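/- **Conventions.** Let $\mathrm{Gr}$ be the category of the real Grassmann algebras $\Lambda_n=\bigwedge\mathbb R^n$, $n\ge 0$, with the parity-preserving unital algebra homomorphisms; $\Lambda=\Lambda_{0}\oplus\Lambda_{1}$ denotes the decomposition of a Grassmann algebra into its even and odd part. For a real super vector space $V=V_0\oplus V_1$ let $\overline V:\mathrm{Gr}\to\mathrm{Sets}$ be the functor $\overline V(\Lambda)=(\Lambda\otimes V)_0=(\Lambda_0\otimes V_0)\oplus(\Lambda_1\otimes V_1)$. Then $\overline{\mathbb R}(\Lambda)=\Lambda_0$ is a ring object, and $\overline V$ is an $\overline{\mathbb R}$-module in $\mathrm{Sets}^{\mathrm{Gr}}$. An $\overline{\mathbb R}$-module in $\mathrm{Sets}^{\mathrm{Gr}}$ is *superrepresentable* if it is isomorphic, as an $\overline{\mathbb R}$-module, to $\overline E$ for some real super vector space $E$ (without topology). A (Banach) *supermanifold* $\mathcal M$ is a functor $\mathrm{Gr}\to\mathrm{Sets}$ with a supersmooth atlas: it is covered by subfunctors that are naturally identified with open subfunctors of $\overline{V}$, $V$ a real Banach super vector space, in such a way that the intersections of charts are open in each chart and that the changes of charts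 are *supersmooth*, i.e. for every $\Lambda$ smooth with $\Lambda_0$-linear derivatives. Morphisms of supermanifolds are the natural transformations that are supersmooth in charts. For a Grassmann algebra $\Lambda$ let $\mathcal P(\Lambda)$ be the superpoint with $\mathcal P(\Lambda)(\Lambda')=\mathrm{Hom}_{\mathrm{Gr}}(\Lambda,\Lambda')$, with its global chart $\mathcal P(\Lambda_n)\cong\overline{\mathbb R^{0|n}}$; a morphism $\varphi:\Lambda\to\Lambda'$ induces $\mathcal P(\varphi):\mathcal P(\Lambda')\to\mathcal P(\Lambda)$. A smooth *super vector bundle* $\pi:\mathcal E\to\mathcal M$ with typical fibre a Banach super vector space $V$ is a functor $\mathcal E$ over $\mathcal M$ that has, over the sets of an open cover of $\mathcal M$ by subfunctors $\mathcal U_i$, trivializations $\mathcal E|_{\mathcal U_i}\cong\mathcal U_i\times\overline V$ with changes that are supersmooth and $\overline{\mathbb R}$-linear in the fibres. Its sections are the supersmooth $\sigma:\mathcal M\to\mathcal E$ with $\pi\circ\sigma=\mathrm{id}$; they form a real vector space $\Gamma(\mathcal M,\mathcal E)$ with the pointwise operations. The bundle $\Pi\mathcal E$ is the super vector bundle over $\mathcal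 M$ with typical fibre $\Pi V$ (reversed parity) that has trivializations over the same $\mathcal U_i$ and whose changes of trivialization $g'_{ij}$ are determined by those of $\mathcal E$ through $c\,g'_{ij}(x,w)=g_{ij}(x,c\,w)$ for all $\Lambda$, odd $c\in\Lambda_1$ and $w\in\overline{\Pi V}(\Lambda)$. **Theorem.** Let $\pi:\mathcal E\to\mathcal M$ be a smooth super vector bundle. Let $\widehat\Gamma(\mathcal M,\mathcal E):\mathrm{Gr}\to\mathrm{Sets}$ be the functor $$\widehat\Gamma(\mathcal M,\mathcal E)(\Lambda)=\Gamma\bigl(\mathcal P(\Lambda)\times\mathcal M,\ \mathrm{pr}_{\mathcal M}^*\mathcal E\bigr),\qquad \widehat\Gamma(\mathcal M,\mathcal E)(\varphi)(\sigma)=\sigma\circ(\mathcal P(\varphi)\times\mathrm{id}_{\mathcal M}),$$ where sections of $\mathrm{pr}_{\mathcal M}^*\mathcal E$ are regarded as morphisms $\mathcal P(\Lambda)\times\mathcal M\to\mathcal E$ over $\mathcal M$. With the pointwise operations $$(\sigma+\tau)(p,m)=\sigma(p,m)+\tau(p,m),\qquad (\lambda\sigma)(p,m)=p(\lambda)\,\sigma(p,m)$$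 for $\lambda\in\Lambda_0$, $p\in\mathcal P(\Lambda)(\Lambda')$ and $m\in\mathcal M(\Lambda')$, this functor is an $\overline{\mathbb R}$-module, and it is superrepresentable. More precisely, the bundle $\Pi\mathcal E$ exists, and as $\overline{\mathbb R}$-modules $$\widehat\Gamma(\mathcal M,\mathcal E)\cong\overline E,\qquad E=E_0\oplus E_1,\quad E_0=\Gamma(\mathcal M,\mathcal E),\quad E_1=\Gamma(\mathcal M,\Pi\mathcal E).$$ -/

import Mathlib

open CategoryTheory TensorProduct
open scoped ContDiff

universe u v w

namespace SuperGeom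

noncomputable section

/-- The object `Λ_rank` of the category `Gr` of real Grassmann algebras. -/
structure Gr where
  rank : ℕ

namespace Gr

/-- The real Grassmann algebra on `rank` odd generators. -/
abbrev Alg (A : Gr) : Type := ExteriorAlgebra ℝ (Fin A.rank → ℝ)

/-- The even (`i = 0`) and odd (`i = 1`) part of the Grassmann algebra. -/
abbrev part (A : Gr) (i : ZMod 2) : Submodule ℝ A.Alg :=
  CliffordAlgebra.evenOdd (0 : QuadraticForm ℝ (Fin A.rank → ℝ)) i

/-- The even subalgebra of the Grassmann algebra. -/
abbrev Even (A : Gr) : Subalgebra ℝ A.Alg :=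
  CliffordAlgebra.even (0 : QuadraticForm ℝ (Fin A.rank → ℝ))

/-- The `i`-th odd generator. -/
def gen (A : Gr) (i : Fin A.rank) : A.part 1 :=
  ⟨ExteriorAlgebra.ι ℝ (Pi.single i 1), CliffordAlgebra.ι_mem_evenOdd_one _ _⟩

/-- A morphism of Grassmann algebras: a unital algebra homomorphism preserving parity. -/
@[ext]
structure Hom (A B : Gr) where
  alg : A.Alg →ₐ[ℝ] B.Alg
  parity : ∀ i, ∀ x ∈ A.part i, alg x ∈ B.part i

instance : Category Gr where
  Hom := Hom
  id A := ⟨AlgHom.id ℝ _, fun _ _ h => h⟩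
  comp f g := ⟨g.alg.comp f.alg, fun i x h => g.parity i _ (f.parity i x h)⟩

variable {A B C : Gr}

/-- The restriction of a morphism to the part of parity `i`. -/
def Hom.res (φ : A ⟶ B) (i : ZMod 2) : A.part i →ₗ[ℝ] B.part i :=
  φ.alg.toLinearMap.restrict (φ.parity i)

/-- The restriction of a morphism to the even subalgebras. -/
def Hom.resEven (φ : A ⟶ B) (a : A.Even) : B.Even := ⟨φ.alg a, φ.parity 0 _ a.2⟩

@[simp] lemma Hom.res_id (i : ZMod 2) : Hom.res (𝟙 A) i = LinearMap.id := rfl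

@[simp] lemma Hom.res_comp (φ : A ⟶ B) (ψ : B ⟶ C) (i : ZMod 2) :
    Hom.res (φ ≫ ψ) i = (Hom.res ψ i).comp (Hom.res φ i) := rfl

/-- Multiplication of homogeneous elements. -/
def mulPart (i j k : ZMod 2) (h : i + j = k) (a : A.part i) : A.part j →ₗ[ℝ] A.part k :=
  (LinearMap.mulLeft ℝ (a : A.Alg)).restrict fun _ hx =>
    h ▸ CliffordAlgebra.evenOdd_mul_le _ _ _ (Submodule.mul_mem_mul a.2 hx)

/-- Each homogeneous part is a module over the even subalgebra, by multiplication. -/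
instance (i : ZMod 2) : SMul A.Even (A.part i) where
  smul a x := mulPart 0 i i (zero_add i) ⟨a, a.2⟩ x

lemma coe_smul_part (i : ZMod 2) (a : A.Even) (x : A.part i) :
    ((a • x : A.part i) : A.Alg) = a * x := rfl

instance (i : ZMod 2) : Module A.Even (A.part i) where
  one_smul x := Subtype.ext (by simp [coe_smul_part])
  mul_smul a b x := Subtype.ext (by simp [coe_smul_part, mul_assoc])
  smul_zero a := Subtype.ext (by simp [coe_smul_part])
  zero_smul x := Subtype.ext (by simp [coe_smul_part])
  smul_add a x y := Subtype.ext (by simp [coe_smul_part, mul_add])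
  add_smul a b x := Subtype.ext (by simp [coe_smul_part, add_mul])

instance (i : ZMod 2) : SMulCommClass ℝ A.Even (A.part i) where
  smul_comm r a x := Subtype.ext (by simp [coe_smul_part])

instance : Module.Finite ℝ A.Alg :=
  Module.Finite.of_basis (Pi.basisFun ℝ (Fin A.rank)).ExteriorAlgebra

instance (i : ZMod 2) : Module.Finite ℝ (A.part i) :=
  FiniteDimensional.finiteDimensional_submodule _

end Gr

/-- `Λ_i ⊗ V`, where `Λ_i` is a homogeneous part of a Grassmann algebra. -/
def GTensor (A : Gr) (i : ZMod 2) (V : Type u) [AddCommGroup V] [Module ℝ V] : Type u :=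
  A.part i ⊗[ℝ] V

namespace GTensor

section Algebraic

variable (A : Gr) {B C : Gr} (i : ZMod 2) (V : Type u) [AddCommGroup V] [Module ℝ V]

instance : AddCommGroup (GTensor A i V) := inferInstanceAs (AddCommGroup (A.part i ⊗[ℝ] V))
instance : Module ℝ (GTensor A i V) := inferInstanceAs (Module ℝ (A.part i ⊗[ℝ] V))
instance : Module A.Even (GTensor A i V) := inferInstanceAs (Module A.Even (A.part i ⊗[ℝ] V))

variable {A V}

/-- The tensor product `L ⊗ T` of two linear maps. -/
def lmap {i j : ZMod 2} {W : Type*} [AddCommGroup W] [Module ℝ W] (L : A.part i →ₗ[ℝ] B.part j)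
    (T : V →ₗ[ℝ] W) : GTensor A i V →ₗ[ℝ] GTensor B j W :=
  TensorProduct.map L T

/-- The map `φ ⊗ id` induced by a morphism `φ` of Grassmann algebras. -/
def map (φ : A ⟶ B) : GTensor A i V →ₗ[ℝ] GTensor B i V :=
  lmap (Gr.Hom.res φ i) LinearMap.id

/-- The pure tensor `p ⊗ v`. -/
def tmul (p : A.part i) : V →ₗ[ℝ] GTensor A i V := TensorProduct.mk ℝ (A.part i) V p

variable {i}

@[elab_as_elim]
lemma induction {P : GTensor A i V → Prop} (h0 : P 0) (ht : ∀ p v, P (tmul i p v))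
    (ha : ∀ x y, P x → P y → P (x + y)) (x : GTensor A i V) : P x :=
  TensorProduct.induction_on (motive := P) x h0 ht ha

lemma smul_tmul (a : A.Even) (p : A.part i) (v : V) : a • tmul i p v = tmul i (a • p) v := rfl

lemma map_tmul (φ : A ⟶ B) (p : A.part i) (v : V) :
    map i φ (tmul i p v) = tmul i (Gr.Hom.res φ i p) v := rfl

lemma lmap_tmul {j : ZMod 2} {W : Type*} [AddCommGroup W] [Module ℝ W]
    (L : A.part i →ₗ[ℝ] B.part j) (T : V →ₗ[ℝ] W) (p : A.part i) (v : V) :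
    lmap L T (tmul i p v) = tmul j (L p) (T v) := rfl

lemma lmap_lmap {W X : Type*} [AddCommGroup W] [Module ℝ W] [AddCommGroup X] [Module ℝ X]
    {j k : ZMod 2} (L : A.part i →ₗ[ℝ] B.part j) (K : B.part j →ₗ[ℝ] C.part k) (T : V →ₗ[ℝ] W)
    (S : W →ₗ[ℝ] X) (x : GTensor A i V) :
    lmap K S (lmap L T x) = lmap (K.comp L) (S.comp T) x := by
  induction x using GTensor.induction with
  | h0 => simp
  | ht p v => rfl
  | ha x y hx hy => simp only [map_add, hx, hy]

lemma lmap_smul {W : Type*} [AddCommGroup W] [Module ℝ W] (T : V →ₗ[ℝ] W) (a : A.Even)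
    (x : GTensor A i V) : lmap LinearMap.id T (a • x) = a • lmap LinearMap.id T x := by
  induction x using GTensor.induction with
  | h0 => simp
  | ht p v => rfl
  | ha x y hx hy => simp only [smul_add, map_add, hx, hy]

lemma lmap_id (x : GTensor A i V) : lmap LinearMap.id LinearMap.id x = x := by
  induction x using GTensor.induction with
  | h0 => simp
  | ht p v => rfl
  | ha x y hx hy => simp only [map_add, hx, hy]

lemma lmap_zero {j : ZMod 2} {W : Type*} [AddCommGroup W] [Module ℝ W]
    (L : A.part i →ₗ[ℝ] B.part j) (x : GTensor A i V) : lmap L (0 : V →ₗ[ℝ] W) x = 0 := by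
  induction x using GTensor.induction with
  | h0 => simp
  | ht p v => simp [lmap_tmul]
  | ha x y hx hy => simp only [map_add, hx, hy, add_zero]

lemma lmap_add {j : ZMod 2} {W : Type*} [AddCommGroup W] [Module ℝ W]
    (L : A.part i →ₗ[ℝ] B.part j) (S T : V →ₗ[ℝ] W) (x : GTensor A i V) :
    lmap L S x + lmap L T x = lmap L (S + T) x := by
  induction x using GTensor.induction with
  | h0 => simp
  | ht p v => simp [lmap_tmul]
  | ha x y hx hy => simp only [map_add, ← hx, ← hy]; abel

variable (i)

lemma map_id (x : GTensor A i V) : map i (𝟙 A) x = x := by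
  induction x using GTensor.induction with
  | h0 => simp
  | ht p v => rfl
  | ha x y hx hy => rw [map_add, hx, hy]

lemma map_comp (φ : A ⟶ B) (ψ : B ⟶ C) (x : GTensor A i V) :
    map i (φ ≫ ψ) x = map i ψ (map i φ x) := by
  induction x using GTensor.induction with
  | h0 => simp
  | ht p v => rfl
  | ha x y hx hy => simp only [map_add, hx, hy]

lemma map_smul_even (φ : A ⟶ B) (a : A.Even) (x : GTensor A i V) :
    map i φ (a • x) = Gr.Hom.resEven φ a • map i φ x := by
  induction x using GTensor.induction with
  | h0 => simp
  | ht p v =>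
    rw [smul_tmul, map_tmul, map_tmul, smul_tmul]
    congr 2
    exact Subtype.ext (map_mul φ.alg (a : A.Alg) (p : A.Alg))
  | ha x y hx hy => simp only [smul_add, map_add, hx, hy]

/-- Left multiplication by a homogeneous element of the Grassmann algebra. -/
def mulLeft (i j k : ZMod 2) (h : i + j = k) (a : A.part i) : GTensor A j V →ₗ[ℝ] GTensor A k V :=
  lmap (Gr.mulPart i j k h a) LinearMap.id

/-- Coordinates of `Λ_i ⊗ V` with respect to a basis of `Λ_i`. -/
def coord : GTensor A i V ≃ₗ[ℝ] (Fin (Module.finrank ℝ (A.part i)) → V) :=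
  (TensorProduct.equivFinsuppOfBasisLeft (Module.finBasis ℝ (A.part i))).trans
    (Finsupp.linearEquivFunOnFinite ℝ V _)

end Algebraic

section Normed

variable (A : Gr) (i : ZMod 2) (V : Type u) [NormedAddCommGroup V] [NormedSpace ℝ V]

/-- For a normed space `V`, the space `Λ_i ⊗ V` is normed by means of coordinates (all choices of
a basis of the finite-dimensional space `Λ_i` give equivalent norms). -/
instance : NormedAddCommGroup (GTensor A i V) :=
  NormedAddCommGroup.induced _ _ (coord i (A := A) (V := V)) (coord i).injective

instance : NormedSpace ℝ (GTensor A i V) :=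
  NormedSpace.induced ℝ _ _ (coord i (A := A) (V := V))


variable {A i V} {B : Gr} {j : ZMod 2} {W : Type*} [NormedAddCommGroup W] [NormedSpace ℝ W]

lemma isometry_coord : Isometry (coord i (A := A) (V := V)) :=
  AddMonoidHomClass.isometry_of_norm _ fun _ => rfl

lemma coord_tmul (p : A.part i) (v : V) (k) :
    coord i (tmul i p v) k = (Module.finBasis ℝ (A.part i)).repr p k • v :=
  TensorProduct.equivFinsuppOfBasisLeft_apply_tmul_apply _ _ _ _

lemma continuous_tmul (p : A.part i) : Continuous (tmul i p : V → GTensor A i V) := by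
  rw [isometry_coord.isEmbedding.continuous_iff]
  refine continuous_pi fun k => ?_
  simp only [Function.comp_apply, coord_tmul]
  fun_prop

lemma eq_sum_tmul (x : GTensor A i V) :
    x = ∑ k, tmul i (Module.finBasis ℝ (A.part i) k) (coord i x k) := by
  apply (coord i).injective
  ext k
  simp [map_sum, coord_tmul, Finsupp.single_apply]

lemma continuous_lmap (L : A.part i →ₗ[ℝ] B.part j) (T : V →L[ℝ] W) :
    Continuous (lmap L (T : V →ₗ[ℝ] W)) := by
  have h : ∀ x : GTensor A i V, lmap L (T : V →ₗ[ℝ] W) x =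
      ∑ k, tmul j (L (Module.finBasis ℝ (A.part i) k)) (T (coord i x k)) := by
    intro x
    conv_lhs => rw [eq_sum_tmul x, map_sum]
    rfl
  rw [funext h]
  refine continuous_finsetSum _ fun k _ => (continuous_tmul _).comp (T.continuous.comp ?_)
  exact (continuous_apply k).comp isometry_coord.continuous

end Normed

end GTensor

/-! ### Super vector spaces and their functors of points -/

/-- The set `(Λ ⊗ V)_0 = (Λ_0 ⊗ V_0) ⊕ (Λ_1 ⊗ V_1)` of `Λ`-points of the super vector space
`V = V₀ ⊕ V₁`, a module over the even part of `Λ`. -/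
abbrev Bar (A : Gr) (V₀ V₁ : Type u) [AddCommGroup V₀] [Module ℝ V₀] [AddCommGroup V₁]
    [Module ℝ V₁] : Type u :=
  GTensor A 0 V₀ × GTensor A 1 V₁

namespace Bar

variable {A B C : Gr} {V₀ V₁ : Type u} [AddCommGroup V₀] [Module ℝ V₀] [AddCommGroup V₁]
    [Module ℝ V₁]

/-- The map `(φ ⊗ id)` on points. -/
def map (φ : A ⟶ B) : Bar A V₀ V₁ →ₗ[ℝ] Bar B V₀ V₁ :=
  (GTensor.map 0 φ).prodMap (GTensor.map 1 φ)

lemma map_id (x : Bar A V₀ V₁) : map (𝟙 A) x = x :=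
  Prod.ext (GTensor.map_id 0 x.1) (GTensor.map_id 1 x.2)

lemma map_comp (φ : A ⟶ B) (ψ : B ⟶ C) (x : Bar A V₀ V₁) : map (φ ≫ ψ) x = map ψ (map φ x) :=
  Prod.ext (GTensor.map_comp 0 φ ψ x.1) (GTensor.map_comp 1 φ ψ x.2)

lemma map_smul_even (φ : A ⟶ B) (a : A.Even) (x : Bar A V₀ V₁) :
    map φ (a • x) = Gr.Hom.resEven φ a • map φ x :=
  Prod.ext (GTensor.map_smul_even 0 φ a x.1) (GTensor.map_smul_even 1 φ a x.2)

/-- Multiplication by an odd element of `Λ`, as a map `(Λ ⊗ ΠV)_0 → (Λ ⊗ V)_0`, where `ΠV` is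
`V` with reversed parity. -/
def oddMul (a : A.part 1) : Bar A V₁ V₀ →ₗ[ℝ] Bar A V₀ V₁ :=
  ((GTensor.mulLeft 1 1 0 (by decide) a).comp (LinearMap.snd ℝ _ _)).prod
    ((GTensor.mulLeft 1 0 1 (by decide) a).comp (LinearMap.fst ℝ _ _))

end Bar

/-- A real Banach super vector space `V = even ⊕ odd`. -/
structure SBanach : Type (u + 1) where
  even : Type u
  odd : Type u
  [normedEven : NormedAddCommGroup even]
  [spaceEven : NormedSpace ℝ even]
  [completeEven : CompleteSpace even]
  [normedOdd : NormedAddCommGroup odd]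
  [spaceOdd : NormedSpace ℝ odd]
  [completeOdd : CompleteSpace odd]

namespace SBanach

attribute [instance] normedEven spaceEven completeEven normedOdd spaceOdd completeOdd

/-- The direct sum of super vector spaces. -/
abbrev prod (V : SBanach.{u}) (W : SBanach.{v}) : SBanach.{max u v} :=
  ⟨V.even × W.even, V.odd × W.odd⟩

/-- The change of parity. -/
abbrev flip (V : SBanach.{u}) : SBanach.{u} := ⟨V.odd, V.even⟩

/-- The purely odd super vector space `ℝ^{0|k}`. -/
abbrev oddSpace (k : ℕ) : SBanach.{0} := ⟨PUnit, Fin k → ℝ⟩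

end SBanach

/-- The `Λ`-points of a Banach super vector space. -/
abbrev Pt (A : Gr) (V : SBanach.{u}) : Type u := Bar A V.even V.odd

namespace GTensor

section Prod

variable (A : Gr) (i : ZMod 2) (V : Type u) (W : Type v) [NormedAddCommGroup V] [NormedSpace ℝ V]
  [NormedAddCommGroup W] [NormedSpace ℝ W]

/-- `Λ_i ⊗ (V ⊕ W) = (Λ_i ⊗ V) ⊕ (Λ_i ⊗ W)`. -/
def prodEquiv : (GTensor A i V × GTensor A i W) ≃L[ℝ] GTensor A i (V × W) where
  toFun p := lmap LinearMap.id (ContinuousLinearMap.inl ℝ V W : V →ₗ[ℝ] V × W) p.1 +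
      lmap LinearMap.id (ContinuousLinearMap.inr ℝ V W : W →ₗ[ℝ] V × W) p.2
  invFun q := (lmap LinearMap.id (ContinuousLinearMap.fst ℝ V W : V × W →ₗ[ℝ] V) q,
      lmap LinearMap.id (ContinuousLinearMap.snd ℝ V W : V × W →ₗ[ℝ] W) q)
  map_add' p q := by simp only [Prod.fst_add, Prod.snd_add, map_add]; abel
  map_smul' r p := by simp
  left_inv p := by
    ext
    · simp only [map_add, lmap_lmap]
      exact (congrArg₂ (· + ·) (lmap_id p.1) (lmap_zero LinearMap.id p.2)).trans (add_zero _)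
    · simp only [map_add, lmap_lmap]
      exact (congrArg₂ (· + ·) (lmap_zero LinearMap.id p.1) (lmap_id p.2)).trans (zero_add _)
  right_inv q := by
    simp only [lmap_lmap, lmap_add]
    refine Eq.trans ?_ (lmap_id q)
    congr 2
    ext <;> simp
  continuous_toFun := ((continuous_lmap _ _).comp continuous_fst).add
    ((continuous_lmap _ _).comp continuous_snd)
  continuous_invFun := (continuous_lmap _ _).prodMk (continuous_lmap _ _)

end Prod

end GTensor

/-- The `Λ`-points of a direct sum. -/
def join (A : Gr) (V : SBanach.{u}) (W : SBanach.{v}) :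
    (Pt A V × Pt A W) ≃L[ℝ] Pt A (V.prod W) :=
  (ContinuousLinearEquiv.prodProdProdComm ℝ _ _ _ _).trans
    ((GTensor.prodEquiv A 0 V.even W.even).prodCongr (GTensor.prodEquiv A 1 V.odd W.odd))

lemma join_smul (A : Gr) (V : SBanach.{u}) (W : SBanach.{v}) (a : A.Even) (p : Pt A V × Pt A W) :
    join A V W (a • p) = a • join A V W p := by
  ext <;> simp [join, GTensor.prodEquiv, GTensor.lmap_smul]

lemma join_map {A B : Gr} (φ : A ⟶ B) (V : SBanach.{u}) (W : SBanach.{v})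
    (p : Pt A V × Pt A W) :
    join B V W (Bar.map φ p.1, Bar.map φ p.2) = Bar.map φ (join A V W p) := by
  ext <;> simp [join, GTensor.prodEquiv, Bar.map, GTensor.map, GTensor.lmap_lmap]

/-! ### Supersmooth maps and supermanifolds -/

section SuperSmooth

variable (A : Gr) {X Y Z : Type*}
  [NormedAddCommGroup X] [NormedSpace ℝ X] [Module A.Even X]
  [NormedAddCommGroup Y] [NormedSpace ℝ Y] [Module A.Even Y]
  [NormedAddCommGroup Z] [NormedSpace ℝ Z] [Module A.Even Z]

/-- On the open set `D`, the map `g` is smooth and its derivatives are linear over the even part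
of the Grassmann algebra. -/
def SuperSmoothOn (g : X → Y) (D : Set X) : Prop :=
  ContDiffOn ℝ ∞ g D ∧ ∀ x ∈ D, ∀ (a : A.Even) (v : X), fderiv ℝ g x (a • v) = a • fderiv ℝ g x v

variable {A}

lemma SuperSmoothOn.differentiableAt {g : X → Y} {D : Set X} (h : SuperSmoothOn A g D)
    (hD : IsOpen D) {x : X} (hx : x ∈ D) : DifferentiableAt ℝ g x :=
  ((h.1 x hx).contDiffAt (hD.mem_nhds hx)).differentiableAt (by simp)

lemma SuperSmoothOn.mono {g : X → Y} {D D' : Set X} (h : SuperSmoothOn A g D) (hs : D' ⊆ D) :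
    SuperSmoothOn A g D' :=
  ⟨h.1.mono hs, fun x hx => h.2 x (hs hx)⟩

/-- Supersmoothness is local. -/
lemma SuperSmoothOn.of_local {g : X → Y} {D : Set X}
    (H : ∀ x ∈ D, ∃ D' g', IsOpen D' ∧ x ∈ D' ∧ SuperSmoothOn A g' D' ∧ Set.EqOn g g' D') :
    SuperSmoothOn A g D := by
  refine ⟨fun x hx => ?_, fun x hx a v => ?_⟩
  · obtain ⟨D', g', ho, hxD, hg, he⟩ := H x hx
    have h1 : ContDiffAt ℝ ∞ g' x := (hg.1 x hxD).contDiffAt (ho.mem_nhds hxD)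
    exact (h1.congr_of_eventuallyEq (he.eventuallyEq_of_mem (ho.mem_nhds hxD))).contDiffWithinAt
  · obtain ⟨D', g', ho, hxD, hg, he⟩ := H x hx
    rw [(he.eventuallyEq_of_mem (ho.mem_nhds hxD)).fderiv_eq]
    exact hg.2 x hxD a v

lemma SuperSmoothOn.comp {g : X → Y} {h : Y → Z} {D : Set X} {D' : Set Y}
    (hh : SuperSmoothOn A h D') (hg : SuperSmoothOn A g D) (ho : IsOpen D) (ho' : IsOpen D')
    (hm : Set.MapsTo g D D') : SuperSmoothOn A (h ∘ g) D := by
  refine ⟨hh.1.comp hg.1 hm, fun x hx a v => ?_⟩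
  rw [fderiv_comp x (hh.differentiableAt ho' (hm hx)) (hg.differentiableAt ho hx)]
  simp [hg.2 x hx, hh.2 _ (hm hx)]

lemma SuperSmoothOn.prodMk {g : X → Y} {h : X → Z} {D : Set X}
    (hg : SuperSmoothOn A g D) (hh : SuperSmoothOn A h D) (ho : IsOpen D) :
    SuperSmoothOn A (fun x => (g x, h x)) D := by
  refine ⟨hg.1.prodMk hh.1, fun x hx a v => ?_⟩
  rw [(hg.differentiableAt ho hx).fderiv_prodMk (hh.differentiableAt ho hx)]
  simp [hg.2 x hx, hh.2 x hx]

lemma SuperSmoothOn.of_linear (L : X →L[ℝ] Y) (hL : ∀ (a : A.Even) v, L (a • v) = a • L v)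
    (D : Set X) : SuperSmoothOn A L D :=
  ⟨L.contDiff.contDiffOn, fun x _ a v => by simp [hL]⟩

end SuperSmooth

/-- A Banach supermanifold: a functor `pts` on the category of Grassmann algebras with a
supersmooth atlas.  The `i`-th chart identifies, naturally in the Grassmann algebra, the subfunctor
`source i` of `pts` with an open subfunctor of the functor of points of the Banach super vector
space `model i`; the charts cover, the intersection of two charts is open in each of them, and the
changes of charts are supersmooth. The manifold structure of each set `pts.obj A` is the one given
by the charts. -/
structure SuperManifold : Type (u + 1) where
  pts : Gr ⥤ Type u
  ι : Type u
  model : ι → SBanach.{u}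
  source : ι → ∀ A : Gr, Set (pts.obj A)
  coord : ∀ (i : ι) (A : Gr), pts.obj A → Pt A (model i)
  injOn : ∀ i A, Set.InjOn (coord i A) (source i A)
  source_map : ∀ i {A B : Gr} (φ : A ⟶ B), ∀ x ∈ source i A, pts.map φ x ∈ source i B
  coord_map : ∀ i {A B : Gr} (φ : A ⟶ B), ∀ x ∈ source i A,
    coord i B (pts.map φ x) = Bar.map φ (coord i A x)
  cover : ∀ A x, ∃ i, x ∈ source i A
  isOpen_overlap : ∀ i j A, IsOpen (coord i A '' (source i A ∩ source j A))
  transition : ∀ i j A, ∃ g : Pt A (model i) → Pt A (model j),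
    SuperSmoothOn A g (coord i A '' (source i A ∩ source j A)) ∧
    ∀ x ∈ source i A ∩ source j A, g (coord i A x) = coord j A x

namespace SuperManifold

variable (X : SuperManifold.{u}) {A : Gr} {Y Z : Type*}
  [NormedAddCommGroup Y] [NormedSpace ℝ Y] [Module A.Even Y]
  [NormedAddCommGroup Z] [NormedSpace ℝ Z] [Module A.Even Z]

/-- `S` is open in the manifold of `A`-points of `X`. -/
def IsOpenSet (S : Set (X.pts.obj A)) : Prop :=
  ∀ i, IsOpen (X.coord i A '' (X.source i A ∩ S))

/-- `S` is open, and `f` is supersmooth on `S`, when expressed in the charts of `X`. -/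
def SmoothOn (f : X.pts.obj A → Y) (S : Set (X.pts.obj A)) : Prop :=
  X.IsOpenSet S ∧ ∀ i, ∃ g : Pt A (X.model i) → Y,
    SuperSmoothOn A g (X.coord i A '' (X.source i A ∩ S)) ∧
    ∀ x ∈ X.source i A ∩ S, g (X.coord i A x) = f x

variable {X}

lemma isOpenSet_source (j : X.ι) : X.IsOpenSet (X.source j A) := fun i => X.isOpen_overlap i j A

lemma smoothOn_coord (j : X.ι) : X.SmoothOn (X.coord j A) (X.source j A) :=
  ⟨isOpenSet_source j, fun i => X.transition i j A⟩

lemma image_inter (i : X.ι) (S T : Set (X.pts.obj A)) :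
    X.coord i A '' (X.source i A ∩ (S ∩ T)) =
      X.coord i A '' (X.source i A ∩ S) ∩ X.coord i A '' (X.source i A ∩ T) := by
  rw [Set.inter_inter_distrib_left]
  exact (X.injOn i A).image_inter Set.inter_subset_left Set.inter_subset_left

lemma IsOpenSet.inter {S T : Set (X.pts.obj A)} (hS : X.IsOpenSet S) (hT : X.IsOpenSet T) :
    X.IsOpenSet (S ∩ T) := fun i => by
  rw [image_inter]; exact (hS i).inter (hT i)

lemma isOpenSet_univ : X.IsOpenSet (Set.univ : Set (X.pts.obj A)) := fun i => by
  simpa using X.isOpen_overlap i i A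

lemma SmoothOn.mono {f : X.pts.obj A → Y} {S T : Set (X.pts.obj A)} (h : X.SmoothOn f S)
    (hT : X.IsOpenSet T) (hs : T ⊆ S) : X.SmoothOn f T := by
  refine ⟨hT, fun i => ?_⟩
  obtain ⟨g, hg, hf⟩ := h.2 i
  exact ⟨g, hg.mono (Set.image_mono (Set.inter_subset_inter_right _ hs)),
    fun x hx => hf x ⟨hx.1, hs hx.2⟩⟩

/-- A function is supersmooth if it is so near each point, in one chart. -/
lemma SmoothOn.of_local {f : X.pts.obj A → Y} {S : Set (X.pts.obj A)}
    (H : ∀ x ∈ S, ∃ i, x ∈ X.source i A ∧ ∃ (D : Set (Pt A (X.model i))) (g : _ → Y),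
      IsOpen D ∧ X.coord i A x ∈ D ∧ D ⊆ X.coord i A '' (X.source i A ∩ S) ∧
      SuperSmoothOn A g D ∧ ∀ y ∈ X.source i A, X.coord i A y ∈ D → g (X.coord i A y) = f y) :
    X.SmoothOn f S := by
  classical
  -- the same statement in all charts
  have H' : ∀ i, ∀ x ∈ X.source i A ∩ S, ∃ (D : Set (Pt A (X.model i))) (g : _ → Y),
      IsOpen D ∧ X.coord i A x ∈ D ∧ D ⊆ X.coord i A '' (X.source i A ∩ S) ∧
      SuperSmoothOn A g D ∧ ∀ y ∈ X.source i A, X.coord i A y ∈ D → g (X.coord i A y) = f y := by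
    rintro j x ⟨hxj, hxS⟩
    obtain ⟨i, hxi, D, g, hD, hxD, hDS, hg, hf⟩ := H x hxS
    obtain ⟨t, ht, htc⟩ := X.transition j i A
    have ho := X.isOpen_overlap j i A
    have hopen : IsOpen (X.coord j A '' (X.source j A ∩ X.source i A) ∩ t ⁻¹' D) :=
      ht.1.continuousOn.isOpen_inter_preimage ho hD
    refine ⟨X.coord j A '' (X.source j A ∩ X.source i A) ∩ t ⁻¹' D, g ∘ t, hopen, ?_, ?_, ?_, ?_⟩
    · exact ⟨⟨x, ⟨hxj, hxi⟩, rfl⟩, by simpa [htc x ⟨hxj, hxi⟩] using hxD⟩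
    · rintro _ ⟨⟨y, ⟨hyj, hyi⟩, rfl⟩, hy⟩
      rw [Set.mem_preimage, htc y ⟨hyj, hyi⟩] at hy
      obtain ⟨z, ⟨hzi, hzS⟩, hz⟩ := hDS hy
      have := X.injOn i A hzi hyi hz
      subst this
      exact ⟨z, ⟨hyj, hzS⟩, rfl⟩
    · exact hg.comp (ht.mono Set.inter_subset_left) hopen hD fun _ h => h.2
    · rintro y hyj ⟨⟨z, ⟨hzj, hzi⟩, hz⟩, hy⟩
      have := X.injOn j A hzj hyj hz
      subst this
      rw [Set.mem_preimage, htc z ⟨hzj, hzi⟩] at hy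
      simp only [Function.comp_apply, htc z ⟨hzj, hzi⟩]
      exact hf z hzi hy
  refine ⟨fun i => ?_, fun i => ?_⟩
  · rw [isOpen_iff_forall_mem_open]
    rintro _ ⟨x, hx, rfl⟩
    obtain ⟨D, g, hD, hxD, hDS, -⟩ := H' i x hx
    exact ⟨D, hDS, hD, hxD⟩
  · let g : Pt A (X.model i) → Y := fun p =>
      if h : ∃ x, x ∈ X.source i A ∩ S ∧ X.coord i A x = p then f h.choose else 0
    have hg : ∀ x ∈ X.source i A ∩ S, g (X.coord i A x) = f x := by
      intro x hx
      have h : ∃ y, y ∈ X.source i A ∩ S ∧ X.coord i A y = X.coord i A x := ⟨x, hx, rfl⟩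
      simp only [g, dif_pos h]
      rw [X.injOn i A h.choose_spec.1.1 hx.1 h.choose_spec.2]
    refine ⟨g, SuperSmoothOn.of_local ?_, hg⟩
    rintro _ ⟨x, hx, rfl⟩
    obtain ⟨D, g', hD, hxD, hDS, hg', hf⟩ := H' i x hx
    refine ⟨D, g', hD, hxD, hg', ?_⟩
    intro p hp
    obtain ⟨y, hy, rfl⟩ := hDS hp
    rw [hg y hy, hf y hy.1 hp]

lemma SmoothOn.comp {f : X.pts.obj A → Y} {S : Set (X.pts.obj A)} {h : Y → Z} {D : Set Y}
    (hh : SuperSmoothOn A h D) (hD : IsOpen D) (hf : X.SmoothOn f S) (hm : Set.MapsTo f S D) :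
    X.SmoothOn (h ∘ f) S := by
  refine ⟨hf.1, fun i => ?_⟩
  obtain ⟨g, hg, hgf⟩ := hf.2 i
  refine ⟨h ∘ g, hh.comp hg (hf.1 i) hD ?_, fun x hx => by simp [hgf x hx]⟩
  rintro _ ⟨x, hx, rfl⟩
  rw [hgf x hx]; exact hm hx.2

lemma SmoothOn.prodMk {f : X.pts.obj A → Y} {h : X.pts.obj A → Z} {S : Set (X.pts.obj A)}
    (hf : X.SmoothOn f S) (hh : X.SmoothOn h S) : X.SmoothOn (fun x => (f x, h x)) S := by
  refine ⟨hf.1, fun i => ?_⟩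
  obtain ⟨g, hg, hgf⟩ := hf.2 i
  obtain ⟨k, hk, hkh⟩ := hh.2 i
  exact ⟨_, hg.prodMk hk (hf.1 i), fun x hx => by simp [hgf x hx, hkh x hx]⟩

/-- A morphism of functors between supermanifolds is supersmooth if it is so in charts. -/
def IsSuperSmooth {X : SuperManifold.{u}} {Y : SuperManifold.{v}}
    (f : ∀ A, X.pts.obj A → Y.pts.obj A) : Prop :=
  ∀ (A : Gr) (j : Y.ι), X.SmoothOn (fun x => Y.coord j A (f A x)) (f A ⁻¹' Y.source j A)

/-- The pullback of a supersmooth function along a supersmooth morphism. -/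
lemma IsSuperSmooth.smoothOn {W : SuperManifold.{v}} {F : ∀ A, X.pts.obj A → W.pts.obj A}
    (hF : IsSuperSmooth F) {h : W.pts.obj A → Y} {T : Set (W.pts.obj A)} (hh : W.SmoothOn h T) :
    X.SmoothOn (fun x => h (F A x)) (F A ⁻¹' T) := by
  apply SmoothOn.of_local
  intro x hx
  obtain ⟨i, hi⟩ := X.cover A x
  obtain ⟨j, hj⟩ := W.cover A (F A x)
  obtain ⟨g, hg, hgf⟩ := (hF A j).2 i
  obtain ⟨k, hk, hkh⟩ := hh.2 j
  have hD1 := (hF A j).1 i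
  have hD2 := hh.1 j
  have hopen := hg.1.continuousOn.isOpen_inter_preimage hD1 hD2
  refine ⟨i, hi, _, k ∘ g, hopen, ?_, ?_, ?_, ?_⟩
  · refine ⟨⟨x, ⟨hi, hj⟩, rfl⟩, ?_⟩
    rw [Set.mem_preimage, hgf x ⟨hi, hj⟩]
    exact ⟨F A x, ⟨hj, hx⟩, rfl⟩
  · rintro _ ⟨⟨y, hy, rfl⟩, hy'⟩
    rw [Set.mem_preimage, hgf y hy] at hy'
    obtain ⟨z, hz, hzy⟩ := hy'
    have := W.injOn j A hz.1 hy.2 hzy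
    subst this
    exact ⟨y, ⟨hy.1, hz.2⟩, rfl⟩
  · exact hk.comp (hg.mono Set.inter_subset_left) hopen hD2 fun _ h => h.2
  · rintro y hy ⟨⟨z, hz, hzy⟩, hy'⟩
    have := X.injOn i A hz.1 hy hzy
    subst this
    rw [Set.mem_preimage, hgf z hz] at hy'
    obtain ⟨w, hw, hwz⟩ := hy'
    have := W.injOn j A hw.1 hz.2 hwz
    simp only [Function.comp_apply, hgf z hz]
    exact hkh _ ⟨hz.2, this ▸ hw.2⟩

lemma IsSuperSmooth.comp {W : SuperManifold.{v}} {U : SuperManifold.{w}}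
    {G : ∀ A, W.pts.obj A → U.pts.obj A} {F : ∀ A, X.pts.obj A → W.pts.obj A}
    (hG : IsSuperSmooth G) (hF : IsSuperSmooth F) : IsSuperSmooth (fun A x => G A (F A x)) :=
  fun A j => hF.smoothOn (hG A j)

end SuperManifold

/-! ### Superpoints -/

namespace Gr

variable {A B : Gr}

lemma ι_mul (v : Fin A.rank → ℝ) (x : A.Alg) :
    ExteriorAlgebra.ι ℝ v * x =
      CliffordAlgebra.involute (Q := (0 : QuadraticForm ℝ (Fin A.rank → ℝ))) x *
        ExteriorAlgebra.ι ℝ v := by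
  induction x using CliffordAlgebra.induction with
  | algebraMap r => simpa using (Algebra.commutes r _).symm
  | ι w =>
    rw [CliffordAlgebra.involute_ι, neg_mul]
    exact eq_neg_of_add_eq_zero_left (ExteriorAlgebra.ι_add_mul_swap v w)
  | mul x y hx hy => rw [← mul_assoc, hx, mul_assoc, hy, map_mul, mul_assoc]
  | add x y hx hy => rw [mul_add, hx, hy, map_add, add_mul]

lemma mul_even (x a : A.Alg) (ha : a ∈ A.part 0) : x * a = a * x := by
  induction x using CliffordAlgebra.induction with
  | algebraMap r => exact Algebra.commutes r a
  | ι v =>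
    have h := ι_mul v a
    rwa [CliffordAlgebra.involute_eq_of_mem_even ha] at h
  | mul x y hx hy => rw [mul_assoc, hy, ← mul_assoc, hx, mul_assoc]
  | add x y hx hy => rw [add_mul, hx, hy, mul_add]

lemma odd_mul (x : A.Alg) (hx : x ∈ A.part 1) (y : A.Alg) :
    x * y = CliffordAlgebra.involute (Q := (0 : QuadraticForm ℝ (Fin A.rank → ℝ))) y * x := by
  induction x, hx using CliffordAlgebra.odd_induction with
  | ι v => exact ι_mul v y
  | add x z _ _ ihx ihz => rw [add_mul, ihx, ihz, mul_add]
  | ι_mul_ι_mul v w x _ ih =>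
    have h1 := ι_mul w (CliffordAlgebra.involute (Q := (0 : QuadraticForm ℝ (Fin A.rank → ℝ))) y)
    have h2 := ι_mul v y
    rw [CliffordAlgebra.involute_involute] at h1
    change ExteriorAlgebra.ι ℝ v * ExteriorAlgebra.ι ℝ w * x * y =
      _ * (ExteriorAlgebra.ι ℝ v * ExteriorAlgebra.ι ℝ w * x)
    rw [mul_assoc, ih, ← mul_assoc, mul_assoc (ExteriorAlgebra.ι ℝ v), h1, ← mul_assoc, h2]
    simp only [mul_assoc]

lemma odd_mul_self (x : A.Alg) (hx : x ∈ A.part 1) : x * x = 0 := by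
  have h := odd_mul x hx x
  rw [CliffordAlgebra.involute_eq_of_mem_odd hx, neg_mul, eq_neg_iff_add_eq_zero] at h
  have h2 : (2 : ℝ) • (x * x) = 0 := by rw [two_smul]; exact h
  exact (smul_eq_zero.mp h2).resolve_left two_ne_zero

/-- The morphism of Grassmann algebras with given odd values on the generators. -/
def homOfGen (y : Fin A.rank → B.part 1) : A ⟶ B where
  alg := ExteriorAlgebra.lift ℝ
    ⟨(Submodule.subtype _).comp (Fintype.linearCombination ℝ y),
      fun _ => odd_mul_self _ (Subtype.prop _)⟩
  parity i x hx := by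
    have hι : ∀ v, ExteriorAlgebra.lift ℝ
        ⟨(Submodule.subtype _).comp (Fintype.linearCombination ℝ y),
          fun _ => odd_mul_self _ (Subtype.prop _)⟩ (ExteriorAlgebra.ι ℝ v) ∈ B.part 1 := by
      intro v
      rw [ExteriorAlgebra.lift_ι_apply]
      exact Subtype.prop _
    have hmul : ∀ (i : ZMod 2) (v w : Fin A.rank → ℝ) (z : A.Alg), ExteriorAlgebra.lift ℝ
        ⟨(Submodule.subtype _).comp (Fintype.linearCombination ℝ y),
          fun _ => odd_mul_self _ (Subtype.prop _)⟩ z ∈ B.part i → ExteriorAlgebra.lift ℝ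
        ⟨(Submodule.subtype _).comp (Fintype.linearCombination ℝ y),
          fun _ => odd_mul_self _ (Subtype.prop _)⟩
          (ExteriorAlgebra.ι ℝ v * ExteriorAlgebra.ι ℝ w * z) ∈ B.part i := by
      intro i v w z hz
      rw [map_mul, map_mul]
      have h := SetLike.mul_mem_graded (A := B.part) (SetLike.mul_mem_graded (A := B.part)
        (hι v) (hι w)) hz
      rwa [show (1 : ZMod 2) + 1 + i = i by rw [show (1 : ZMod 2) + 1 = 0 by decide, zero_add]] at h
    rcases (by decide : ∀ i : ZMod 2, i = 0 ∨ i = 1) i with rfl | rfl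
    · induction x, hx using CliffordAlgebra.even_induction with
      | algebraMap r =>
        rw [AlgHom.commutes]
        exact SetLike.algebraMap_mem_graded B.part r
      | add x y _ _ hx hy => rw [map_add]; exact add_mem hx hy
      | ι_mul_ι_mul v w z _ hz => exact hmul 0 v w z hz
    · induction x, hx using CliffordAlgebra.odd_induction with
      | ι v => exact hι v
      | add x y _ _ hx hy => rw [map_add]; exact add_mem hx hy
      | ι_mul_ι_mul v w z _ hz => exact hmul 1 v w z hz

lemma homOfGen_gen (y : Fin A.rank → B.part 1) (i : Fin A.rank) :
    Hom.res (homOfGen y) 1 (A.gen i) = y i := by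
  apply Subtype.ext
  change ExteriorAlgebra.lift ℝ _ (ExteriorAlgebra.ι ℝ (Pi.single i 1)) = _
  rw [ExteriorAlgebra.lift_ι_apply]
  simp

lemma hom_ext {f g : A ⟶ B} (h : ∀ i, Hom.res f 1 (A.gen i) = Hom.res g 1 (A.gen i)) : f = g := by
  apply Hom.ext
  apply ExteriorAlgebra.hom_ext
  ext i
  exact congrArg Subtype.val (h i)

end Gr

namespace GTensor

variable {A : Gr}

/-- `id ⊗ T` as a continuous linear map. -/
def clmap (A : Gr) (i : ZMod 2) {V : Type u} {W : Type v} [NormedAddCommGroup V] [NormedSpace ℝ V]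
    [NormedAddCommGroup W] [NormedSpace ℝ W] (T : V →L[ℝ] W) :
    GTensor A i V →L[ℝ] GTensor A i W where
  toLinearMap := lmap LinearMap.id (T : V →ₗ[ℝ] W)
  cont := continuous_lmap _ T

lemma clmap_smul {i : ZMod 2} {V : Type u} {W : Type v} [NormedAddCommGroup V] [NormedSpace ℝ V]
    [NormedAddCommGroup W] [NormedSpace ℝ W] (T : V →L[ℝ] W) (a : A.Even) (x : GTensor A i V) :
    clmap A i T (a • x) = a • clmap A i T x := lmap_smul _ a x

lemma clmap_tmul {i : ZMod 2} {V : Type u} {W : Type v} [NormedAddCommGroup V] [NormedSpace ℝ V]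
    [NormedAddCommGroup W] [NormedSpace ℝ W] (T : V →L[ℝ] W) (p : A.part i) (v : V) :
    clmap A i T (tmul i p v) = tmul i p (T v) := rfl

/-- `Λ_i ⊗ ℝ = Λ_i`. -/
def toPart (i : ZMod 2) : GTensor A i ℝ ≃ₗ[ℝ] A.part i := TensorProduct.rid ℝ (A.part i)

lemma toPart_tmul (i : ZMod 2) (p : A.part i) (r : ℝ) : toPart i (tmul i p r) = r • p :=
  TensorProduct.rid_tmul _ _

lemma toPart_symm (i : ZMod 2) (p : A.part i) : (toPart i).symm p = tmul i p 1 := rfl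

lemma add_tmul (i : ZMod 2) (p q : A.part i) (r : ℝ) :
    tmul i (p + q) r = tmul i p r + tmul i q r := TensorProduct.add_tmul p q r

lemma toPart_smul (i : ZMod 2) (a : A.Even) (x : GTensor A i ℝ) :
    toPart i (a • x) = a • toPart i x := by
  induction x using GTensor.induction with
  | h0 => simp
  | ht p v => rw [smul_tmul, toPart_tmul, toPart_tmul, smul_comm]
  | ha x y hx hy => simp only [smul_add, map_add, hx, hy]

instance (i : ZMod 2) : FiniteDimensional ℝ (GTensor A i ℝ) :=
  Module.Finite.equiv (toPart i).symm

/-- Multiplication of homogeneous elements. -/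
def mul (i j k : ZMod 2) (h : i + j = k) :
    GTensor A i ℝ →ₗ[ℝ] GTensor A j ℝ →ₗ[ℝ] GTensor A k ℝ :=
  LinearMap.mk₂ ℝ (fun x y => (toPart k).symm (Gr.mulPart i j k h (toPart i x) (toPart j y)))
    (fun x y z => by
      rw [← map_add]; congr 1; exact Subtype.ext (by simp [Gr.mulPart, add_mul]))
    (fun r x y => by
      rw [← map_smul]; congr 1; exact Subtype.ext (by simp [Gr.mulPart]))
    (fun x y z => by simp)
    (fun r x y => by simp)

lemma mul_apply (i j k : ZMod 2) (h : i + j = k) (x : GTensor A i ℝ) (y : GTensor A j ℝ) :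
    mul i j k h x y = (toPart k).symm (Gr.mulPart i j k h (toPart i x) (toPart j y)) := rfl

lemma mul_smul_left (i j k : ZMod 2) (h : i + j = k) (a : A.Even) (x : GTensor A i ℝ)
    (y : GTensor A j ℝ) : mul i j k h (a • x) y = a • mul i j k h x y := by
  apply (toPart k).injective
  rw [toPart_smul, mul_apply, mul_apply, LinearEquiv.apply_symm_apply, LinearEquiv.apply_symm_apply,
    toPart_smul]
  exact Subtype.ext (mul_assoc (a : A.Alg) _ _)

lemma mul_smul_right (i j k : ZMod 2) (h : i + j = k) (a : A.Even) (x : GTensor A i ℝ)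
    (y : GTensor A j ℝ) : mul i j k h x (a • y) = a • mul i j k h x y := by
  apply (toPart k).injective
  rw [toPart_smul, mul_apply, mul_apply, LinearEquiv.apply_symm_apply, LinearEquiv.apply_symm_apply,
    toPart_smul]
  refine Subtype.ext ?_
  change (toPart i x : A.Alg) * ((a : A.Alg) * (toPart j y : A.Alg)) =
    (a : A.Alg) * ((toPart i x : A.Alg) * (toPart j y : A.Alg))
  rw [← mul_assoc, Gr.mul_even _ _ a.2, mul_assoc]

end GTensor

lemma SuperSmoothOn.comp_snd {A : Gr} {X Y Z : Type*}
    [NormedAddCommGroup X] [NormedSpace ℝ X] [Module A.Even X]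
    [NormedAddCommGroup Y] [NormedSpace ℝ Y] [Module A.Even Y]
    [NormedAddCommGroup Z] [NormedSpace ℝ Z] [Module A.Even Z] {D : Set X} {E : Set Y} {g : Y → Z}
    (hg : SuperSmoothOn A g E) (hD : IsOpen D) (hE : IsOpen E) :
    SuperSmoothOn A (fun p : X × Y => g p.2) (D ×ˢ E) :=
  hg.comp (SuperSmoothOn.of_linear (ContinuousLinearMap.snd ℝ X Y) (fun _ _ => rfl) _)
    (hD.prod hE) hE fun _ h => h.2

lemma SuperSmoothOn.comp_fst {A : Gr} {X Y Z : Type*}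
    [NormedAddCommGroup X] [NormedSpace ℝ X] [Module A.Even X]
    [NormedAddCommGroup Y] [NormedSpace ℝ Y] [Module A.Even Y]
    [NormedAddCommGroup Z] [NormedSpace ℝ Z] [Module A.Even Z] {D : Set X} {E : Set Y} {g : X → Z}
    (hg : SuperSmoothOn A g D) (hD : IsOpen D) (hE : IsOpen E) :
    SuperSmoothOn A (fun p : X × Y => g p.1) (D ×ˢ E) :=
  hg.comp (SuperSmoothOn.of_linear (ContinuousLinearMap.fst ℝ X Y) (fun _ _ => rfl) _)
    (hD.prod hE) hD fun _ h => h.1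

lemma join_symm_smul (A : Gr) (V : SBanach.{u}) (W : SBanach.{v}) (a : A.Even)
    (p : Pt A (V.prod W)) : (join A V W).symm (a • p) = a • (join A V W).symm p := by
  rw [ContinuousLinearEquiv.symm_apply_eq, join_smul, ContinuousLinearEquiv.apply_symm_apply]

lemma superSmoothOn_join {A : Gr} {V V' : SBanach.{u}} {W W' : SBanach.{v}} {D : Set (Pt A V)}
    {E : Set (Pt A W)} {g : Pt A V → Pt A V'} {h : Pt A V × Pt A W → Pt A W'}
    (hg : SuperSmoothOn A g D) (hh : SuperSmoothOn A h (D ×ˢ E)) (hD : IsOpen D) (hE : IsOpen E) :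
    SuperSmoothOn A (fun p => join A V' W' (g ((join A V W).symm p).1, h ((join A V W).symm p)))
      (join A V W '' (D ×ˢ E)) := by
  have ho : IsOpen (join A V W '' (D ×ˢ E)) :=
    (join A V W).toHomeomorph.isOpenMap _ (hD.prod hE)
  have h1 : SuperSmoothOn A (join A V W).symm (join A V W '' (D ×ˢ E)) :=
    SuperSmoothOn.of_linear (join A V W).symm.toContinuousLinearMap (join_symm_smul A V W) _
  have h2 : SuperSmoothOn A (join A V' W') Set.univ :=
    SuperSmoothOn.of_linear (join A V' W').toContinuousLinearMap (join_smul A V' W') _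
  refine h2.comp (((hg.comp_fst hD hE).prodMk hh (hD.prod hE)).comp h1 ho (hD.prod hE) ?_) ho
    isOpen_univ fun _ _ => trivial
  rintro _ ⟨p, hp, rfl⟩
  simpa using hp

namespace SuperManifold

/-- Coordinates of a superpoint: the images of the odd generators. -/
def superpointCoord (K A : Gr) (p : K ⟶ A) : Pt A (SBanach.oddSpace K.rank) :=
  (0, ∑ i, GTensor.tmul 1 (Gr.Hom.res p 1 (K.gen i)) (Pi.single i 1))

lemma superpointCoord_bijective (K A : Gr) : Function.Bijective (superpointCoord K A) := by
  classical
  let e := TensorProduct.equivFinsuppOfBasisRight (M := A.part 1) (Pi.basisFun ℝ (Fin K.rank))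
  have he : ∀ y : Fin K.rank → A.part 1,
      (∑ i, GTensor.tmul 1 (y i) (Pi.single i (1 : ℝ)) : GTensor A 1 (Fin K.rank → ℝ)) =
        e.symm (Finsupp.equivFunOnFinite.symm y) := by
    intro y
    simp only [e]
    rw [TensorProduct.equivFinsuppOfBasisRight_symm_apply, Finsupp.sum_fintype _ _ (by simp)]
    simp only [Pi.basisFun_apply, Finsupp.equivFunOnFinite_symm_apply_apply]
    rfl
  constructor
  · intro p q h
    have h2 := (Prod.ext_iff.mp h).2
    simp only [superpointCoord] at h2
    rw [he, he] at h2
    have h3 := Finsupp.equivFunOnFinite.symm.injective (e.symm.injective h2)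
    exact Gr.hom_ext fun i => congrFun h3 i
  · rintro ⟨z, y⟩
    refine ⟨Gr.homOfGen (fun i => e y i), Prod.ext ?_ ?_⟩
    · have hz : ∀ z : GTensor A 0 PUnit, z = 0 := by
        intro z
        induction z using GTensor.induction with
        | h0 => rfl
        | ht p v => rw [Subsingleton.elim v 0, map_zero]
        | ha x y hx hy => rw [hx, hy, add_zero]
      exact (hz z).symm
    · simp only [superpointCoord, Gr.homOfGen_gen]
      rw [he]
      have : Finsupp.equivFunOnFinite.symm (fun i => e y i) = e y := by ext; rfl
      rw [this]
      exact e.symm_apply_apply y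

/-- The superpoint `𝓟(Λ)`, with `𝓟(Λ)(Λ') = Hom(Λ, Λ')`; it is isomorphic to the functor of points
of `ℝ^{0|k}`, where `k` is the number of generators of `Λ`. -/
def superpoint (K : Gr) : SuperManifold.{0} where
  pts := { obj := fun A => K ⟶ A, map := fun φ => ↾fun p => p ≫ φ }
  ι := PUnit
  model _ := SBanach.oddSpace K.rank
  source _ _ := Set.univ
  coord _ A p := superpointCoord K A p
  injOn _ A := (superpointCoord_bijective K A).1.injOn
  source_map _ _ _ _ _ _ := trivial
  coord_map _ A B φ p _ := by
    change superpointCoord K B (p ≫ φ) = Bar.map φ (superpointCoord K A p)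
    ext1 <;> simp [superpointCoord, Bar.map, map_sum, GTensor.map_tmul]
  cover _ _ := ⟨PUnit.unit, trivial⟩
  isOpen_overlap _ _ A := by
    simp [(superpointCoord_bijective K A).2.range_eq]
  transition _ _ A := ⟨_, SuperSmoothOn.of_linear (ContinuousLinearMap.id ℝ _) (fun _ _ => rfl) _,
    fun _ _ => rfl⟩

/-- The product of two supermanifolds. -/
def prod (X : SuperManifold.{u}) (Y : SuperManifold.{v}) : SuperManifold.{max u v} where
  pts :=
    { obj := fun A => X.pts.obj A × Y.pts.obj A
      map := fun φ => ↾fun p => (X.pts.map φ p.1, Y.pts.map φ p.2) }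
  ι := X.ι × Y.ι
  model i := (X.model i.1).prod (Y.model i.2)
  source i A := X.source i.1 A ×ˢ Y.source i.2 A
  coord i A p := join A _ _ (X.coord i.1 A p.1, Y.coord i.2 A p.2)
  injOn i A := by
    intro p hp q hq h
    have h' := Prod.ext_iff.mp ((join A _ _).injective h)
    exact Prod.ext (X.injOn _ _ hp.1 hq.1 h'.1) (Y.injOn _ _ hp.2 hq.2 h'.2)
  source_map i A B φ p hp := ⟨X.source_map _ φ _ hp.1, Y.source_map _ φ _ hp.2⟩
  coord_map i A B φ p hp := by
    rw [← join_map, ← X.coord_map _ φ _ hp.1, ← Y.coord_map _ φ _ hp.2]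
    rfl
  cover A p := by
    obtain ⟨i, hi⟩ := X.cover A p.1
    obtain ⟨j, hj⟩ := Y.cover A p.2
    exact ⟨(i, j), hi, hj⟩
  isOpen_overlap i j A := by
    have h := (join A (X.model i.1) (Y.model i.2)).toHomeomorph.isOpenMap _
      ((X.isOpen_overlap i.1 j.1 A).prod (Y.isOpen_overlap i.2 j.2 A))
    convert h using 1
    rw [Set.prod_inter_prod, Set.prod_image_image_eq, Set.image_image]
    rfl
  transition i j A := by
    obtain ⟨g, hg, hgx⟩ := X.transition i.1 j.1 A
    obtain ⟨k, hk, hky⟩ := Y.transition i.2 j.2 A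
    refine ⟨_, (superSmoothOn_join hg (hk.comp_snd (D := X.coord i.1 A '' _) (X.isOpen_overlap _ _ _)
      (Y.isOpen_overlap i.2 j.2 A)) (X.isOpen_overlap _ _ _) (Y.isOpen_overlap i.2 j.2 A)).mono ?_,
      ?_⟩
    · rintro _ ⟨p, hp, rfl⟩
      exact ⟨_, ⟨⟨p.1, ⟨hp.1.1, hp.2.1⟩, rfl⟩, ⟨p.2, ⟨hp.1.2, hp.2.2⟩, rfl⟩⟩, rfl⟩
    · intro p hp
      simp [hgx p.1 ⟨hp.1.1, hp.2.1⟩, hky p.2 ⟨hp.1.2, hp.2.2⟩]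

/-- A supersmooth morphism of supermanifolds. -/
@[ext]
structure Hom (X : SuperManifold.{u}) (Y : SuperManifold.{v}) where
  toFun : ∀ A, X.pts.obj A → Y.pts.obj A
  naturality : ∀ {A B : Gr} (φ : A ⟶ B) (x : X.pts.obj A),
    toFun B (X.pts.map φ x) = Y.pts.map φ (toFun A x)
  smooth : IsSuperSmooth toFun

/-- Composition of supersmooth morphisms. -/
def Hom.comp {X : SuperManifold.{u}} {Y : SuperManifold.{v}} {Z : SuperManifold.{w}}
    (g : Hom Y Z) (f : Hom X Y) : Hom X Z where
  toFun A x := g.toFun A (f.toFun A x)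
  naturality φ x := by rw [f.naturality, g.naturality]
  smooth := g.smooth.comp f.smooth

lemma isSuperSmooth_id (X : SuperManifold.{u}) : IsSuperSmooth (X := X) (Y := X) fun _ x => x :=
  fun _ j => smoothOn_coord j

section Prod

variable {X : SuperManifold.{u}} {Y : SuperManifold.{v}} {Z : SuperManifold.{w}}

lemma isSuperSmooth_fst :
    IsSuperSmooth (X := X.prod Y) (Y := X) (fun _ p => p.1) := by
  intro A j
  apply SmoothOn.of_local
  intro p hp
  obtain ⟨i, hi⟩ := Y.cover A p.2
  refine ⟨(j, i), ⟨hp, hi⟩, _, fun q => ((join A _ _).symm q).1,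
    (X.prod Y).isOpen_overlap (j, i) (j, i) A, ⟨p, ⟨⟨hp, hi⟩, ⟨hp, hi⟩⟩, rfl⟩, ?_, ?_, ?_⟩
  · rintro _ ⟨q, hq, rfl⟩
    exact ⟨q, ⟨hq.1, hq.1.1⟩, rfl⟩
  · exact SuperSmoothOn.of_linear ((ContinuousLinearMap.fst ℝ _ _).comp
      (join A (X.model j) (Y.model i)).symm.toContinuousLinearMap)
      (fun a v => congrArg Prod.fst (join_symm_smul _ _ _ a v)) _
  · intro q _ _
    simp [prod]

lemma isSuperSmooth_snd :
    IsSuperSmooth (X := X.prod Y) (Y := Y) (fun _ p => p.2) := by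
  intro A j
  apply SmoothOn.of_local
  intro p hp
  obtain ⟨i, hi⟩ := X.cover A p.1
  refine ⟨(i, j), ⟨hi, hp⟩, _, fun q => ((join A _ _).symm q).2,
    (X.prod Y).isOpen_overlap (i, j) (i, j) A, ⟨p, ⟨⟨hi, hp⟩, ⟨hi, hp⟩⟩, rfl⟩, ?_, ?_, ?_⟩
  · rintro _ ⟨q, hq, rfl⟩
    exact ⟨q, ⟨hq.1, hq.1.2⟩, rfl⟩
  · exact SuperSmoothOn.of_linear ((ContinuousLinearMap.snd ℝ _ _).comp
      (join A (X.model i) (Y.model j)).symm.toContinuousLinearMap)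
      (fun a v => congrArg Prod.snd (join_symm_smul _ _ _ a v)) _
  · intro q _ _
    simp [prod]

/-- A morphism into a product is supersmooth if its components are. -/
lemma IsSuperSmooth.prodMk {f : ∀ A, Z.pts.obj A → X.pts.obj A} {g : ∀ A, Z.pts.obj A → Y.pts.obj A}
    (hf : IsSuperSmooth f) (hg : IsSuperSmooth g) :
    IsSuperSmooth (X := Z) (Y := X.prod Y) fun A z => (f A z, g A z) := by
  intro A j
  have ho : Z.IsOpenSet ((f A ⁻¹' X.source j.1 A) ∩ (g A ⁻¹' Y.source j.2 A)) :=
    (hf A j.1).1.inter (hg A j.2).1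
  have h := ((hf A j.1).mono ho Set.inter_subset_left).prodMk
    ((hg A j.2).mono ho Set.inter_subset_right)
  have h' := SmoothOn.comp (SuperSmoothOn.of_linear
    (join A (X.model j.1) (Y.model j.2)).toContinuousLinearMap
    (join_smul A _ _) Set.univ) isOpen_univ h fun _ _ => trivial
  exact h'

variable (X Y)

/-- The projection of a product to its second factor. -/
def sndHom : Hom (X.prod Y) Y where
  toFun _ p := p.2
  naturality _ _ := rfl
  smooth := isSuperSmooth_snd

end Prod

section Superpoint

variable {X : SuperManifold.{u}} {A : Gr} {Y : Type*}
  [NormedAddCommGroup Y] [NormedSpace ℝ Y] [Module A.Even Y]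

lemma smoothOn_const (c : Y) : X.SmoothOn (fun _ : X.pts.obj A => c) Set.univ :=
  ⟨isOpenSet_univ, fun _ => ⟨fun _ => c, ⟨contDiffOn_const, fun x _ a v => by simp⟩,
    fun _ _ => rfl⟩⟩

lemma SmoothOn.add {f g : X.pts.obj A → Y} {S : Set (X.pts.obj A)} (hf : X.SmoothOn f S)
    (hg : X.SmoothOn g S) : X.SmoothOn (fun x => f x + g x) S :=
  SmoothOn.comp (SuperSmoothOn.of_linear (ContinuousLinearMap.fst ℝ Y Y +
    ContinuousLinearMap.snd ℝ Y Y) (fun a v => by simp) Set.univ) isOpen_univ (hf.prodMk hg)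
    fun _ _ => trivial

lemma SmoothOn.sum {ι : Type*} (s : Finset ι) {f : ι → X.pts.obj A → Y}
    (hf : ∀ i ∈ s, X.SmoothOn (f i) Set.univ) :
    X.SmoothOn (fun x => ∑ i ∈ s, f i x) Set.univ := by
  classical
  induction s using Finset.induction_on with
  | empty => simpa using smoothOn_const 0
  | insert i s hi ih =>
    simp only [Finset.sum_insert hi]
    exact (hf i (Finset.mem_insert_self _ _)).add
      (ih fun j hj => hf j (Finset.mem_insert_of_mem hj))

lemma superSmoothOn_mul (i j k : ZMod 2) (h : i + j = k) (D : Set _) : SuperSmoothOn A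
    (fun p : GTensor A i ℝ × GTensor A j ℝ => GTensor.mul i j k h p.1 p.2) D := by
  have hb := (GTensor.mul (A := A) i j k h).toContinuousBilinearMap.isBoundedBilinearMap
  refine ⟨hb.contDiff.contDiffOn, fun x _ a v => ?_⟩
  have hd : fderiv ℝ (fun p : GTensor A i ℝ × GTensor A j ℝ => GTensor.mul i j k h p.1 p.2) x = _ :=
    hb.fderiv x
  rw [hd]
  change GTensor.mul i j k h x.1 (a • v.2) + GTensor.mul i j k h (a • v.1) x.2 =
    a • (GTensor.mul i j k h x.1 v.2 + GTensor.mul i j k h v.1 x.2)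
  rw [GTensor.mul_smul_left, GTensor.mul_smul_right, smul_add]

lemma smoothOn_superpoint_eval (L : Gr) (i : ZMod 2) (a : L.part i) :
    (superpoint L).SmoothOn (A := A)
      (fun p => GTensor.tmul i (Gr.Hom.res (A := L) p i a) (1 : ℝ)) Set.univ := by
  have hι : ∀ v : Fin L.rank → ℝ, (superpoint L).SmoothOn (A := A) (fun p =>
      GTensor.tmul 1 (Gr.Hom.res (A := L) p 1
        ⟨ExteriorAlgebra.ι ℝ v, CliffordAlgebra.ι_mem_evenOdd_one _ _⟩) (1 : ℝ)) Set.univ := by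
    intro v
    let d : (Fin L.rank → ℝ) →L[ℝ] ℝ := LinearMap.toContinuousLinearMap
      (Fintype.linearCombination ℝ v)
    have h0 : (superpoint L).SmoothOn (A := A) (superpointCoord L A) Set.univ :=
      smoothOn_coord (X := superpoint L) (A := A) PUnit.unit
    have h1 := SmoothOn.comp (SuperSmoothOn.of_linear
      (ContinuousLinearMap.snd ℝ (GTensor A 0 PUnit) (GTensor A 1 (Fin L.rank → ℝ)))
      (fun _ _ => rfl) Set.univ) isOpen_univ h0 fun _ _ => trivial
    have h := SmoothOn.comp (SuperSmoothOn.of_linear (GTensor.clmap A 1 d)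
      (GTensor.clmap_smul d) Set.univ) isOpen_univ h1 fun _ _ => trivial
    convert h using 1
    funext p
    change _ = GTensor.clmap A 1 d (∑ i, GTensor.tmul 1 (Gr.Hom.res (A := L) p 1 (L.gen i)) (Pi.single i 1))
    have hv : (⟨ExteriorAlgebra.ι ℝ v, CliffordAlgebra.ι_mem_evenOdd_one _ _⟩ : L.part 1) =
        ∑ i, v i • L.gen i := by
      apply Subtype.ext
      have : v = ∑ i, v i • (Pi.single i (1 : ℝ) : Fin L.rank → ℝ) := by
        simpa using (pi_eq_sum_univ' v)
      conv_lhs => rw [this]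
      simp [Gr.gen]
    rw [hv, map_sum, map_sum]
    apply (GTensor.toPart 1).injective
    simp [GTensor.toPart_tmul, GTensor.clmap_tmul, d, Fintype.linearCombination_apply,
      Pi.single_apply]
  have hmul : ∀ (j : ZMod 2) (v w : Fin L.rank → ℝ) (x : L.Alg) (hx : x ∈ L.part j)
      (hy : ExteriorAlgebra.ι ℝ v * ExteriorAlgebra.ι ℝ w * x ∈ L.part j),
      (superpoint L).SmoothOn (A := A)
        (fun p => GTensor.tmul j (Gr.Hom.res (A := L) p j ⟨x, hx⟩) (1 : ℝ)) Set.univ →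
      (superpoint L).SmoothOn (A := A)
        (fun p => GTensor.tmul j (Gr.Hom.res (A := L) p j
          ⟨ExteriorAlgebra.ι ℝ v * ExteriorAlgebra.ι ℝ w * x, hy⟩) (1 : ℝ)) Set.univ := by
    intro j v w x hx hy h
    have h1 := SmoothOn.comp (superSmoothOn_mul 1 1 0 (by decide) Set.univ) isOpen_univ
      ((hι v).prodMk (hι w)) fun _ _ => trivial
    have h2 := SmoothOn.comp (superSmoothOn_mul 0 j j (zero_add j) Set.univ) isOpen_univ
      (h1.prodMk h) fun _ _ => trivial
    convert h2 using 1
    funext p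
    apply (GTensor.toPart j).injective
    simp only [Function.comp_apply, GTensor.mul_apply, LinearEquiv.apply_symm_apply,
      GTensor.toPart_tmul, one_smul]
    apply Subtype.ext
    let q : L ⟶ A := p
    exact (map_mul q.alg _ _).trans (congrArg (· * _) (map_mul q.alg _ _))
  obtain ⟨a, ha⟩ := a
  rcases (by decide : ∀ i : ZMod 2, i = 0 ∨ i = 1) i with rfl | rfl
  · induction a, ha using CliffordAlgebra.even_induction with
    | algebraMap r =>
      convert smoothOn_const (X := superpoint L) (A := A) (GTensor.tmul 0
        (⟨algebraMap ℝ A.Alg r, SetLike.algebraMap_mem_graded A.part r⟩ : A.part 0) (1 : ℝ)) using 1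
      funext p
      congr 2
      exact Subtype.ext ((Gr.Hom.alg (A := L) p).commutes r)
    | add x y hx hy ihx ihy =>
      convert ihx.add ihy using 1
      funext p
      rw [← GTensor.add_tmul, ← map_add]
      rfl
    | ι_mul_ι_mul v w z hz ih => exact hmul 0 v w z hz _ ih
  · induction a, ha using CliffordAlgebra.odd_induction with
    | ι v => exact hι v
    | add x y hx hy ihx ihy =>
      convert ihx.add ihy using 1
      funext p
      rw [← GTensor.add_tmul, ← map_add]
      rfl
    | ι_mul_ι_mul v w z hz ih => exact hmul 1 v w z hz _ ih

end Superpoint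

/-- The morphism `𝓟(φ) : 𝓟(Λ') → 𝓟(Λ)` of superpoints given by `φ : Λ → Λ'`. -/
def superpointMap {K L : Gr} (φ : K ⟶ L) : Hom (superpoint L) (superpoint K) where
  toFun _ p := φ ≫ p
  naturality ψ p := (Category.assoc φ p ψ).symm
  smooth := by
    intro A j
    let d : Fin K.rank → ℝ →L[ℝ] (Fin K.rank → ℝ) := fun i =>
      ContinuousLinearMap.toSpanSingleton ℝ (Pi.single i 1)
    have h1 := SmoothOn.sum (X := superpoint L) (A := A) Finset.univ fun i _ =>
      SmoothOn.comp (SuperSmoothOn.of_linear (GTensor.clmap A 1 (d i))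
        (GTensor.clmap_smul (d i)) Set.univ) isOpen_univ
        (smoothOn_superpoint_eval L 1 (Gr.Hom.res φ 1 (K.gen i))) fun _ _ => trivial
    have h := (smoothOn_const (X := superpoint L) (A := A) (0 : GTensor A 0 PUnit)).prodMk h1
    refine (congrArg (fun f => (superpoint L).SmoothOn f Set.univ) ?_).mpr h
    funext p
    change superpointCoord K A (φ ≫ p) = _
    simp only [superpointCoord, GTensor.clmap_tmul, d, Function.comp_apply,
      ContinuousLinearMap.toSpanSingleton_apply, one_smul]
    rfl

/-- The morphism `𝓟(φ) × id`. -/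
def superpointMapProd {K L : Gr} (φ : K ⟶ L) (M : SuperManifold.{u}) :
    Hom ((superpoint L).prod M) ((superpoint K).prod M) where
  toFun A p := ((superpointMap φ).toFun A p.1, p.2)
  naturality ψ p := by
    exact Prod.ext ((superpointMap φ).naturality ψ p.1) rfl
  smooth := ((superpointMap φ).smooth.comp isSuperSmooth_fst).prodMk isSuperSmooth_snd

end SuperManifold

/-! ### Super vector bundles -/

/-- A super vector bundle over the supermanifold `M` with typical fibre the Banach super vector
space `V`: a functor `tot` with a projection to `M` and with `Λ_0`-module operations on the
fibres of `tot.obj Λ → M.pts.obj Λ`, and a bundle atlas.  The `i`-th chart of the bundle is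
given by an open subfunctor `base i` of `M` and by the fibre coordinate `fib i`; it identifies
`tot` over `base i`, naturally and linearly on the fibres, with the product of `base i` and the
functor of points of `V`.  The changes of trivializations `base i ∩ base j × V → V` are
supersmooth. -/
structure SuperVectorBundle (M : SuperManifold.{u}) (V : SBanach.{u}) : Type (u + 1) where
  tot : Gr ⥤ Type u
  proj : tot ⟶ M.pts
  add : ∀ (A : Gr) (a b : tot.obj A), proj.app A a = proj.app A b → tot.obj A
  smul : ∀ A : Gr, A.Even → tot.obj A → tot.obj A
  proj_add : ∀ A a b h, proj.app A (add A a b h) = proj.app A a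
  proj_smul : ∀ A c a, proj.app A (smul A c a) = proj.app A a
  ι : Type u
  base : ι → ∀ A : Gr, Set (M.pts.obj A)
  fib : ι → ∀ A : Gr, tot.obj A → Pt A V
  base_map : ∀ i {A B : Gr} (φ : A ⟶ B), ∀ x ∈ base i A, M.pts.map φ x ∈ base i B
  base_open : ∀ i A, M.IsOpenSet (base i A)
  cover : ∀ A x, ∃ i, x ∈ base i A
  fib_map : ∀ i {A B : Gr} (φ : A ⟶ B) (a : tot.obj A), proj.app A a ∈ base i A →
    fib i B (tot.map φ a) = Bar.map φ (fib i A a)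
  fib_bij : ∀ i A, ∀ x ∈ base i A, Set.BijOn (fib i A) {a | proj.app A a = x} Set.univ
  fib_add : ∀ i A a b h, proj.app A a ∈ base i A → fib i A (add A a b h) = fib i A a + fib i A b
  fib_smul : ∀ i A c a, proj.app A a ∈ base i A → fib i A (smul A c a) = c • fib i A a
  transition : ∀ i j A (α : M.ι), ∃ g : Pt A (M.model α) × Pt A V → Pt A V,
    SuperSmoothOn A g ((M.coord α A '' (M.source α A ∩ (base i A ∩ base j A))) ×ˢ Set.univ) ∧
    ∀ a, proj.app A a ∈ M.source α A ∩ (base i A ∩ base j A) →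
      g (M.coord α A (proj.app A a), fib i A a) = fib j A a

namespace SuperVectorBundle

open SuperManifold

variable {M : SuperManifold.{u}} {V : SBanach.{u}}

lemma proj_map (E : SuperVectorBundle M V) {A B : Gr} (φ : A ⟶ B) (a : E.tot.obj A) :
    E.proj.app B (E.tot.map φ a) = M.pts.map φ (E.proj.app A a) :=
  NatTrans.naturality_apply E.proj φ a

/-- The total space of a super vector bundle, as a supermanifold. -/
def total (E : SuperVectorBundle M V) : SuperManifold.{u} where
  pts := E.tot
  ι := M.ι × E.ι
  model i := (M.model i.1).prod V
  source i A := {a | E.proj.app A a ∈ M.source i.1 A ∩ E.base i.2 A}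
  coord i A a := join A _ _ (M.coord i.1 A (E.proj.app A a), E.fib i.2 A a)
  injOn i A := by
    intro a ha b hb h
    have h' := Prod.ext_iff.mp ((join A _ _).injective h)
    exact (E.fib_bij i.2 A _ ha.2).injOn rfl (M.injOn _ _ ha.1 hb.1 h'.1).symm h'.2
  source_map i A B φ a ha := by
    simp only [Set.mem_ofPred_eq, proj_map]
    exact ⟨M.source_map _ φ _ ha.1, E.base_map _ φ _ ha.2⟩
  coord_map i A B φ a ha := by
    rw [← join_map, proj_map, M.coord_map _ φ _ ha.1, E.fib_map _ φ _ ha.2]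
  cover A a := by
    obtain ⟨i, hi⟩ := M.cover A (E.proj.app A a)
    obtain ⟨j, hj⟩ := E.cover A (E.proj.app A a)
    exact ⟨(i, j), hi, hj⟩
  isOpen_overlap i j A := by
    have h1 : M.IsOpenSet (M.source j.1 A ∩ (E.base i.2 A ∩ E.base j.2 A)) :=
      (isOpenSet_source j.1).inter ((E.base_open i.2 A).inter (E.base_open j.2 A))
    have h := (join A (M.model i.1) V).toHomeomorph.isOpenMap _
      ((h1 i.1).prod (isOpen_univ (X := Pt A V)))
    convert h using 1
    ext q
    constructor
    · rintro ⟨a, ha, rfl⟩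
      exact ⟨_, ⟨⟨_, ⟨ha.1.1, ha.2.1, ha.1.2, ha.2.2⟩, rfl⟩, trivial⟩, rfl⟩
    · rintro ⟨⟨p, v⟩, ⟨⟨x, hx, rfl⟩, -⟩, rfl⟩
      obtain ⟨a, rfl, rfl⟩ := (E.fib_bij i.2 A x hx.2.2.1).surjOn (Set.mem_univ v)
      exact ⟨a, ⟨⟨hx.1, hx.2.2.1⟩, ⟨hx.2.1, hx.2.2.2⟩⟩, rfl⟩
  transition i j A := by
    have h1 : M.IsOpenSet (M.source j.1 A ∩ (E.base i.2 A ∩ E.base j.2 A)) :=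
      (isOpenSet_source j.1).inter ((E.base_open i.2 A).inter (E.base_open j.2 A))
    obtain ⟨g, hg, hgx⟩ := M.transition i.1 j.1 A
    obtain ⟨k, hk, hky⟩ := E.transition i.2 j.2 A i.1
    refine ⟨_, (superSmoothOn_join (D := M.coord i.1 A '' (M.source i.1 A ∩ (M.source j.1 A ∩
      (E.base i.2 A ∩ E.base j.2 A)))) (E := Set.univ) (hg.mono ?_) (hk.mono ?_) (h1 i.1)
      isOpen_univ).mono ?_, ?_⟩
    · exact Set.image_mono fun x hx => ⟨hx.1, hx.2.1⟩
    · exact Set.prod_mono (Set.image_mono fun x hx => ⟨hx.1, hx.2.2⟩) subset_rfl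
    · rintro _ ⟨a, ha, rfl⟩
      exact ⟨_, ⟨⟨_, ⟨ha.1.1, ha.2.1, ha.1.2, ha.2.2⟩, rfl⟩, trivial⟩, rfl⟩
    · intro a ha
      simp [hgx _ ⟨ha.1.1, ha.2.1⟩, hky a ⟨ha.1.1, ha.1.2, ha.2.2⟩]

section Smoothness

variable {X : SuperManifold.{v}} (E : SuperVectorBundle M V)

lemma isSuperSmooth_proj : IsSuperSmooth (X := E.total) (Y := M) fun A a => E.proj.app A a := by
  intro A α
  apply SmoothOn.of_local
  intro a ha
  obtain ⟨i, hi⟩ := E.cover A (E.proj.app A a)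
  refine ⟨(α, i), ⟨ha, hi⟩, _, fun q => ((join A _ _).symm q).1,
    E.total.isOpen_overlap (α, i) (α, i) A, ⟨a, ⟨⟨ha, hi⟩, ⟨ha, hi⟩⟩, rfl⟩, ?_, ?_, ?_⟩
  · rintro _ ⟨b, hb, rfl⟩
    exact ⟨b, ⟨hb.1, hb.1.1⟩, rfl⟩
  · exact SuperSmoothOn.of_linear ((ContinuousLinearMap.fst ℝ _ _).comp
      (join A (M.model α) V).symm.toContinuousLinearMap)
      (fun a v => congrArg Prod.fst (join_symm_smul _ _ _ a v)) _
  · intro b _ _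
    simp [total]

lemma smoothOn_fib (i : E.ι) (A : Gr) :
    E.total.SmoothOn (E.fib i A) {a | E.proj.app A a ∈ E.base i A} := by
  apply SmoothOn.of_local
  intro a ha
  obtain ⟨α, hα⟩ := M.cover A (E.proj.app A a)
  refine ⟨(α, i), ⟨hα, ha⟩, _, fun q => ((join A _ _).symm q).2,
    E.total.isOpen_overlap (α, i) (α, i) A, ⟨a, ⟨⟨hα, ha⟩, ⟨hα, ha⟩⟩, rfl⟩, ?_, ?_, ?_⟩
  · rintro _ ⟨b, hb, rfl⟩
    exact ⟨b, ⟨hb.1, hb.1.2⟩, rfl⟩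
  · exact SuperSmoothOn.of_linear ((ContinuousLinearMap.snd ℝ _ _).comp
      (join A (M.model α) V).symm.toContinuousLinearMap)
      (fun a v => congrArg Prod.snd (join_symm_smul _ _ _ a v)) _
  · intro b _ _
    simp [total]

/-- A morphism into the total space is supersmooth if its projection to the base and its fibre
coordinates are. -/
lemma isSuperSmooth_total {f : ∀ A, X.pts.obj A → E.tot.obj A}
    (h1 : IsSuperSmooth (X := X) (Y := M) fun A x => E.proj.app A (f A x))
    (h2 : ∀ i A, X.SmoothOn (fun x => E.fib i A (f A x)) {x | E.proj.app A (f A x) ∈ E.base i A}) :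
    IsSuperSmooth (X := X) (Y := E.total) f := by
  intro A j
  have ho : X.IsOpenSet ({x | E.proj.app A (f A x) ∈ M.source j.1 A} ∩
      {x | E.proj.app A (f A x) ∈ E.base j.2 A}) := (h1 A j.1).1.inter (h2 j.2 A).1
  have h := ((h1 A j.1).mono ho Set.inter_subset_left).prodMk
    ((h2 j.2 A).mono ho Set.inter_subset_right)
  have h' := SmoothOn.comp (SuperSmoothOn.of_linear
    (join A (M.model j.1) V).toContinuousLinearMap
    (join_smul A _ _) Set.univ) isOpen_univ h fun _ _ => trivial
  exact h'

end Smoothness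

/-- The projection of a super vector bundle, as a supersmooth morphism. -/
def projHom (E : SuperVectorBundle M V) : Hom E.total M where
  toFun A a := E.proj.app A a
  naturality φ a := E.proj_map φ a
  smooth := E.isSuperSmooth_proj

/-- The sections of a super vector bundle: the supersmooth morphisms `σ : M → E` with
`π ∘ σ = id`. -/
def Section (E : SuperVectorBundle M V) : Type u :=
  {σ : Hom M E.total // ∀ A x, E.proj.app A (σ.toFun A x) = x}

/-- The pullback of a super vector bundle along a supersmooth morphism: for every Grassmann algebra,
the fibre product of the points. -/
def pullback {N : SuperManifold.{u}} (f : Hom N M) (E : SuperVectorBundle M V) :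
    SuperVectorBundle N V where
  tot :=
    { obj := fun A => {p : N.pts.obj A × E.tot.obj A // f.toFun A p.1 = E.proj.app A p.2}
      map := fun φ => ↾fun p => ⟨(N.pts.map φ p.1.1, E.tot.map φ p.1.2), by
        rw [f.naturality, p.2, E.proj_map]⟩ }
  proj := { app := fun A => ↾fun p => p.1.1 }
  add A p q h := ⟨(p.1.1, E.add A p.1.2 q.1.2 (by
    have h' : p.1.1 = q.1.1 := h
    rw [← p.2, ← q.2, h'])), by rw [E.proj_add]; exact p.2⟩
  smul A c p := ⟨(p.1.1, E.smul A c p.1.2), by rw [E.proj_smul]; exact p.2⟩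
  proj_add A p q h := rfl
  proj_smul A c p := rfl
  ι := E.ι
  base i A := f.toFun A ⁻¹' E.base i A
  fib i A p := E.fib i A p.1.2
  base_map i A B φ x hx := by
    rw [Set.mem_preimage, f.naturality]
    exact E.base_map i φ _ hx
  base_open i A := (f.smooth.smoothOn ((smoothOn_const (0 : Pt A V)).mono (E.base_open i A)
    (Set.subset_univ _))).1
  cover A x := E.cover A (f.toFun A x)
  fib_map i A B φ p hp := E.fib_map i φ p.1.2 (p.2 ▸ hp)
  fib_bij i A x hx := by
    refine ⟨fun _ _ => trivial, ?_, ?_⟩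
    · rintro ⟨⟨y, a⟩, hp⟩ rfl ⟨⟨z, b⟩, hq⟩ h hab
      change z = y at h
      subst h
      have := (E.fib_bij i A _ hx).injOn hp.symm hq.symm hab
      change a = b at this
      subst this
      rfl
    · intro v _
      obtain ⟨a, ha, hv⟩ := (E.fib_bij i A _ hx).surjOn (Set.mem_univ v)
      exact ⟨⟨(x, a), Eq.symm ha⟩, rfl, hv⟩
  fib_add i A p q h hp := E.fib_add i A p.1.2 q.1.2 _ (p.2 ▸ hp)
  fib_smul i A c p hp := E.fib_smul i A c p.1.2 (p.2 ▸ hp)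
  transition i j A α := by
    classical
    let P : Pt A (N.model α) × Pt A V → N.pts.obj A × E.tot.obj A → Prop := fun q p =>
      p.1 ∈ N.source α A ∧ f.toFun A p.1 ∈ E.base i A ∧ f.toFun A p.1 = E.proj.app A p.2 ∧
        N.coord α A p.1 = q.1 ∧ E.fib i A p.2 = q.2
    let g : Pt A (N.model α) × Pt A V → Pt A V := fun q =>
      if h : ∃ p, P q p then E.fib j A h.choose.2 else 0
    have hg : ∀ q p, P q p → g q = E.fib j A p.2 := by
      intro q p hp
      have h : ∃ p, P q p := ⟨p, hp⟩
      simp only [g, dif_pos h]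
      obtain ⟨h1, h2, h3, h4, h5⟩ := h.choose_spec
      obtain ⟨k1, k2, k3, k4, k5⟩ := hp
      have e1 := N.injOn α A h1 k1 (h4.trans k4.symm)
      have e2 := (E.fib_bij i A _ k2).injOn (h3.symm.trans (congrArg (f.toFun A) e1)) k3.symm
        (h5.trans k5.symm)
      rw [e2]
    have hbase : M.IsOpenSet (E.base i A ∩ E.base j A) := (E.base_open i A).inter (E.base_open j A)
    refine ⟨g, SuperSmoothOn.of_local ?_, fun p hp =>
      hg _ p.1 ⟨hp.1, hp.2.1, p.2, rfl, rfl⟩⟩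
    rintro ⟨_, v⟩ ⟨⟨x, hx, rfl⟩, -⟩
    obtain ⟨β, hβ⟩ := M.cover A (f.toFun A x)
    obtain ⟨t, ht, htx⟩ := (f.smooth A β).2 α
    obtain ⟨k, hk, hka⟩ := E.transition i j A β
    have hT : M.IsOpenSet (M.source β A ∩ (E.base i A ∩ E.base j A)) :=
      (isOpenSet_source β).inter hbase
    have hD := (f.smooth.smoothOn ((smoothOn_const (0 : Pt A V)).mono hT
      (Set.subset_univ _))).1 α
    have hD' := hD.prod (isOpen_univ (X := Pt A V))
    refine ⟨_, fun q => k (t q.1, q.2), hD', ⟨⟨x, ⟨hx.1, hβ, hx.2⟩, rfl⟩, trivial⟩, ?_, ?_⟩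
    · have h1 := (ht.mono (Set.image_mono fun y (hy : y ∈ N.source α A ∩ (f.toFun A ⁻¹'
        (M.source β A ∩ (E.base i A ∩ E.base j A)))) => ⟨hy.1, hy.2.1⟩)).comp
        (SuperSmoothOn.of_linear (ContinuousLinearMap.fst ℝ (Pt A (N.model α)) (Pt A V))
        (fun _ _ => rfl) _) hD' hD fun q hq => hq.1
      have h2 := h1.prodMk (SuperSmoothOn.of_linear
        (ContinuousLinearMap.snd ℝ (Pt A (N.model α)) (Pt A V)) (fun _ _ => rfl) _) hD'
      refine hk.comp h2 hD' ((hbase β).prod isOpen_univ) ?_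
      rintro ⟨_, w⟩ ⟨⟨y, hy, rfl⟩, -⟩
      exact ⟨⟨f.toFun A y, hy.2, (htx y ⟨hy.1, hy.2.1⟩).symm⟩, trivial⟩
    · rintro ⟨_, w⟩ ⟨⟨y, hy, rfl⟩, -⟩
      obtain ⟨a, ha, rfl⟩ := (E.fib_bij i A _ hy.2.2.1).surjOn (Set.mem_univ w)
      have ha' : E.proj.app A a = f.toFun A y := ha
      have h := hka a (ha' ▸ hy.2)
      have ht' : t (N.coord α A y) = M.coord β A (E.proj.app A a) := by
        rw [htx y ⟨hy.1, hy.2.1⟩, ha']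
      change g _ = k (t (N.coord α A y), E.fib i A a)
      rw [ht', h]
      exact hg _ (y, a) ⟨hy.1, hy.2.2.1, ha'.symm, rfl, rfl⟩

end SuperVectorBundle

/-! ### Modules over the line in the category of functors on Grassmann algebras -/

/-- The structure of a module over the ring object `Λ ↦ Λ_0` on the set-valued functor `F`. -/
structure RbarModule (F : Gr ⥤ Type u) : Type u where
  addCommGroup : ∀ A, AddCommGroup (F.obj A)
  module : ∀ A, Module A.Even (F.obj A)
  map_add : ∀ {A B : Gr} (φ : A ⟶ B) (x y : F.obj A), F.map φ (x + y) = F.map φ x + F.map φ y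
  map_smul : ∀ {A B : Gr} (φ : A ⟶ B) (a : A.Even) (x : F.obj A),
    F.map φ (a • x) = Gr.Hom.resEven φ a • F.map φ x

namespace RbarModule

/-- Isomorphism of modules over `Λ ↦ Λ_0`: a natural family of `Λ_0`-linear isomorphisms. -/
def IsIso {F : Gr ⥤ Type u} {G : Gr ⥤ Type v} (S : RbarModule F) (T : RbarModule G) : Prop :=
  letI := S.addCommGroup
  letI := S.module
  letI := T.addCommGroup
  letI := T.module
  ∃ e : ∀ A, F.obj A ≃ G.obj A,
    (∀ A x y, e A (x + y) = e A x + e A y) ∧ (∀ A (a : A.Even) x, e A (a • x) = a • e A x) ∧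
    ∀ (A B : Gr) (φ : A ⟶ B) (x : F.obj A), e B (F.map φ x) = G.map φ (e A x)

end RbarModule

/-- The functor `Λ ↦ (Λ ⊗ E)_0` of points of the real super vector space `E = E₀ ⊕ E₁`. -/
def barFunctor (E₀ E₁ : Type u) [AddCommGroup E₀] [Module ℝ E₀] [AddCommGroup E₁] [Module ℝ E₁] :
    Gr ⥤ Type u where
  obj A := Bar A E₀ E₁
  map φ := ↾fun x => Bar.map φ x
  map_id A := by
    ext x : 3
    exact Bar.map_id x
  map_comp φ ψ := by
    ext x : 3
    exact Bar.map_comp φ ψ x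

/-- The module structure of `Λ ↦ (Λ ⊗ E)_0`. -/
def barModule (E₀ E₁ : Type u) [AddCommGroup E₀] [Module ℝ E₀] [AddCommGroup E₁] [Module ℝ E₁] :
    RbarModule (barFunctor E₀ E₁) where
  addCommGroup A := inferInstanceAs (AddCommGroup (Bar A E₀ E₁))
  module A := inferInstanceAs (Module A.Even (Bar A E₀ E₁))
  map_add φ x y := LinearMap.map_add (Bar.map φ) x y
  map_smul φ a x := Bar.map_smul_even φ a x

/-- A module over `Λ ↦ Λ_0` is superrepresentable if it is isomorphic to `Λ ↦ (Λ ⊗ E)_0` for some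
real super vector space `E`. -/
def RbarModule.IsSuperrepresentable {F : Gr ⥤ Type u} (S : RbarModule F) : Prop :=
  ∃ (E₀ E₁ : Type u) (_ : AddCommGroup E₀) (_ : Module ℝ E₀) (_ : AddCommGroup E₁)
    (_ : Module ℝ E₁), S.IsIso (barModule E₀ E₁)

namespace SuperVectorBundle

open SuperManifold

variable {M : SuperManifold.{u}} {V : SBanach.{u}} (E : SuperVectorBundle M V)

/-! ### The functor of sections -/

/-- The pullback of the bundle to the product of a superpoint with `M`. -/
abbrev family (K : Gr) : SuperVectorBundle ((superpoint K).prod M) V :=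
  E.pullback (sndHom (superpoint K) M)

variable {E} in
/-- The value in `E` of a section of the pullback of `E` to `𝓟(Λ) × M`, at a point of
`𝓟(Λ) × M`. -/
def val {K : Gr} (σ : (E.family K).Section) (A : Gr) (p : K ⟶ A) (m : M.pts.obj A) : E.tot.obj A :=
  (σ.1.toFun A (p, m)).1.2

variable {E} in
lemma proj_val {K : Gr} (σ : (E.family K).Section) (A : Gr) (p : K ⟶ A) (m : M.pts.obj A) :
    E.proj.app A (val σ A p m) = m := by
  have h : (σ.1.toFun A (p, m)).1.1 = (p, m) := σ.2 A (p, m)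
  have h' : (σ.1.toFun A (p, m)).1.1.2 = E.proj.app A (val σ A p m) := (σ.1.toFun A (p, m)).2
  rw [← h', h]

variable {E} in
lemma section_ext {K : Gr} {σ τ : (E.family K).Section}
    (h : ∀ A p m, val σ A p m = val τ A p m) : σ = τ := by
  apply Subtype.ext
  have h' : σ.1.toFun = τ.1.toFun := by
    funext A x
    exact Subtype.ext (Prod.ext ((σ.2 A x).trans (τ.2 A x).symm) (h A x.1 x.2))
  cases hs : σ.1
  cases ht : τ.1
  rw [hs, ht] at h'
  subst h'
  rfl

/-- The section `σ ∘ (𝓟(φ) × id)`. -/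
def sectionMap {K L : Gr} (φ : K ⟶ L) (σ : (E.family K).Section) : (E.family L).Section :=
  ⟨{ toFun := fun A x => ⟨(x, val σ A (φ ≫ x.1) x.2), (proj_val σ A _ _).symm⟩
     naturality := fun {A B} ψ x => by
       have h := σ.1.naturality ψ (φ ≫ x.1, x.2)
       exact Subtype.ext (Prod.ext rfl (congrArg (fun y => y.1.2) h))
     smooth := (E.family L).isSuperSmooth_total (isSuperSmooth_id _) fun i A => by
       have h := (superpointMapProd φ M).smooth.smoothOn
         (σ.1.smooth.smoothOn ((E.family K).smoothOn_fib i A))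
       refine (congrArg (((superpoint L).prod M).SmoothOn _) ?_).mpr h
       ext x
       have h1 : (σ.1.toFun A (φ ≫ x.1, x.2)).1.1 = (φ ≫ x.1, x.2) := σ.2 A _
       change x.2 ∈ E.base i A ↔ (σ.1.toFun A (φ ≫ x.1, x.2)).1.1.2 ∈ E.base i A
       rw [h1] },
   fun _ _ => rfl⟩

lemma val_sectionMap {K L : Gr} (φ : K ⟶ L) (σ : (E.family K).Section) (A : Gr) (p : L ⟶ A)
    (m : M.pts.obj A) : val (E.sectionMap φ σ) A p m = val σ A (φ ≫ p) m := rfl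

/-- The functor that sends a Grassmann algebra `Λ` to the set of sections of the pullback of the
bundle to `𝓟(Λ) × M`, and a morphism `φ` to the composition with `𝓟(φ) × id`. -/
def gammaHat : Gr ⥤ Type u where
  obj K := (E.family K).Section
  map φ := ↾(E.sectionMap φ)
  map_id K := by
    ext σ
    exact section_ext fun A p m => by
      change val (E.sectionMap (𝟙 K) σ) A p m = val σ A p m
      rw [val_sectionMap, Category.id_comp]
  map_comp φ ψ := by
    ext σ
    exact section_ext fun A p m => by
      change val (E.sectionMap (φ ≫ ψ) σ) A p m = val (E.sectionMap ψ (E.sectionMap φ σ)) A p m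
      rw [val_sectionMap, val_sectionMap, val_sectionMap, Category.assoc]

/-- The module operations on the functor of sections are the pointwise ones: at a point `(p, m)` of
`𝓟(Λ) × M`, where `p` is a morphism of Grassmann algebras on `Λ`, the sum of two sections is the
sum of their values, and the product with `a ∈ Λ_0` is the product of the value with `p(a)`. -/
def IsPointwise (S : RbarModule E.gammaHat) : Prop :=
  letI := S.addCommGroup
  letI := S.module
  ∀ (K : Gr) (σ τ : E.gammaHat.obj K) (a : K.Even) (A : Gr) (p : K ⟶ A) (m : M.pts.obj A),
    val (σ + τ : E.gammaHat.obj K) A p m =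
      E.add A (val σ A p m) (val τ A p m) ((proj_val _ _ _ _).trans (proj_val _ _ _ _).symm) ∧
    val (a • σ : E.gammaHat.obj K) A p m = E.smul A (Gr.Hom.resEven p a) (val σ A p m)

/-- The vector space operations on the sections of a bundle are the pointwise ones. -/
def IsPointwiseSpace [AddCommGroup E.Section] [Module ℝ E.Section] : Prop :=
  ∀ (s t : E.Section) (r : ℝ) (A : Gr) (m : M.pts.obj A),
    (s + t).1.toFun A m = E.add A (s.1.toFun A m) (t.1.toFun A m) (by rw [s.2, t.2]) ∧
    (r • s).1.toFun A m = E.smul A (algebraMap ℝ A.Even r) (s.1.toFun A m)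

/-- `E'` is the bundle `ΠE`, the bundle `E` with reversed parity in the fibres: it has bundle charts
over the same open sets, and its changes of trivializations correspond to those of `E` by means of
multiplication by odd elements `c`.  That is, whether a point of `E` is `c` times a point of `E'` does
not depend on the trivialization. (For a fixed Grassmann algebra the multiplication by `c` is not
injective, but it is so on the points that come from a smaller Grassmann algebra, if `c` is a new
generator.  Thus the changes of trivializations of `E'` are determined by those of `E`.) -/
def IsParityReversal (E' : SuperVectorBundle M V.flip) : Prop :=
  ∃ ε : E.ι ≃ E'.ι, (∀ i A, E'.base (ε i) A = E.base i A) ∧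
    ∀ (i j : E.ι) (A : Gr) (a : E.tot.obj A) (b : E'.tot.obj A) (c : A.part 1),
      E.proj.app A a = E'.proj.app A b → E.proj.app A a ∈ E.base i A ∩ E.base j A →
      E.fib i A a = Bar.oddMul c (E'.fib (ε i) A b) →
      E.fib j A a = Bar.oddMul c (E'.fib (ε j) A b)

end SuperVectorBundle

end

end SuperGeom

namespace SuperGeom

noncomputable section

/-! ### Coproducts of Grassmann algebras and contractions -/

namespace Gr

variable {K A B C : Gr}

/-! A family of sections over `𝓟(K) × M` is determined by its values at the generic point of the
superpoint. Every pair `(p, m)` over `A` is the image of the pair `(inl, inr m)` over the coproduct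
`K ⊗ A` (`Gr.tens`) under the morphism `desc p (𝟙 A)`, which is a form of the Yoneda lemma
(`map_desc_generic`). In a trivialization the generic value lies in `(K ⊗ A ⊗ V)_0`, which splits as
`K_0 ⊗ (A ⊗ V)_0 ⊕ K_1 ⊗ (A ⊗ ΠV)_0`. With bases `k_n` of `K_0` and `l_n` of `K_1` the generic value
is `∑ k_n s_n(m) + ∑ l_n t_n(m)`, and substituting `p` gives `σ(p, m) = ∑ p(k_n) s_n(m) + ∑ p(l_n)
t_n(m)`.

The point is that the `s_n` are sections of `E` and the `t_n` sections of `ΠE` (`exists_coeff`). The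
coefficients are extracted by contractions with functionals on `K`. These are natural in `A`, and
they are semilinear along `inr : A ⟶ K ⊗ A`, so that they preserve supersmoothness
(`SmoothOn.baseChange`). They also commute with changes of trivialization
(`exists_transition_comm`): by naturality and linearity the change over `K ⊗ A` sends `k w` to `k
g₀(w)` for even `k`, and to `k g₁(w)` for odd `k`, where `g₀` and `g₁` are the changes of `E` and of
`ΠE` over `A`.

Contractions exist because the products of basis elements of `K` and of `A` are independent in `K ⊗
A`. This is seen by letting the algebra `Λ_{m+n}` act on the tensor product of the vector spaces
`Λ_m` and `Λ_n`, and evaluating at `1 ⊗ 1` (`contractAlg_mul`).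

The bundle `ΠE` is built without gluing. With `η` the generator of `Λ_1`, its points over `A` are
the points of `E` over `Λ_1 ⊗ A` that vanish for `η = 0`. In a trivialization they are exactly `η w`
with `w ∈ (A ⊗ ΠV)_0` (`Bar.eq_tensOddMul_eta`), and substituting `c` for `η` is the multiplication
by the odd element `c`. Functoriality, fibre operations and supersmooth transitions are inherited
from `E`.

The isomorphism is the inverse of `ofBar`, which sends `k ⊗ s` to the family `(p, m) ↦ p(k) s(m)`.
Contraction of generic values proves both injectivity and surjectivity. -/

@[simp] lemma coe_res (φ : A ⟶ B) (i : ZMod 2) (x : A.part i) :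
    ((Hom.res φ i x : B.part i) : B.Alg) = Hom.alg φ x := rfl

@[simp] lemma coe_mulPart (i j k : ZMod 2) (h : i + j = k) (a : A.part i) (x : A.part j) :
    ((mulPart i j k h a x : A.part k) : A.Alg) = a * x := rfl

lemma alg_comp (φ : A ⟶ B) (ψ : B ⟶ C) (x : A.Alg) :
    Hom.alg (φ ≫ ψ) x = Hom.alg ψ (Hom.alg φ x) := rfl

/-- The coproduct `Λ_m ⊗ Λ_n = Λ_{m+n}` of two Grassmann algebras. -/
def tens (K A : Gr) : Gr := ⟨K.rank + A.rank⟩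

/-- The first generators of the coproduct. -/
def idxL (K A : Gr) (i : Fin K.rank) : Fin (tens K A).rank := Fin.castAdd A.rank i

/-- The last generators of the coproduct. -/
def idxR (K A : Gr) (i : Fin A.rank) : Fin (tens K A).rank := Fin.natAdd K.rank i

/-- The family on the generators of the coproduct with given values on both kinds of generators. -/
def idxElim {X : Type*} (f : Fin K.rank → X) (g : Fin A.rank → X) (i : Fin (tens K A).rank) : X :=
  Fin.addCases (motive := fun _ => X) f g i

@[simp] lemma idxElim_idxL {X : Type*} (f : Fin K.rank → X) (g : Fin A.rank → X) (i : Fin K.rank) :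
    idxElim f g (idxL K A i) = f i := Fin.addCases_left _

@[simp] lemma idxElim_idxR {X : Type*} (f : Fin K.rank → X) (g : Fin A.rank → X) (i : Fin A.rank) :
    idxElim f g (idxR K A i) = g i := Fin.addCases_right _

lemma idx_cases {P : Fin (tens K A).rank → Prop} (hL : ∀ i, P (idxL K A i))
    (hR : ∀ i, P (idxR K A i)) (i : Fin (tens K A).rank) : P i :=
  Fin.addCases (motive := P) hL hR i

lemma sum_idx {X : Type*} [AddCommMonoid X] (f : Fin (tens K A).rank → X) :
    ∑ i, f i = ∑ i, f (idxL K A i) + ∑ i, f (idxR K A i) := Fin.sum_univ_add _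

/-- The first inclusion into the coproduct. -/
def inl (K A : Gr) : K ⟶ tens K A := homOfGen fun i => (tens K A).gen (idxL K A i)

/-- The second inclusion into the coproduct. -/
def inr (K A : Gr) : A ⟶ tens K A := homOfGen fun i => (tens K A).gen (idxR K A i)

/-- The morphism out of the coproduct with given components. -/
def desc (p : K ⟶ B) (q : A ⟶ B) : tens K A ⟶ B :=
  homOfGen (A := tens K A)
    (idxElim (fun i => Hom.res p 1 (K.gen i)) fun i => Hom.res q 1 (A.gen i))

@[simp] lemma inl_desc (p : K ⟶ B) (q : A ⟶ B) : inl K A ≫ desc p q = p :=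
  hom_ext fun i => by
    rw [Hom.res_comp, LinearMap.comp_apply, inl, homOfGen_gen, desc, homOfGen_gen,
      idxElim_idxL]

@[simp] lemma inr_desc (p : K ⟶ B) (q : A ⟶ B) : inr K A ≫ desc p q = q :=
  hom_ext fun i => by
    rw [Hom.res_comp, LinearMap.comp_apply, inr, homOfGen_gen, desc, homOfGen_gen,
      idxElim_idxR]

@[simp] lemma desc_inl (p : K ⟶ B) (q : A ⟶ B) (x : K.Alg) :
    Hom.alg (desc p q) (Hom.alg (inl K A) x) = Hom.alg p x := by
  rw [← alg_comp, inl_desc]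

lemma tens_hom_ext {f g : tens K A ⟶ B} (h₁ : inl K A ≫ f = inl K A ≫ g)
    (h₂ : inr K A ≫ f = inr K A ≫ g) : f = g := by
  refine hom_ext fun i => ?_
  refine idx_cases (P := fun i => Hom.res f 1 ((tens K A).gen i) =
    Hom.res g 1 ((tens K A).gen i)) (fun i => ?_) (fun i => ?_) i
  · have h := congrArg (fun q => Hom.res q 1 (K.gen i)) h₁
    simpa only [Hom.res_comp, LinearMap.comp_apply, inl, homOfGen_gen] using h
  · have h := congrArg (fun q => Hom.res q 1 (A.gen i)) h₂
    simpa only [Hom.res_comp, LinearMap.comp_apply, inr, homOfGen_gen] using h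

/-- The morphism `id ⊗ φ`. -/
def whisker (K : Gr) (φ : A ⟶ B) : tens K A ⟶ tens K B := desc (inl K B) (φ ≫ inr K B)

@[simp] lemma inl_whisker (φ : A ⟶ B) : inl K A ≫ whisker K φ = inl K B := inl_desc _ _

@[simp] lemma inr_whisker (φ : A ⟶ B) : inr K A ≫ whisker K φ = φ ≫ inr K B := inr_desc _ _

@[simp] lemma whisker_id : whisker K (𝟙 A) = 𝟙 (tens K A) :=
  tens_hom_ext (by simp) (by simp)

@[simp] lemma whisker_comp (φ : A ⟶ B) (ψ : B ⟶ C) :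
    whisker K (φ ≫ ψ) = whisker K φ ≫ whisker K ψ :=
  tens_hom_ext (by rw [← Category.assoc]; simp)
    (by rw [← Category.assoc, inr_whisker, inr_whisker, Category.assoc, Category.assoc,
      inr_whisker])

@[simp] lemma whisker_desc (φ : A ⟶ B) (p : K ⟶ C) (q : B ⟶ C) :
    whisker K φ ≫ desc p q = desc p (φ ≫ q) :=
  tens_hom_ext (by rw [← Category.assoc]; simp) (by rw [← Category.assoc]; simp)

@[simp] lemma desc_comp (p : K ⟶ B) (q : A ⟶ B) (φ : B ⟶ C) :
    desc p q ≫ φ = desc (p ≫ φ) (q ≫ φ) :=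
  tens_hom_ext (by rw [← Category.assoc]; simp) (by rw [← Category.assoc]; simp)

@[simp] lemma alg_whisker_inl (φ : A ⟶ B) (x : K.Alg) :
    Hom.alg (whisker K φ) (Hom.alg (inl K A) x) = Hom.alg (inl K B) x := by
  rw [← alg_comp, inl_whisker]

@[simp] lemma alg_whisker_inr (φ : A ⟶ B) (x : A.Alg) :
    Hom.alg (whisker K φ) (Hom.alg (inr K A) x) = Hom.alg (inr K B) (Hom.alg φ x) := by
  rw [← alg_comp, inr_whisker]; rfl

lemma homOfGen_ι (y : Fin A.rank → B.part 1) (v : Fin A.rank → ℝ) :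
    Hom.alg (homOfGen y) (ExteriorAlgebra.ι ℝ v) = ∑ i, v i • (y i : B.Alg) := by
  change ExteriorAlgebra.lift ℝ _ (ExteriorAlgebra.ι ℝ v) = _
  rw [ExteriorAlgebra.lift_ι_apply]
  simp [Fintype.linearCombination_apply]

lemma ι_eq_inl_add_inr (v : Fin (tens K A).rank → ℝ) :
    (ExteriorAlgebra.ι ℝ v : (tens K A).Alg) =
      Hom.alg (inl K A) (ExteriorAlgebra.ι ℝ fun i => v (idxL K A i)) +
      Hom.alg (inr K A) (ExteriorAlgebra.ι ℝ fun i => v (idxR K A i)) := by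
  rw [inl, inr, homOfGen_ι, homOfGen_ι]
  have : v = ∑ i, v i • (Pi.single i (1 : ℝ) : Fin (tens K A).rank → ℝ) := by
    simpa using (pi_eq_sum_univ' v)
  conv_lhs => rw [this]
  rw [map_sum, sum_idx]
  simp only [map_smul]
  rfl

/-- Products of elements of the two factors span the coproduct, compatibly with the parity. -/
lemma part_tens_le (i : ZMod 2) : (tens K A).part i ≤ Submodule.span ℝ
    {x | ∃ j l, j + l = i ∧ ∃ k ∈ K.part j, ∃ a ∈ A.part l,
      x = Hom.alg (inl K A) k * Hom.alg (inr K A) a} := by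
  set S : ZMod 2 → Submodule ℝ (tens K A).Alg := fun i => Submodule.span ℝ
    {x | ∃ j l, j + l = i ∧ ∃ k ∈ K.part j, ∃ a ∈ A.part l,
      x = Hom.alg (inl K A) k * Hom.alg (inr K A) a} with hS
  have hmul : ∀ (i : ZMod 2) (v : Fin (tens K A).rank → ℝ) (x : (tens K A).Alg), x ∈ S i →
      ExteriorAlgebra.ι ℝ v * x ∈ S (1 + i) := by
    intro i v x hx
    induction hx using Submodule.span_induction with
    | zero => simp
    | add x y _ _ hx hy => rw [mul_add]; exact add_mem hx hy
    | smul r x _ hx => rw [mul_smul_comm]; exact Submodule.smul_mem _ _ hx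
    | mem x hx =>
      obtain ⟨j, l, rfl, k, hk, a, ha, rfl⟩ := hx
      rw [ι_eq_inl_add_inr, add_mul]
      refine add_mem ?_ ?_
      · rw [← mul_assoc, ← map_mul]
        exact Submodule.subset_span ⟨1 + j, l, add_assoc _ _ _, _, SetLike.mul_mem_graded
          (A := K.part) (CliffordAlgebra.ι_mem_evenOdd_one _ _) hk, a, ha, rfl⟩
      · set w : Fin A.rank → ℝ := fun i => v (idxR K A i)
        have hw : Hom.alg (inr K A) (ExteriorAlgebra.ι ℝ w) ∈ (tens K A).part 1 :=
          Hom.parity (inr K A) 1 _ (CliffordAlgebra.ι_mem_evenOdd_one _ _)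
        have ht : Hom.alg (inl K A) k * Hom.alg (inr K A) (ExteriorAlgebra.ι ℝ w * a) ∈
            S (1 + (j + l)) :=
          Submodule.subset_span ⟨j, 1 + l, by ring, k, hk, _, SetLike.mul_mem_graded
            (A := A.part) (CliffordAlgebra.ι_mem_evenOdd_one _ _) ha, rfl⟩
        -- Moving the vector of `A` to the right of `inl k` applies the grading involution to `inl
        -- k`. On a homogeneous `k` this is a sign, which the span absorbs.
        rw [← mul_assoc, odd_mul _ hw]
        rcases (by decide : ∀ i : ZMod 2, i = 0 ∨ i = 1) j with rfl | rfl
        · rw [CliffordAlgebra.involute_eq_of_mem_even (Hom.parity (inl K A) 0 _ hk), mul_assoc,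
            ← map_mul]
          exact ht
        · rw [CliffordAlgebra.involute_eq_of_mem_odd (Hom.parity (inl K A) 1 _ hk), neg_mul,
            neg_mul, mul_assoc, ← map_mul]
          exact neg_mem ht
  -- The parity-preserving inductions below multiply by two vectors at a time.
  have hmul2 : ∀ (i : ZMod 2) (v w : Fin (tens K A).rank → ℝ) (x : (tens K A).Alg), x ∈ S i →
      ExteriorAlgebra.ι ℝ v * ExteriorAlgebra.ι ℝ w * x ∈ S i := by
    intro i v w x hx
    have h := hmul _ v _ (hmul i w x hx)
    rwa [← mul_assoc, ← add_assoc, show (1 : ZMod 2) + 1 = 0 by decide, zero_add] at h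
  have h1 : (1 : (tens K A).Alg) ∈ S 0 :=
    Submodule.subset_span ⟨0, 0, add_zero _, 1, SetLike.GradedOne.one_mem (A := K.part), 1,
      SetLike.GradedOne.one_mem (A := A.part), by simp⟩
  intro x hx
  rcases (by decide : ∀ i : ZMod 2, i = 0 ∨ i = 1) i with rfl | rfl
  · induction x, hx using CliffordAlgebra.even_induction with
    | algebraMap r =>
      rw [Algebra.algebraMap_eq_smul_one]
      exact Submodule.smul_mem _ _ h1
    | add x y _ _ hx hy => exact add_mem hx hy
    | ι_mul_ι_mul v w z _ hz => exact hmul2 0 v w z hz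
  · induction x, hx using CliffordAlgebra.odd_induction with
    | ι v => simpa using hmul 0 v 1 h1
    | add x y _ _ hx hy => exact add_mem hx hy
    | ι_mul_ι_mul v w z _ hz => exact hmul2 1 v w z hz

/-- The product of an element of the first and an element of the second factor. -/
def tensMul (j l i : ZMod 2) (h : j + l = i) (k : K.part j) : A.part l →ₗ[ℝ] (tens K A).part i :=
  (mulPart j l i h (Hom.res (inl K A) j k)).comp (Hom.res (inr K A) l)

lemma coe_tensMul (j l i : ZMod 2) (h : j + l = i) (k : K.part j) (a : A.part l) :
    (tensMul j l i h k a : (tens K A).Alg) = Hom.alg (inl K A) k * Hom.alg (inr K A) a := rfl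

/-- Products span the homogeneous part, by `part_tens_le`. The span lives in the whole algebra while
`f` and `g` are defined on the part only, so membership in the part is carried through the
induction. -/
lemma part_tens_hom_ext {i : ZMod 2} {W : Type*} [AddCommGroup W] [Module ℝ W]
    {f g : (tens K A).part i →ₗ[ℝ] W}
    (h : ∀ (j l : ZMod 2) (hi : j + l = i) (k : K.part j) (a : A.part l),
      f (tensMul j l i hi k a) = g (tensMul j l i hi k a)) : f = g := by
  have key : ∀ x ∈ Submodule.span ℝ {x | ∃ j l, j + l = i ∧ ∃ k ∈ K.part j, ∃ a ∈ A.part l,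
      x = Hom.alg (inl K A) k * Hom.alg (inr K A) a}, ∃ hx : x ∈ (tens K A).part i,
        f ⟨x, hx⟩ = g ⟨x, hx⟩ := by
    intro x hx
    induction hx using Submodule.span_induction with
    | zero => exact ⟨zero_mem _, (map_zero f).trans (map_zero g).symm⟩
    | add x y _ _ hx hy =>
      obtain ⟨hx, ex⟩ := hx
      obtain ⟨hy, ey⟩ := hy
      refine ⟨add_mem hx hy, ?_⟩
      have := congrArg₂ (· + ·) ex ey
      simp only [← map_add] at this
      exact this
    | smul r x _ hx =>
      obtain ⟨hx, ex⟩ := hx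
      refine ⟨Submodule.smul_mem _ r hx, ?_⟩
      have := congrArg (r • ·) ex
      simp only [← map_smul] at this
      exact this
    | mem x hx =>
      obtain ⟨j, l, hi, k, hk, a, ha, rfl⟩ := hx
      exact ⟨(tensMul j l i hi ⟨k, hk⟩ ⟨a, ha⟩).2, h j l hi ⟨k, hk⟩ ⟨a, ha⟩⟩
  ext x
  obtain ⟨_, h⟩ := key x (part_tens_le i x.2)
  exact h

/-! ### The action of the coproduct on the tensor product of the two algebras. -/

/-- The action of a vector of `ℝ^m ⊕ ℝ^n` on `Λ_m ⊗ Λ_n`. -/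
def vectorAction (K A : Gr) :
    (Fin (tens K A).rank → ℝ) →ₗ[ℝ] Module.End ℝ (K.Alg ⊗[ℝ] A.Alg) :=
  ((TensorProduct.mapBilinear (RingHom.id ℝ) K.Alg A.Alg K.Alg A.Alg).flip LinearMap.id).comp
      ((LinearMap.mul ℝ K.Alg).comp ((ExteriorAlgebra.ι ℝ).comp
        (LinearMap.funLeft ℝ ℝ (idxL K A)))) +
    (TensorProduct.mapBilinear (RingHom.id ℝ) K.Alg A.Alg K.Alg A.Alg
      (CliffordAlgebra.involute (Q := (0 : QuadraticForm ℝ (Fin K.rank → ℝ)))).toLinearMap).comp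
      ((LinearMap.mul ℝ A.Alg).comp ((ExteriorAlgebra.ι ℝ).comp
        (LinearMap.funLeft ℝ ℝ (idxR K A))))

lemma vectorAction_tmul (v : Fin (tens K A).rank → ℝ) (y : K.Alg) (z : A.Alg) :
    vectorAction K A v (y ⊗ₜ z) =
      (ExteriorAlgebra.ι ℝ (fun i => v (idxL K A i)) * y) ⊗ₜ z +
      (CliffordAlgebra.involute (Q := (0 : QuadraticForm ℝ (Fin K.rank → ℝ))) y) ⊗ₜ
        (ExteriorAlgebra.ι ℝ (fun i => v (idxR K A i)) * z) := rfl

/-- This is the relation required by the universal property of the exterior algebra. The squares of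
the two summands vanish, and the mixed terms cancel because the involution changes the sign of a
vector of the first factor. -/
lemma vectorAction_sq (v : Fin (tens K A).rank → ℝ) :
    vectorAction K A v * vectorAction K A v = 0 := by
  refine TensorProduct.ext' fun y z => ?_
  rw [Module.End.mul_apply, vectorAction_tmul, map_add, vectorAction_tmul, vectorAction_tmul,
    ← mul_assoc, ExteriorAlgebra.ι_sq_zero, ← mul_assoc, ExteriorAlgebra.ι_sq_zero]
  simp only [zero_mul, TensorProduct.zero_tmul, TensorProduct.tmul_zero, map_mul]
  rw [show CliffordAlgebra.involute (Q := (0 : QuadraticForm ℝ (Fin K.rank → ℝ)))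
    (ExteriorAlgebra.ι ℝ fun i => v (idxL K A i)) = - _ from
      CliffordAlgebra.involute_ι _]
  simp [neg_mul, TensorProduct.neg_tmul]

/-- The action of `Λ_m ⊗ Λ_n` on the vector space `Λ_m ⊗ Λ_n`. -/
def tensAction (K A : Gr) : (tens K A).Alg →ₐ[ℝ] Module.End ℝ (K.Alg ⊗[ℝ] A.Alg) :=
  ExteriorAlgebra.lift ℝ ⟨vectorAction K A, vectorAction_sq⟩

lemma tensAction_ι (v : Fin (tens K A).rank → ℝ) :
    tensAction K A (ExteriorAlgebra.ι ℝ v) = vectorAction K A v :=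
  ExteriorAlgebra.lift_ι_apply _ _ _ _

lemma inl_ι (v : Fin K.rank → ℝ) : Hom.alg (inl K A) (ExteriorAlgebra.ι ℝ v) =
    ExteriorAlgebra.ι ℝ (idxElim v 0) := by
  rw [ι_eq_inl_add_inr]
  simp only [idxElim_idxL, idxElim_idxR, Pi.zero_apply]
  rw [show (fun _ => 0 : Fin A.rank → ℝ) = 0 from rfl, map_zero, map_zero, add_zero]

lemma inr_ι (v : Fin A.rank → ℝ) : Hom.alg (inr K A) (ExteriorAlgebra.ι ℝ v) =
    ExteriorAlgebra.ι ℝ (idxElim 0 v) := by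
  rw [ι_eq_inl_add_inr]
  simp only [idxElim_idxL, idxElim_idxR, Pi.zero_apply]
  rw [show (fun _ => 0 : Fin K.rank → ℝ) = 0 from rfl, map_zero, map_zero, zero_add]

lemma tensAction_inl (k y : K.Alg) (z : A.Alg) :
    tensAction K A (Hom.alg (inl K A) k) (y ⊗ₜ z) = (k * y) ⊗ₜ z := by
  induction k using CliffordAlgebra.induction generalizing y z with
  | algebraMap r =>
    rw [AlgHom.commutes, AlgHom.commutes, Module.algebraMap_end_apply, TensorProduct.smul_tmul',
      Algebra.smul_def]
  | ι v =>
    have h := inl_ι (K := K) (A := A) v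
    change tensAction K A (Hom.alg (inl K A) (ExteriorAlgebra.ι ℝ v)) (y ⊗ₜ z) = _
    rw [h, tensAction_ι, vectorAction_tmul]
    simp only [idxElim_idxL, idxElim_idxR, Pi.zero_apply]
    rw [show (fun _ => 0 : Fin A.rank → ℝ) = 0 from rfl, map_zero, zero_mul,
      TensorProduct.tmul_zero, add_zero]
  | mul x w hx hw => rw [map_mul, map_mul, Module.End.mul_apply, hw, hx, mul_assoc]
  | add x w hx hw =>
    rw [map_add, map_add, LinearMap.add_apply, hx, hw, add_mul, TensorProduct.add_tmul]

/-- The first tensor factor is restricted to `1`, which the involution fixes, so that no sign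
appears. -/
lemma tensAction_inr (a z : A.Alg) :
    tensAction K A (Hom.alg (inr K A) a) (1 ⊗ₜ z) = 1 ⊗ₜ (a * z) := by
  induction a using CliffordAlgebra.induction generalizing z with
  | algebraMap r =>
    rw [AlgHom.commutes, AlgHom.commutes, Module.algebraMap_end_apply, ← TensorProduct.tmul_smul,
      Algebra.smul_def]
  | ι v =>
    have h := inr_ι (K := K) (A := A) v
    change tensAction K A (Hom.alg (inr K A) (ExteriorAlgebra.ι ℝ v)) (1 ⊗ₜ z) = _
    rw [h, tensAction_ι, vectorAction_tmul]
    simp only [idxElim_idxL, idxElim_idxR, Pi.zero_apply]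
    rw [show (fun _ => 0 : Fin K.rank → ℝ) = 0 from rfl, map_zero, zero_mul,
      TensorProduct.zero_tmul, zero_add, map_one]
  | mul x w hx hw => rw [map_mul, map_mul, Module.End.mul_apply, hw, hx, mul_assoc]
  | add x w hx hw =>
    rw [map_add, map_add, LinearMap.add_apply, hx, hw, add_mul, TensorProduct.tmul_add]

/-! ### Contraction with functionals on the first factor. -/

lemma isCompl_part (j : ZMod 2) : IsCompl (K.part j) (K.part (j + 1)) := by
  rcases (by decide : ∀ i : ZMod 2, i = 0 ∨ i = 1) j with rfl | rfl
  · exact CliffordAlgebra.evenOdd_isCompl _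
  · exact (CliffordAlgebra.evenOdd_isCompl _).symm

/-- The extension by zero of a functional on the part of parity `j`. -/
def extendDual {j : ZMod 2} (f : K.part j →ₗ[ℝ] ℝ) : K.Alg →ₗ[ℝ] ℝ :=
  LinearMap.ofIsCompl (isCompl_part j) f 0

lemma extendDual_coe {j : ZMod 2} (f : K.part j →ₗ[ℝ] ℝ) (k : K.part j) :
    extendDual f k = f k := LinearMap.ofIsCompl_apply_left _ _

lemma extendDual_coe_ne {j j' : ZMod 2} (hj : j' ≠ j) (f : K.part j →ₗ[ℝ] ℝ) (k : K.part j') :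
    extendDual f k = 0 := by
  obtain rfl : j' = j + 1 := (by decide : ∀ j j' : ZMod 2, j' ≠ j → j' = j + 1) _ _ hj
  exact LinearMap.ofIsCompl_apply_right _ _

/-- The contraction with a functional on the first factor of a coproduct. -/
def contractAlg {j : ZMod 2} (f : K.part j →ₗ[ℝ] ℝ) : (tens K A).Alg →ₗ[ℝ] A.Alg :=
  ((TensorProduct.lid ℝ A.Alg).toLinearMap.comp (LinearMap.rTensor A.Alg (extendDual f))).comp
    ((LinearMap.applyₗ ((1 : K.Alg) ⊗ₜ[ℝ] (1 : A.Alg))).comp (tensAction K A).toLinearMap)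

/-- Acting on `1 ⊗ 1`, first `inr a` gives `1 ⊗ a` and then `inl k` gives `k ⊗ a`. Applying the
functional to the first tensor factor leaves a multiple of `a`, without sign. -/
lemma contractAlg_mul {j : ZMod 2} (f : K.part j →ₗ[ℝ] ℝ) (k : K.Alg) (a : A.Alg) :
    contractAlg f (Hom.alg (inl K A) k * Hom.alg (inr K A) a) = extendDual f k • a := by
  change TensorProduct.lid ℝ A.Alg (LinearMap.rTensor A.Alg (extendDual f)
    (tensAction K A (Hom.alg (inl K A) k * Hom.alg (inr K A) a) (1 ⊗ₜ 1))) = _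
  rw [map_mul, Module.End.mul_apply, tensAction_inr, tensAction_inl, LinearMap.rTensor_tmul,
    TensorProduct.lid_tmul, mul_one, mul_one]

/-- The contraction with a functional on the first factor of a coproduct, on homogeneous parts. -/
def contract {j : ZMod 2} (f : K.part j →ₗ[ℝ] ℝ) (l i : ZMod 2) (h : j + l = i) :
    (tens K A).part i →ₗ[ℝ] A.part l :=
  (contractAlg f).restrict fun x hx => by
    have hx' := part_tens_le i hx
    clear hx
    induction hx' using Submodule.span_induction with
    | zero => simp
    | add x y _ _ hx hy => rw [map_add]; exact add_mem hx hy
    | smul r x _ hx => rw [map_smul]; exact Submodule.smul_mem _ _ hx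
    | mem x hx =>
      obtain ⟨j', l', hi, k, hk, a, ha, rfl⟩ := hx
      rw [contractAlg_mul]
      -- If `k` has parity `j`, the parity of `a` is forced by `j + l = i`. Otherwise the extension
      -- by zero kills the term.
      by_cases hj : j' = j
      · obtain rfl : l' = l := by subst hj; exact add_left_cancel (hi.trans h.symm)
        exact Submodule.smul_mem _ _ ha
      · rw [extendDual_coe_ne hj f ⟨k, hk⟩, zero_smul]
        exact zero_mem _

lemma contract_tensMul {j l i : ZMod 2} (f : K.part j →ₗ[ℝ] ℝ) (h : j + l = i) (k : K.part j)
    (a : A.part l) : contract f l i h (tensMul j l i h k a) = f k • a :=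
  Subtype.ext ((contractAlg_mul f _ _).trans (congrArg (· • (a : A.Alg)) (extendDual_coe f k)))

lemma contract_tensMul_ne {j l i j' l' : ZMod 2} (f : K.part j →ₗ[ℝ] ℝ) (h : j + l = i)
    (h' : j' + l' = i) (hj : j' ≠ j) (k : K.part j') (a : A.part l') :
    contract f l i h (tensMul j' l' i h' k a) = 0 :=
  Subtype.ext ((contractAlg_mul f _ _).trans 
    ((congrArg (· • (a : A.Alg)) (extendDual_coe_ne hj f k)).trans (zero_smul _ _)))

/-- The morphism `id ⊗ φ` does not touch the factor to which the functional is applied. This is the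
source of the naturality of the coefficients of a family. -/
lemma contract_whisker {j l i : ZMod 2} (f : K.part j →ₗ[ℝ] ℝ) (h : j + l = i) (φ : A ⟶ B) :
    (contract f l i h).comp (Hom.res (whisker K φ) i) = (Hom.res φ l).comp (contract f l i h) := by
  refine part_tens_hom_ext fun j' l' hi k a => ?_
  have e : Hom.res (whisker K φ) i (tensMul j' l' i hi k a) =
      tensMul j' l' i hi k (Hom.res φ l' a) := by
    apply Subtype.ext
    simp [coe_tensMul]
  rw [LinearMap.comp_apply, LinearMap.comp_apply, e]
  by_cases hj : j' = j
  · subst hj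
    obtain rfl : l' = l := add_left_cancel (hi.trans h.symm)
    rw [contract_tensMul, contract_tensMul, map_smul]
  · rw [contract_tensMul_ne f h hi hj, contract_tensMul_ne f h hi hj, map_zero]

/-- Contraction commutes with multiplication by the even elements of the second factor. -/
lemma contract_inr_mul {j l i : ZMod 2} (f : K.part j →ₗ[ℝ] ℝ) (h : j + l = i) (c : A.part 0) :
    (contract f l i h).comp (mulPart 0 i i (zero_add i) (Hom.res (inr K A) 0 c)) =
      (mulPart 0 l l (zero_add l) c).comp (contract f l i h) := by
  refine part_tens_hom_ext fun j' l' hi k a => ?_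
  have e : mulPart 0 i i (zero_add i) (Hom.res (inr K A) 0 c) (tensMul j' l' i hi k a) =
      tensMul j' l' i hi k (mulPart 0 l' l' (zero_add l') c a) := by
    apply Subtype.ext
    simp only [coe_mulPart, coe_tensMul, coe_res, map_mul]
    rw [← mul_assoc, ← mul_assoc, mul_even _ _ (Hom.parity (inr K A) 0 _ c.2)]
  rw [LinearMap.comp_apply, LinearMap.comp_apply, e]
  by_cases hj : j' = j
  · subst hj
    obtain rfl : l' = l := add_left_cancel (hi.trans h.symm)
    rw [contract_tensMul, contract_tensMul, map_smul]
  · rw [contract_tensMul_ne f h hi hj, contract_tensMul_ne f h hi hj, map_zero]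

/-- The expansion of an element of a coproduct in a basis of the first factor. -/
lemma sum_tensMul_contract {ι₀ ι₁ : Type*} [Fintype ι₀] [Fintype ι₁]
    (b₀ : Module.Basis ι₀ ℝ (K.part 0)) (b₁ : Module.Basis ι₁ ℝ (K.part 1)) {i l : ZMod 2}
    (h : 1 + l = i) :
    ∑ n, (tensMul 0 i i (zero_add i) (b₀ n)).comp (contract (A := A) (b₀.coord n) i i (zero_add i)) +
      ∑ n, (tensMul 1 l i h (b₁ n)).comp (contract (b₁.coord n) l i h) = LinearMap.id := by
  refine part_tens_hom_ext fun j' l' hi k a => ?_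
  simp only [LinearMap.add_apply, LinearMap.sum_apply, LinearMap.comp_apply, LinearMap.id_apply]
  -- Only the sum of the parity of `k` survives, and it is the expansion of `k` in the basis, times
  -- `a`.
  rcases (by decide : ∀ i : ZMod 2, i = 0 ∨ i = 1) j' with rfl | rfl
  · obtain rfl : l' = i := by rw [← hi, zero_add]
    rw [Finset.sum_eq_zero (s := (Finset.univ : Finset ι₁)) fun n _ => by
      rw [contract_tensMul_ne _ h hi (by decide), map_zero], add_zero]
    apply Subtype.ext
    simp only [contract_tensMul, map_smul, AddSubmonoidClass.coe_finsetSum, Submodule.coe_smul,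
      coe_tensMul, Module.Basis.coord_apply]
    conv_rhs => rw [← b₀.sum_repr k]
    simp only [AddSubmonoidClass.coe_finsetSum, Submodule.coe_smul, map_sum, map_smul,
      Finset.sum_mul, smul_mul_assoc]
  · obtain rfl : l' = l := add_left_cancel (hi.trans h.symm)
    rw [Finset.sum_eq_zero (s := (Finset.univ : Finset ι₀)) fun n _ => by
      rw [contract_tensMul_ne _ (zero_add i) hi (by decide), map_zero], zero_add]
    apply Subtype.ext
    simp only [contract_tensMul, map_smul, AddSubmonoidClass.coe_finsetSum, Submodule.coe_smul,
      coe_tensMul, Module.Basis.coord_apply]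
    conv_rhs => rw [← b₁.sum_repr k]
    simp only [AddSubmonoidClass.coe_finsetSum, Submodule.coe_smul, map_sum, map_smul,
      Finset.sum_mul, smul_mul_assoc]

end Gr

/-! ### Multiplication and contraction on the points of super vector spaces -/

namespace GTensor

variable {A B : Gr} {i j : ZMod 2} {V : Type u}

section Algebraic

variable [AddCommGroup V] [Module ℝ V]

/-- Once scalar multiplication is an `lmap`, identities on `Λ_i ⊗ V` reduce, by `lmap_id_lmap`, to
identities between linear maps of the parts of Grassmann algebras. -/
lemma smul_eq_lmap (a : A.Even) (x : GTensor A i V) :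
    a • x = lmap (Gr.mulPart 0 i i (zero_add i) ⟨a, a.2⟩) LinearMap.id x := by
  induction x using GTensor.induction with
  | h0 => simp
  | ht p v => rfl
  | ha x y hx hy => rw [smul_add, map_add, hx, hy]

lemma lmap_add_left (L L' : A.part i →ₗ[ℝ] B.part j) (x : GTensor A i V) :
    lmap (L + L') (LinearMap.id : V →ₗ[ℝ] V) x =
      lmap L LinearMap.id x + lmap L' LinearMap.id x := by
  change TensorProduct.map (L + L') LinearMap.id x = _
  rw [TensorProduct.map_add_left]
  rfl

lemma lmap_smul_left (r : ℝ) (L : A.part i →ₗ[ℝ] B.part j) (x : GTensor A i V) :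
    lmap (r • L) (LinearMap.id : V →ₗ[ℝ] V) x = r • lmap L LinearMap.id x := by
  change TensorProduct.map (r • L) LinearMap.id x = _
  rw [TensorProduct.map_smul_left]
  rfl

lemma lmap_zero_left (x : GTensor A i V) :
    lmap (0 : A.part i →ₗ[ℝ] B.part j) (LinearMap.id : V →ₗ[ℝ] V) x = 0 := by
  simpa using lmap_smul_left (0 : ℝ) (0 : A.part i →ₗ[ℝ] B.part j) x

lemma lmap_sum_left {ι : Type*} (s : Finset ι) (L : ι → A.part i →ₗ[ℝ] B.part j)
    (x : GTensor A i V) : lmap (∑ n ∈ s, L n) (LinearMap.id : V →ₗ[ℝ] V) x =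
      ∑ n ∈ s, lmap (L n) LinearMap.id x := by
  classical
  induction s using Finset.induction_on with
  | empty => simp [lmap_zero_left]
  | insert n s hn ih => rw [Finset.sum_insert hn, Finset.sum_insert hn, lmap_add_left, ih]

lemma lmap_id_lmap {C : Gr} {k : ZMod 2} (L : A.part i →ₗ[ℝ] B.part j)
    (L' : B.part j →ₗ[ℝ] C.part k) (x : GTensor A i V) :
    lmap L' (LinearMap.id : V →ₗ[ℝ] V) (lmap L LinearMap.id x) =
      lmap (L'.comp L) LinearMap.id x := by
  rw [lmap_lmap, LinearMap.id_comp]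

end Algebraic

end GTensor

namespace Gr

variable {A B : Gr}

/-- An element of the part of parity `0`, as an element of the even subalgebra. -/
def toEven (a : A.part 0) : A.Even := ⟨a, a.2⟩

lemma resEven_toEven (φ : A ⟶ B) (a : A.part 0) :
    Hom.resEven φ (toEven a) = toEven (Hom.res φ 0 a) := rfl

lemma toEven_add (a b : A.part 0) : toEven (a + b) = toEven a + toEven b := rfl

lemma mulPart_add_left (i j k : ZMod 2) (h : i + j = k) (a b : A.part i) :
    mulPart i j k h (a + b) = mulPart i j k h a + mulPart i j k h b :=
  LinearMap.ext fun _ => Subtype.ext (add_mul _ _ _)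

lemma mulPart_smul_left (i j k : ZMod 2) (h : i + j = k) (r : ℝ) (a : A.part i) :
    mulPart i j k h (r • a) = r • mulPart i j k h a :=
  LinearMap.ext fun _ => Subtype.ext (smul_mul_assoc _ _ _)

lemma contract_comp_tensMul {K : Gr} {j l i : ZMod 2} (f : K.part j →ₗ[ℝ] ℝ) (h : j + l = i)
    (k : K.part j) : (contract (A := A) f l i h).comp (tensMul j l i h k) = f k • LinearMap.id :=
  LinearMap.ext fun a => contract_tensMul f h k a

lemma contract_comp_tensMul_ne {K : Gr} {j l i j' l' : ZMod 2} (f : K.part j →ₗ[ℝ] ℝ)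
    (h : j + l = i) (h' : j' + l' = i) (hj : j' ≠ j) (k : K.part j') :
    (contract (A := A) f l i h).comp (tensMul j' l' i h' k) = 0 :=
  LinearMap.ext fun a => contract_tensMul_ne f h h' hj k a

end Gr

namespace Bar

variable {K A B : Gr} {V₀ V₁ : Type u}

section Algebraic

variable [AddCommGroup V₀] [Module ℝ V₀] [AddCommGroup V₁] [Module ℝ V₁]

/-- Multiplication by an even element of `Λ`. -/
def evenMul (a : A.part 0) : Bar A V₀ V₁ →ₗ[ℝ] Bar A V₀ V₁ :=
  (GTensor.mulLeft 0 0 0 (by decide) a).prodMap (GTensor.mulLeft 0 1 1 (by decide) a)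

lemma evenMul_eq_smul (a : A.part 0) (x : Bar A V₀ V₁) : evenMul a x = Gr.toEven a • x :=
  Prod.ext (GTensor.smul_eq_lmap _ _).symm (GTensor.smul_eq_lmap _ _).symm

lemma evenMul_smul_left (r : ℝ) (a : A.part 0) (x : Bar A V₀ V₁) :
    evenMul (r • a) x = r • evenMul a x := by
  ext1
  · exact (congrArg (fun L => GTensor.lmap L LinearMap.id x.1)
      (Gr.mulPart_smul_left 0 0 0 _ r _)).trans (GTensor.lmap_smul_left _ _ _)
  · exact (congrArg (fun L => GTensor.lmap L LinearMap.id x.2)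
      (Gr.mulPart_smul_left 0 1 1 _ r _)).trans (GTensor.lmap_smul_left _ _ _)

lemma evenMul_add_left (a b : A.part 0) (x : Bar A V₀ V₁) :
    evenMul (a + b) x = evenMul a x + evenMul b x := by
  rw [evenMul_eq_smul, Gr.toEven_add, add_smul, evenMul_eq_smul, evenMul_eq_smul]

lemma oddMul_fst (a : A.part 1) (x : Bar A V₁ V₀) :
    (oddMul a x).1 = GTensor.lmap (Gr.mulPart 1 1 0 (by decide) a) LinearMap.id x.2 := rfl

lemma oddMul_snd (a : A.part 1) (x : Bar A V₁ V₀) :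
    (oddMul a x).2 = GTensor.lmap (Gr.mulPart 1 0 1 (by decide) a) LinearMap.id x.1 := rfl

lemma map_fst (φ : A ⟶ B) (x : Bar A V₀ V₁) :
    (map φ x).1 = GTensor.lmap (Gr.Hom.res φ 0) LinearMap.id x.1 := rfl

lemma map_snd (φ : A ⟶ B) (x : Bar A V₀ V₁) :
    (map φ x).2 = GTensor.lmap (Gr.Hom.res φ 1) LinearMap.id x.2 := rfl

lemma map_oddMul (φ : A ⟶ B) (a : A.part 1) (x : Bar A V₁ V₀) :
    map φ (oddMul a x) = oddMul (Gr.Hom.res φ 1 a) (map φ x) := by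
  have h : ∀ j k (h : 1 + j = k), (Gr.Hom.res φ k).comp (Gr.mulPart 1 j k h a) =
      (Gr.mulPart 1 j k h (Gr.Hom.res φ 1 a)).comp (Gr.Hom.res φ j) := fun j k h =>
    LinearMap.ext fun x => Subtype.ext (map_mul (Gr.Hom.alg φ) _ _)
  ext1
  · rw [map_fst, oddMul_fst, oddMul_fst, map_snd, GTensor.lmap_id_lmap, GTensor.lmap_id_lmap, h]
  · rw [map_snd, oddMul_snd, oddMul_snd, map_fst, GTensor.lmap_id_lmap, GTensor.lmap_id_lmap, h]

lemma oddMul_add_left (a b : A.part 1) (x : Bar A V₁ V₀) :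
    oddMul (a + b) x = oddMul a x + oddMul b x := by
  ext1
  · rw [Prod.fst_add, oddMul_fst, oddMul_fst, oddMul_fst, Gr.mulPart_add_left,
      GTensor.lmap_add_left]
  · rw [Prod.snd_add, oddMul_snd, oddMul_snd, oddMul_snd, Gr.mulPart_add_left,
      GTensor.lmap_add_left]

lemma oddMul_smul_left (r : ℝ) (a : A.part 1) (x : Bar A V₁ V₀) :
    oddMul (r • a) x = r • oddMul a x := by
  ext1
  · rw [Prod.smul_fst, oddMul_fst, oddMul_fst, Gr.mulPart_smul_left, GTensor.lmap_smul_left]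
  · rw [Prod.smul_snd, oddMul_snd, oddMul_snd, Gr.mulPart_smul_left, GTensor.lmap_smul_left]

lemma oddMul_zero_left (x : Bar A V₁ V₀) : oddMul (0 : A.part 1) x = 0 := by
  simpa using oddMul_smul_left (0 : ℝ) (0 : A.part 1) x

lemma oddMul_even_smul_left (e : A.Even) (a : A.part 1) (x : Bar A V₁ V₀) :
    oddMul (e • a) x = e • oddMul a x := by
  have h : ∀ j k (h : 1 + j = k), Gr.mulPart 1 j k h (e • a) =
      (Gr.mulPart 0 k k (zero_add k) ⟨e, e.2⟩).comp (Gr.mulPart 1 j k h a) := fun j k h =>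
    LinearMap.ext fun x => Subtype.ext (mul_assoc (e : A.Alg) _ _)
  ext1
  · rw [Prod.smul_fst, GTensor.smul_eq_lmap, oddMul_fst, oddMul_fst, GTensor.lmap_id_lmap, h]
  · rw [Prod.smul_snd, GTensor.smul_eq_lmap, oddMul_snd, oddMul_snd, GTensor.lmap_id_lmap, h]

/-- Even elements are central, so `e` moves past the odd factor `a` without sign. -/
lemma oddMul_even_smul (e : A.Even) (a : A.part 1) (x : Bar A V₁ V₀) :
    oddMul a (e • x) = e • oddMul a x := by
  have h : ∀ j k (h : 1 + j = k),
      (Gr.mulPart 1 j k h a).comp (Gr.mulPart 0 j j (zero_add j) ⟨e, e.2⟩) =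
      (Gr.mulPart 0 k k (zero_add k) ⟨e, e.2⟩).comp (Gr.mulPart 1 j k h a) := fun j k h =>
    LinearMap.ext fun x => Subtype.ext (by
      change (a : A.Alg) * ((e : A.Alg) * (x : A.Alg)) = (e : A.Alg) * ((a : A.Alg) * (x : A.Alg))
      rw [← mul_assoc, Gr.mul_even _ _ e.2, mul_assoc])
  ext1
  · rw [Prod.smul_fst, GTensor.smul_eq_lmap, oddMul_fst, oddMul_fst, Prod.smul_snd,
      GTensor.smul_eq_lmap, GTensor.lmap_id_lmap, GTensor.lmap_id_lmap, h]
  · rw [Prod.smul_snd, GTensor.smul_eq_lmap, oddMul_snd, oddMul_snd, Prod.smul_fst,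
      GTensor.smul_eq_lmap, GTensor.lmap_id_lmap, GTensor.lmap_id_lmap, h]

/-! ### Contractions and products on points over a coproduct. -/

/-- Contraction with an even functional on the first factor. -/
def contractEven (f : K.part 0 →ₗ[ℝ] ℝ) : Bar (K.tens A) V₀ V₁ →ₗ[ℝ] Bar A V₀ V₁ :=
  (GTensor.lmap (Gr.contract f 0 0 (by decide)) LinearMap.id).prodMap
    (GTensor.lmap (Gr.contract f 1 1 (by decide)) LinearMap.id)

/-- Contraction with an odd functional on the first factor. -/
def contractOdd (f : K.part 1 →ₗ[ℝ] ℝ) : Bar (K.tens A) V₀ V₁ →ₗ[ℝ] Bar A V₁ V₀ :=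
  ((GTensor.lmap (Gr.contract f 0 1 (by decide)) LinearMap.id).comp (LinearMap.snd ℝ _ _)).prod
    ((GTensor.lmap (Gr.contract f 1 0 (by decide)) LinearMap.id).comp (LinearMap.fst ℝ _ _))

lemma contractEven_fst (f : K.part 0 →ₗ[ℝ] ℝ) (x : Bar (K.tens A) V₀ V₁) :
    (contractEven f x).1 = GTensor.lmap (Gr.contract f 0 0 (by decide)) LinearMap.id x.1 := rfl

lemma contractEven_snd (f : K.part 0 →ₗ[ℝ] ℝ) (x : Bar (K.tens A) V₀ V₁) :
    (contractEven f x).2 = GTensor.lmap (Gr.contract f 1 1 (by decide)) LinearMap.id x.2 := rfl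

lemma contractOdd_fst (f : K.part 1 →ₗ[ℝ] ℝ) (x : Bar (K.tens A) V₀ V₁) :
    (contractOdd f x).1 = GTensor.lmap (Gr.contract f 0 1 (by decide)) LinearMap.id x.2 := rfl

lemma contractOdd_snd (f : K.part 1 →ₗ[ℝ] ℝ) (x : Bar (K.tens A) V₀ V₁) :
    (contractOdd f x).2 = GTensor.lmap (Gr.contract f 1 0 (by decide)) LinearMap.id x.1 := rfl

/-- Inherited from `Gr.contract_whisker`. It will make the coefficients of a family natural in the
Grassmann algebra. -/
lemma contractEven_map (f : K.part 0 →ₗ[ℝ] ℝ) (φ : A ⟶ B) (x : Bar (K.tens A) V₀ V₁) :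
    contractEven f (map (Gr.whisker K φ) x) = map φ (contractEven f x) := by
  ext1
  · rw [contractEven_fst, map_fst, map_fst, contractEven_fst, GTensor.lmap_id_lmap,
      GTensor.lmap_id_lmap, Gr.contract_whisker]
  · rw [contractEven_snd, map_snd, map_snd, contractEven_snd, GTensor.lmap_id_lmap,
      GTensor.lmap_id_lmap, Gr.contract_whisker]

lemma contractOdd_map (f : K.part 1 →ₗ[ℝ] ℝ) (φ : A ⟶ B) (x : Bar (K.tens A) V₀ V₁) :
    contractOdd f (map (Gr.whisker K φ) x) = map φ (contractOdd f x) := by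
  ext1
  · rw [contractOdd_fst, map_snd, map_fst, contractOdd_fst, GTensor.lmap_id_lmap,
      GTensor.lmap_id_lmap, Gr.contract_whisker]
  · rw [contractOdd_snd, map_fst, map_snd, contractOdd_snd, GTensor.lmap_id_lmap,
      GTensor.lmap_id_lmap, Gr.contract_whisker]

/-- Semilinearity along `inr`, from `Gr.contract_inr_mul`. It is what lets a contraction of a
supersmooth function over `K ⊗ A` be supersmooth over `A`. -/
lemma contractEven_smul (f : K.part 0 →ₗ[ℝ] ℝ) (c : A.Even) (x : Bar (K.tens A) V₀ V₁) :
    contractEven f (Gr.Hom.resEven (K.inr A) c • x) = c • contractEven f x := by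
  ext1
  · rw [contractEven_fst, Prod.smul_fst, Prod.smul_fst, contractEven_fst, GTensor.smul_eq_lmap,
      GTensor.smul_eq_lmap, GTensor.lmap_id_lmap, GTensor.lmap_id_lmap]
    exact congrArg (fun L => GTensor.lmap L LinearMap.id x.1)
      (Gr.contract_inr_mul f _ (⟨c, c.2⟩ : A.part 0))
  · rw [contractEven_snd, Prod.smul_snd, Prod.smul_snd, contractEven_snd, GTensor.smul_eq_lmap,
      GTensor.smul_eq_lmap, GTensor.lmap_id_lmap, GTensor.lmap_id_lmap]
    exact congrArg (fun L => GTensor.lmap L LinearMap.id x.2)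
      (Gr.contract_inr_mul f _ (⟨c, c.2⟩ : A.part 0))

lemma contractOdd_smul (f : K.part 1 →ₗ[ℝ] ℝ) (c : A.Even) (x : Bar (K.tens A) V₀ V₁) :
    contractOdd f (Gr.Hom.resEven (K.inr A) c • x) = c • contractOdd f x := by
  ext1
  · rw [contractOdd_fst, Prod.smul_snd, Prod.smul_fst, contractOdd_fst, GTensor.smul_eq_lmap,
      GTensor.smul_eq_lmap, GTensor.lmap_id_lmap, GTensor.lmap_id_lmap]
    exact congrArg (fun L => GTensor.lmap L LinearMap.id x.2)
      (Gr.contract_inr_mul f _ (⟨c, c.2⟩ : A.part 0))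
  · rw [contractOdd_snd, Prod.smul_fst, Prod.smul_snd, contractOdd_snd, GTensor.smul_eq_lmap,
      GTensor.smul_eq_lmap, GTensor.lmap_id_lmap, GTensor.lmap_id_lmap]
    exact congrArg (fun L => GTensor.lmap L LinearMap.id x.1)
      (Gr.contract_inr_mul f _ (⟨c, c.2⟩ : A.part 0))

/-- The product of an even element of the first factor and a point over the second factor. -/
def tensEvenMul (k : K.part 0) : Bar A V₀ V₁ →ₗ[ℝ] Bar (K.tens A) V₀ V₁ :=
  (evenMul (Gr.Hom.res (K.inl A) 0 k)).comp (map (K.inr A))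

/-- The product of an odd element of the first factor and a point over the second factor. -/
def tensOddMul (k : K.part 1) : Bar A V₁ V₀ →ₗ[ℝ] Bar (K.tens A) V₀ V₁ :=
  (oddMul (Gr.Hom.res (K.inl A) 1 k)).comp (map (K.inr A))

lemma tensEvenMul_fst (k : K.part 0) (x : Bar A V₀ V₁) :
    (tensEvenMul k x).1 = GTensor.lmap (Gr.tensMul 0 0 0 (by decide) k) LinearMap.id x.1 :=
  GTensor.lmap_id_lmap _ _ _

lemma tensEvenMul_snd (k : K.part 0) (x : Bar A V₀ V₁) :
    (tensEvenMul k x).2 = GTensor.lmap (Gr.tensMul 0 1 1 (by decide) k) LinearMap.id x.2 :=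
  GTensor.lmap_id_lmap _ _ _

lemma tensOddMul_fst (k : K.part 1) (x : Bar A V₁ V₀) :
    (tensOddMul k x).1 = GTensor.lmap (Gr.tensMul 1 1 0 (by decide) k) LinearMap.id x.2 :=
  GTensor.lmap_id_lmap _ _ _

lemma tensOddMul_snd (k : K.part 1) (x : Bar A V₁ V₀) :
    (tensOddMul k x).2 = GTensor.lmap (Gr.tensMul 1 0 1 (by decide) k) LinearMap.id x.1 :=
  GTensor.lmap_id_lmap _ _ _

/-- This and the next three lemmas are the orthogonality relations. Together with the expansion
`sum_tensMul_contract` they express the splitting of `(K ⊗ A ⊗ V)_0` into `K_0 ⊗ (A ⊗ V)_0` and `K_1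
⊗ (A ⊗ ΠV)_0`. -/
lemma contractEven_tensEvenMul (f : K.part 0 →ₗ[ℝ] ℝ) (k : K.part 0) (x : Bar A V₀ V₁) :
    contractEven f (tensEvenMul k x) = f k • x := by
  ext1
  · rw [contractEven_fst, tensEvenMul_fst, GTensor.lmap_id_lmap, Gr.contract_comp_tensMul,
      GTensor.lmap_smul_left, GTensor.lmap_id, Prod.smul_fst]
  · rw [contractEven_snd, tensEvenMul_snd, GTensor.lmap_id_lmap, Gr.contract_comp_tensMul,
      GTensor.lmap_smul_left, GTensor.lmap_id, Prod.smul_snd]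

lemma contractEven_tensOddMul (f : K.part 0 →ₗ[ℝ] ℝ) (k : K.part 1) (x : Bar A V₁ V₀) :
    contractEven f (tensOddMul k x) = 0 := by
  ext1
  · rw [contractEven_fst, tensOddMul_fst, GTensor.lmap_id_lmap,
      Gr.contract_comp_tensMul_ne _ _ _ (by decide), GTensor.lmap_zero_left, Prod.fst_zero]
  · rw [contractEven_snd, tensOddMul_snd, GTensor.lmap_id_lmap,
      Gr.contract_comp_tensMul_ne _ _ _ (by decide), GTensor.lmap_zero_left, Prod.snd_zero]

lemma contractOdd_tensEvenMul (f : K.part 1 →ₗ[ℝ] ℝ) (k : K.part 0) (x : Bar A V₀ V₁) :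
    contractOdd f (tensEvenMul k x) = 0 := by
  ext1
  · rw [contractOdd_fst, tensEvenMul_snd, GTensor.lmap_id_lmap,
      Gr.contract_comp_tensMul_ne _ _ _ (by decide), GTensor.lmap_zero_left, Prod.fst_zero]
  · rw [contractOdd_snd, tensEvenMul_fst, GTensor.lmap_id_lmap,
      Gr.contract_comp_tensMul_ne _ _ _ (by decide), GTensor.lmap_zero_left, Prod.snd_zero]

lemma contractOdd_tensOddMul (f : K.part 1 →ₗ[ℝ] ℝ) (k : K.part 1) (x : Bar A V₁ V₀) :
    contractOdd f (tensOddMul k x) = f k • x := by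
  ext1
  · rw [contractOdd_fst, tensOddMul_snd, GTensor.lmap_id_lmap, Gr.contract_comp_tensMul,
      GTensor.lmap_smul_left, GTensor.lmap_id, Prod.smul_fst]
  · rw [contractOdd_snd, tensOddMul_fst, GTensor.lmap_id_lmap, Gr.contract_comp_tensMul,
      GTensor.lmap_smul_left, GTensor.lmap_id, Prod.smul_snd]

/-- The expansion of a point over a coproduct in a basis of the first factor. -/
lemma sum_tensMul_contract {ι₀ ι₁ : Type*} [Fintype ι₀] [Fintype ι₁]
    (b₀ : Module.Basis ι₀ ℝ (K.part 0)) (b₁ : Module.Basis ι₁ ℝ (K.part 1))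
    (x : Bar (K.tens A) V₀ V₁) :
    ∑ n, tensEvenMul (b₀ n) (contractEven (b₀.coord n) x) +
      ∑ n, tensOddMul (b₁ n) (contractOdd (b₁.coord n) x) = x := by
  ext1
  · simp only [Prod.fst_add, Prod.fst_sum, tensEvenMul_fst, contractEven_fst, tensOddMul_fst,
      contractOdd_snd, GTensor.lmap_id_lmap, ← GTensor.lmap_sum_left, ← GTensor.lmap_add_left]
    exact (congrArg (fun L => GTensor.lmap L LinearMap.id x.1)
      (Gr.sum_tensMul_contract b₀ b₁ (by decide))).trans (GTensor.lmap_id _)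
  · simp only [Prod.snd_add, Prod.snd_sum, tensEvenMul_snd, contractEven_snd, tensOddMul_snd,
      contractOdd_fst, GTensor.lmap_id_lmap, ← GTensor.lmap_sum_left, ← GTensor.lmap_add_left]
    exact (congrArg (fun L => GTensor.lmap L LinearMap.id x.2)
      (Gr.sum_tensMul_contract b₀ b₁ (by decide))).trans (GTensor.lmap_id _)

lemma map_evenMul (φ : A ⟶ B) (a : A.part 0) (x : Bar A V₀ V₁) :
    map φ (evenMul a x) = evenMul (Gr.Hom.res φ 0 a) (map φ x) := by
  rw [evenMul_eq_smul, map_smul_even, evenMul_eq_smul, Gr.resEven_toEven]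

/-- `desc p q` is `p` on the first factor and `q` on the second. For `q = 𝟙 A` this is the
substitution of an arbitrary point `p` for the generic point. -/
lemma map_desc_tensEvenMul (p : K ⟶ B) (q : A ⟶ B) (k : K.part 0) (x : Bar A V₀ V₁) :
    map (Gr.desc p q) (tensEvenMul k x) = evenMul (Gr.Hom.res p 0 k) (map q x) := by
  rw [tensEvenMul, LinearMap.comp_apply, map_evenMul, ← map_comp, Gr.inr_desc]
  congr 2
  exact Subtype.ext (Gr.desc_inl p q k)

lemma map_desc_tensOddMul (p : K ⟶ B) (q : A ⟶ B) (k : K.part 1) (x : Bar A V₁ V₀) :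
    map (Gr.desc p q) (tensOddMul k x) = oddMul (Gr.Hom.res p 1 k) (map q x) := by
  rw [tensOddMul, LinearMap.comp_apply, map_oddMul, ← map_comp, Gr.inr_desc]
  congr 2
  exact Subtype.ext (Gr.desc_inl p q k)

end Algebraic

/-! ### Continuity of products and contractions. -/

section Normed

variable [NormedAddCommGroup V₀] [NormedSpace ℝ V₀] [NormedAddCommGroup V₁] [NormedSpace ℝ V₁]

lemma continuous_lmap_id {i j : ZMod 2} (L : A.part i →ₗ[ℝ] B.part j) :
    Continuous (GTensor.lmap L (LinearMap.id : V₀ →ₗ[ℝ] V₀)) :=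
  GTensor.continuous_lmap L (ContinuousLinearMap.id ℝ V₀)

lemma continuous_map (φ : A ⟶ B) : Continuous (map φ : Bar A V₀ V₁ → Bar B V₀ V₁) :=
  ((continuous_lmap_id _).comp continuous_fst).prodMk ((continuous_lmap_id _).comp continuous_snd)

lemma continuous_evenMul (a : A.part 0) :
    Continuous (evenMul a : Bar A V₀ V₁ → Bar A V₀ V₁) :=
  ((continuous_lmap_id _).comp continuous_fst).prodMk ((continuous_lmap_id _).comp continuous_snd)

lemma continuous_oddMul (a : A.part 1) :
    Continuous (oddMul a : Bar A V₁ V₀ → Bar A V₀ V₁) :=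
  ((continuous_lmap_id _).comp continuous_snd).prodMk ((continuous_lmap_id _).comp continuous_fst)

lemma continuous_contractEven (f : K.part 0 →ₗ[ℝ] ℝ) :
    Continuous (contractEven f : Bar (K.tens A) V₀ V₁ → Bar A V₀ V₁) :=
  ((continuous_lmap_id _).comp continuous_fst).prodMk ((continuous_lmap_id _).comp continuous_snd)

lemma continuous_contractOdd (f : K.part 1 →ₗ[ℝ] ℝ) :
    Continuous (contractOdd f : Bar (K.tens A) V₀ V₁ → Bar A V₁ V₀) :=
  ((continuous_lmap_id _).comp continuous_snd).prodMk ((continuous_lmap_id _).comp continuous_fst)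

end Normed

end Bar

/-! ### Supersmoothness of products and change of the Grassmann algebra -/

section SuperSmooth

/-- Finite dimension of `X` makes `L` continuous, so the pairing is a bounded bilinear map. Its
derivative is given by the product rule, and both terms are linear over the even part by `h₁` and
`h₂`. -/
lemma superSmoothOn_bilinear {A : Gr} {X Y Z : Type*}
    [NormedAddCommGroup X] [NormedSpace ℝ X] [Module A.Even X] [FiniteDimensional ℝ X]
    [NormedAddCommGroup Y] [NormedSpace ℝ Y] [Module A.Even Y]
    [NormedAddCommGroup Z] [NormedSpace ℝ Z] [Module A.Even Z]
    (L : X →ₗ[ℝ] Y →L[ℝ] Z) (h₁ : ∀ (a : A.Even) x y, L (a • x) y = a • L x y)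
    (h₂ : ∀ (a : A.Even) x y, L x (a • y) = a • L x y) (D : Set (X × Y)) :
    SuperSmoothOn A (fun p : X × Y => L p.1 p.2) D := by
  have hb := (LinearMap.toContinuousLinearMap L).isBoundedBilinearMap
  refine ⟨hb.contDiff.contDiffOn, fun x _ a v => ?_⟩
  have hd : fderiv ℝ (fun p : X × Y => L p.1 p.2) x = _ := hb.fderiv x
  rw [hd]
  change L x.1 (a • v.2) + L (a • v.1) x.2 = a • (L x.1 v.2 + L v.1 x.2)
  rw [h₁, h₂, smul_add]

/-- Change of the Grassmann algebra along `ψ : A ⟶ G`, by means of semilinear maps. -/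
lemma SuperSmoothOn.baseChange {A G : Gr} (ψ : A ⟶ G) {X Y X' Y' : Type*}
    [NormedAddCommGroup X] [NormedSpace ℝ X] [Module A.Even X]
    [NormedAddCommGroup Y] [NormedSpace ℝ Y] [Module A.Even Y]
    [NormedAddCommGroup X'] [NormedSpace ℝ X'] [Module G.Even X']
    [NormedAddCommGroup Y'] [NormedSpace ℝ Y'] [Module G.Even Y']
    (P : X →L[ℝ] X') (hP : ∀ (a : A.Even) v, P (a • v) = Gr.Hom.resEven ψ a • P v)
    (L : Y' →L[ℝ] Y) (hL : ∀ (a : A.Even) y, L (Gr.Hom.resEven ψ a • y) = a • L y)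
    {g : X' → Y'} {D : Set X'} (hD : IsOpen D) (hg : SuperSmoothOn G g D) :
    SuperSmoothOn A (fun x => L (g (P x))) (P ⁻¹' D) := by
  refine ⟨L.contDiff.comp_contDiffOn (hg.1.comp P.contDiff.contDiffOn fun _ h => h),
    fun x hx a v => ?_⟩
  -- In this composite `P` turns the scalar `a` into `ψ(a)`, the derivative of `g` is linear over
  -- `ψ(a)`, and `L` turns it back into `a`.
  have hd : HasFDerivAt (fun x => L (g (P x))) (L.comp ((fderiv ℝ g (P x)).comp P)) x :=
    L.hasFDerivAt.comp x ((hg.differentiableAt hD hx).hasFDerivAt.comp x P.hasFDerivAt)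
  rw [hd.fderiv]
  simp [hP, hg.2 _ hx, hL]

end SuperSmooth

/-! ### Base change and products for functions on supermanifolds. -/

namespace SuperManifold

variable {X : SuperManifold.{u}} {A G : Gr}

/-- In a chart, the map of points given by `ψ` is the continuous semilinear map `Bar.map ψ`, so the
corresponding fact on model spaces applies. It is used with `ψ = inr` and with a contraction as `L`.
-/
lemma SmoothOn.baseChange (ψ : A ⟶ G) {Y Y' : Type*}
    [NormedAddCommGroup Y] [NormedSpace ℝ Y] [Module A.Even Y]
    [NormedAddCommGroup Y'] [NormedSpace ℝ Y'] [Module G.Even Y']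
    (L : Y' →L[ℝ] Y) (hL : ∀ (a : A.Even) y, L (Gr.Hom.resEven ψ a • y) = a • L y)
    {h : X.pts.obj G → Y'} {S : Set (X.pts.obj G)} (hh : X.SmoothOn h S) :
    X.SmoothOn (fun x => L (h (X.pts.map ψ x))) {x | X.pts.map ψ x ∈ S} := by
  -- Injectivity of the chart over `G` identifies the chart image of the preimage of `S` with the
  -- preimage of the chart image of `S`, cut down to the chart domain. Hence it is open, and the
  -- local expression of `h` is defined on it.
  have himage : ∀ i, X.coord i A '' (X.source i A ∩ {x | X.pts.map ψ x ∈ S}) =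
      X.coord i A '' X.source i A ∩ Bar.map ψ ⁻¹' (X.coord i G '' (X.source i G ∩ S)) := by
    intro i
    ext q
    constructor
    · rintro ⟨x, ⟨hx, hxS⟩, rfl⟩
      exact ⟨⟨x, hx, rfl⟩, _, ⟨X.source_map i ψ x hx, hxS⟩, X.coord_map i ψ x hx⟩
    · rintro ⟨⟨x, hx, rfl⟩, y, ⟨hy, hyS⟩, h⟩
      refine ⟨x, ⟨hx, ?_⟩, rfl⟩
      rw [← X.coord_map i ψ x hx] at h
      have := X.injOn i G hy (X.source_map i ψ x hx) h
      subst this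
      exact hyS
  refine ⟨fun i => ?_, fun i => ?_⟩
  · rw [himage]
    refine IsOpen.inter ?_ ((hh.1 i).preimage (Bar.continuous_map ψ))
    simpa using X.isOpen_overlap i i A
  · obtain ⟨g, hg, hgh⟩ := hh.2 i
    let P : Pt A (X.model i) →L[ℝ] Pt G (X.model i) := ⟨Bar.map ψ, Bar.continuous_map ψ⟩
    refine ⟨_, (SuperSmoothOn.baseChange ψ P (Bar.map_smul_even ψ) L hL (hh.1 i) hg).mono ?_, ?_⟩
    · rw [himage]
      exact Set.inter_subset_right
    · intro x hx
      change L (g (Bar.map ψ (X.coord i A x))) = _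
      rw [← X.coord_map i ψ x hx.1, hgh _ ⟨X.source_map i ψ x hx.1, hx.2⟩]

variable {V : SBanach.{v}}

/-- The coefficient is viewed in `Λ_0 ⊗ ℝ`, the normed form of `Λ_0`, which is finite-dimensional.
Thus the product is a bilinear pairing to which `superSmoothOn_bilinear` applies. -/
lemma SmoothOn.evenMul {c : X.pts.obj A → A.part 0} {h : X.pts.obj A → Pt A V}
    {S : Set (X.pts.obj A)} (hc : X.SmoothOn (fun x => GTensor.tmul 0 (c x) (1 : ℝ)) S)
    (hh : X.SmoothOn h S) : X.SmoothOn (fun x => Bar.evenMul (c x) (h x)) S := by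
  let L : GTensor A 0 ℝ →ₗ[ℝ] Pt A V →L[ℝ] Pt A V :=
    { toFun := fun a => ⟨Bar.evenMul (GTensor.toPart 0 a), Bar.continuous_evenMul _⟩
      map_add' := fun a b => ContinuousLinearMap.ext fun x => by
        change Bar.evenMul _ x = Bar.evenMul _ x + Bar.evenMul _ x
        rw [map_add, Bar.evenMul_add_left]
      map_smul' := fun r a => ContinuousLinearMap.ext fun x => by
        change Bar.evenMul _ x = r • Bar.evenMul _ x
        rw [map_smul, Bar.evenMul_smul_left] }
  have hL := superSmoothOn_bilinear (A := A) L
    (fun a x y => by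
      change Bar.evenMul _ y = a • Bar.evenMul _ y
      rw [GTensor.toPart_smul, Bar.evenMul_eq_smul, Bar.evenMul_eq_smul, smul_smul]
      rfl)
    (fun a x y => by
      change Bar.evenMul _ (a • y) = a • Bar.evenMul _ y
      rw [Bar.evenMul_eq_smul, Bar.evenMul_eq_smul, smul_smul, smul_smul]
      congr 1
      exact Subtype.ext (Gr.mul_even _ _ a.2)) Set.univ
  refine (congrArg (fun f => X.SmoothOn f S) ?_).mpr
    (SmoothOn.comp hL isOpen_univ (hc.prodMk hh) fun _ _ => trivial)
  funext x
  change _ = Bar.evenMul (GTensor.toPart 0 (GTensor.tmul 0 (c x) (1 : ℝ))) (h x)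
  rw [GTensor.toPart_tmul, one_smul]

lemma SmoothOn.oddMul {c : X.pts.obj A → A.part 1} {h : X.pts.obj A → Pt A V.flip}
    {S : Set (X.pts.obj A)} (hc : X.SmoothOn (fun x => GTensor.tmul 1 (c x) (1 : ℝ)) S)
    (hh : X.SmoothOn h S) :
    X.SmoothOn (fun x => (Bar.oddMul (c x) (h x) : Pt A V)) S := by
  let L : GTensor A 1 ℝ →ₗ[ℝ] Pt A V.flip →L[ℝ] Pt A V :=
    { toFun := fun a => ⟨Bar.oddMul (GTensor.toPart 1 a), Bar.continuous_oddMul _⟩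
      map_add' := fun a b => ContinuousLinearMap.ext fun x => by
        change Bar.oddMul _ x = Bar.oddMul _ x + Bar.oddMul _ x
        rw [map_add, Bar.oddMul_add_left]
      map_smul' := fun r a => ContinuousLinearMap.ext fun x => by
        change Bar.oddMul _ x = r • Bar.oddMul _ x
        rw [map_smul, Bar.oddMul_smul_left] }
  have hL := superSmoothOn_bilinear (A := A) L
    (fun a x y => by
      change Bar.oddMul _ y = a • Bar.oddMul _ y
      rw [GTensor.toPart_smul, Bar.oddMul_even_smul_left])
    (fun a x y => Bar.oddMul_even_smul a _ y) Set.univ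
  refine (congrArg (fun f => X.SmoothOn f S) ?_).mpr
    (SmoothOn.comp hL isOpen_univ (hc.prodMk hh) fun _ _ => trivial)
  funext x
  change _ = Bar.oddMul (GTensor.toPart 1 (GTensor.tmul 1 (c x) (1 : ℝ))) (h x)
  rw [GTensor.toPart_tmul, one_smul]

end SuperManifold

/-! ### The vector space of sections -/

/-- A bundle has only scalars in `Λ_0`, so real scalars act on its fibres through `algebraMap`. In a
trivialization this must agree with the real vector space structure of the points of `V`. -/
lemma Bar.algebraMap_smul {A : Gr} {V₀ V₁ : Type u} [AddCommGroup V₀] [Module ℝ V₀]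
    [AddCommGroup V₁] [Module ℝ V₁] (r : ℝ) (x : Bar A V₀ V₁) :
    algebraMap ℝ A.Even r • x = r • x := by
  have h : ∀ i, Gr.mulPart 0 i i (zero_add i) (⟨algebraMap ℝ A.Even r,
      (algebraMap ℝ A.Even r).2⟩ : A.part 0) = r • LinearMap.id := fun i =>
    LinearMap.ext fun x => Subtype.ext (Algebra.smul_def r (x : A.Alg)).symm
  ext1
  · rw [Prod.smul_fst, GTensor.smul_eq_lmap, h, GTensor.lmap_smul_left, GTensor.lmap_id,
      Prod.smul_fst]
  · rw [Prod.smul_snd, GTensor.smul_eq_lmap, h, GTensor.lmap_smul_left, GTensor.lmap_id,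
      Prod.smul_snd]

namespace SuperVectorBundle

open SuperManifold

variable {M : SuperManifold.{u}} {V : SBanach.{u}} (E : SuperVectorBundle M V) {A B : Gr}

variable {E} in
lemma eq_of_fib {a b : E.tot.obj A} (i : E.ι) (h : E.proj.app A a = E.proj.app A b)
    (hi : E.proj.app A a ∈ E.base i A) (hf : E.fib i A a = E.fib i A b) : a = b :=
  (E.fib_bij i A _ hi).injOn rfl h.symm hf

lemma exists_fib (i : E.ι) {x : M.pts.obj A} (hx : x ∈ E.base i A) (v : Pt A V) :
    ∃ a, E.proj.app A a = x ∧ E.fib i A a = v :=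
  (E.fib_bij i A x hx).surjOn (Set.mem_univ v)

/-- The zero of a fibre is found in one trivialization. There it is seen to be fixed by the scalar
`0`, and this property does not refer to a trivialization, so its coordinate vanishes in all of
them. -/
lemma exists_zero (x : M.pts.obj A) : ∃ a, E.proj.app A a = x ∧
    ∀ i, x ∈ E.base i A → E.fib i A a = 0 := by
  obtain ⟨j, hj⟩ := E.cover A x
  obtain ⟨a, rfl, ha⟩ := E.exists_fib j hj 0
  have h : E.smul A 0 a = a := eq_of_fib j (E.proj_smul A 0 a) (by rwa [E.proj_smul])
    (by rw [E.fib_smul _ _ _ _ hj, ha, smul_zero])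
  exact ⟨a, rfl, fun i hi => by rw [← h, E.fib_smul _ _ _ _ hi, zero_smul]⟩

/-- The zero section. -/
def zero (A : Gr) (x : M.pts.obj A) : E.tot.obj A := (E.exists_zero x).choose

lemma proj_zero (x : M.pts.obj A) : E.proj.app A (E.zero A x) = x := (E.exists_zero x).choose_spec.1

lemma fib_zero {i : E.ι} {x : M.pts.obj A} (hx : x ∈ E.base i A) : E.fib i A (E.zero A x) = 0 :=
  (E.exists_zero x).choose_spec.2 i hx

/-! ### Sections through their fibre coordinates, and the vector space they form. -/

namespace Section

variable {E}

/-- The value of a section at a point. -/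
def eval (s : E.Section) (A : Gr) (x : M.pts.obj A) : E.tot.obj A := s.1.toFun A x

@[simp] lemma proj_eval (s : E.Section) (x : M.pts.obj A) : E.proj.app A (s.eval A x) = x := s.2 A x

lemma eval_map (s : E.Section) (φ : A ⟶ B) (x : M.pts.obj A) :
    s.eval B (M.pts.map φ x) = E.tot.map φ (s.eval A x) := s.1.naturality φ x

lemma proj_eval_mem (s : E.Section) {i : E.ι} {x : M.pts.obj A} (hx : x ∈ E.base i A) :
    E.proj.app A (s.eval A x) ∈ E.base i A := by rwa [proj_eval]

lemma fib_eval_map (s : E.Section) (φ : A ⟶ B) {i : E.ι} {x : M.pts.obj A}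
    (hx : x ∈ E.base i A) :
    E.fib i B (s.eval B (M.pts.map φ x)) = Bar.map φ (E.fib i A (s.eval A x)) := by
  rw [eval_map, E.fib_map _ _ _ (s.proj_eval_mem hx)]

lemma ext_eval {s t : E.Section} (h : ∀ A x, s.eval A x = t.eval A x) : s = t :=
  Subtype.ext (Hom.ext (funext fun A => funext fun x => h A x))

/-- The trivializations cover and are injective on fibres. All algebraic laws for sections are
reduced in this way to laws in the points of `V`. -/
lemma ext_fib {s t : E.Section}
    (h : ∀ A i x, x ∈ E.base i A → E.fib i A (s.eval A x) = E.fib i A (t.eval A x)) : s = t :=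
  ext_eval fun A x => by
    obtain ⟨i, hi⟩ := E.cover A x
    exact eq_of_fib i (by simp) (s.proj_eval_mem hi) (h A i x hi)

lemma smoothOn_fib_eval (s : E.Section) (i : E.ι) (A : Gr) :
    M.SmoothOn (fun x => E.fib i A (s.eval A x)) (E.base i A) := by
  have h := s.1.smooth.smoothOn (E.smoothOn_fib i A)
  have e : s.1.toFun A ⁻¹' {a | E.proj.app A a ∈ E.base i A} = E.base i A := by
    ext x
    change E.proj.app A (s.1.toFun A x) ∈ E.base i A ↔ _
    rw [s.2 A x]
  rw [e] at h
  exact h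

/-- A section is given by its values, if their fibre coordinates are natural and supersmooth. -/
def mk (f : ∀ A, M.pts.obj A → E.tot.obj A) (hp : ∀ A x, E.proj.app A (f A x) = x)
    (hn : ∀ {A B : Gr} (φ : A ⟶ B) (i : E.ι) (x : M.pts.obj A), x ∈ E.base i A →
      E.fib i B (f B (M.pts.map φ x)) = Bar.map φ (E.fib i A (f A x)))
    (hs : ∀ i A, M.SmoothOn (fun x => E.fib i A (f A x)) (E.base i A)) : E.Section :=
  ⟨{ toFun := f
     naturality := fun {A B} φ x => by
       obtain ⟨i, hi⟩ := E.cover A x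
       refine eq_of_fib i (((hp _ _).trans (congrArg (M.pts.map φ) (hp A x).symm)).trans
         (E.proj_map φ _).symm)
         (by rw [hp]; exact E.base_map i φ x hi) ?_
       refine (hn φ i x hi).trans (E.fib_map _ _ _ ?_).symm
       rwa [hp]
     smooth := E.isSuperSmooth_total
       (by
         have h : (fun A x => E.proj.app A (f A x)) = fun A (x : M.pts.obj A) => x :=
           funext fun A => funext fun x => hp A x
         rw [h]
         exact isSuperSmooth_id M)
       (fun i A => by
         have e : {x | E.proj.app A (f A x) ∈ E.base i A} = E.base i A := by
           ext x
           change E.proj.app A (f A x) ∈ E.base i A ↔ _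
           rw [hp]
         rw [e]
         exact hs i A) }, hp⟩

instance : Zero E.Section where
  zero := mk E.zero (fun _ x => E.proj_zero x)
    (fun φ i x hx => by
      rw [E.fib_zero hx, E.fib_zero (E.base_map i φ x hx), map_zero])
    (fun i A => by
      have h := (smoothOn_const (X := M) (A := A) (0 : Pt A V)).mono (E.base_open i A)
        (Set.subset_univ _)
      refine ⟨h.1, fun j => ?_⟩
      obtain ⟨g, hg, he⟩ := h.2 j
      exact ⟨g, hg, fun x hx => (he x hx).trans (E.fib_zero hx.2).symm⟩)

/-- Fibre coordinates are meaningful only over the trivializing set, so identities between them hold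
on `S` and not everywhere. -/
lemma smoothOn_congr {Y : Type*} [NormedAddCommGroup Y] [NormedSpace ℝ Y] [Module A.Even Y]
    {f g : M.pts.obj A → Y} {S : Set (M.pts.obj A)} (hf : M.SmoothOn f S)
    (h : ∀ x ∈ S, f x = g x) : M.SmoothOn g S := by
  refine ⟨hf.1, fun j => ?_⟩
  obtain ⟨k, hk, he⟩ := hf.2 j
  exact ⟨k, hk, fun x hx => (he x hx).trans (h x hx.2)⟩

instance : Add E.Section where
  add s t := mk (fun A x => E.add A (s.eval A x) (t.eval A x) (by simp))
    (fun A x => by rw [E.proj_add, proj_eval])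
    (fun φ i x hx => by
      rw [E.fib_add _ _ _ _ _ (s.proj_eval_mem hx),
        E.fib_add _ _ _ _ _ (s.proj_eval_mem (E.base_map i φ x hx)), s.fib_eval_map φ hx,
        t.fib_eval_map φ hx, map_add])
    (fun i A => smoothOn_congr ((s.smoothOn_fib_eval i A).add (t.smoothOn_fib_eval i A))
      fun x hx => (E.fib_add _ _ _ _ _ (s.proj_eval_mem hx)).symm)

/-- The product of a section with an even function. -/
def mulFun (c : ∀ A, M.pts.obj A → A.part 0)
    (hn : ∀ {A B : Gr} (φ : A ⟶ B) x, c B (M.pts.map φ x) = Gr.Hom.res φ 0 (c A x))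
    (hs : ∀ A, M.SmoothOn (fun x => GTensor.tmul 0 (c A x) (1 : ℝ)) Set.univ)
    (s : E.Section) : E.Section :=
  mk (fun A x => E.smul A (Gr.toEven (c A x)) (s.eval A x))
    (fun A x => by rw [E.proj_smul, proj_eval])
    (fun φ i x hx => by
      rw [E.fib_smul _ _ _ _ (s.proj_eval_mem hx),
        E.fib_smul _ _ _ _ (s.proj_eval_mem (E.base_map i φ x hx)), s.fib_eval_map φ hx, hn,
        Bar.map_smul_even]
      rfl)
    (fun i A => smoothOn_congr (((hs A).mono (E.base_open i A) (Set.subset_univ _)).evenMul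
      (s.smoothOn_fib_eval i A)) fun x hx => by
        rw [E.fib_smul _ _ _ _ (s.proj_eval_mem hx), Bar.evenMul_eq_smul])

/-- A real number acts as a constant even function, since the fibres carry scalars in `Λ_0` only. -/
instance : SMul ℝ E.Section where
  smul r s := s.mulFun (fun A _ => ⟨algebraMap ℝ A.Even r, (algebraMap ℝ A.Even r).2⟩)
    (fun φ _ => Subtype.ext ((Gr.Hom.alg φ).commutes r).symm)
    (fun _ => smoothOn_const _)

lemma fib_eval_add (s t : E.Section) {i : E.ι} {x : M.pts.obj A} (hx : x ∈ E.base i A) :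
    E.fib i A ((s + t).eval A x) = E.fib i A (s.eval A x) + E.fib i A (t.eval A x) :=
  E.fib_add _ _ _ _ _ (s.proj_eval_mem hx)

lemma fib_eval_zero {i : E.ι} {x : M.pts.obj A} (hx : x ∈ E.base i A) :
    E.fib i A ((0 : E.Section).eval A x) = 0 := E.fib_zero hx

lemma fib_eval_smul' (r : ℝ) (s : E.Section) {i : E.ι} {x : M.pts.obj A} (hx : x ∈ E.base i A) :
    E.fib i A ((r • s).eval A x) = algebraMap ℝ A.Even r • E.fib i A (s.eval A x) :=
  E.fib_smul _ _ _ _ (s.proj_eval_mem hx)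

lemma fib_eval_smul (r : ℝ) (s : E.Section) {i : E.ι} {x : M.pts.obj A} (hx : x ∈ E.base i A) :
    E.fib i A ((r • s).eval A x) = r • E.fib i A (s.eval A x) :=
  (fib_eval_smul' r s hx).trans (Bar.algebraMap_smul _ _)

/-- The data of a bundle contain no negation in the fibres, so it comes from the scalar `-1`. -/
instance : Neg E.Section := ⟨fun s => (-1 : ℝ) • s⟩

lemma fib_eval_neg (s : E.Section) {i : E.ι} {x : M.pts.obj A} (hx : x ∈ E.base i A) :
    E.fib i A ((-s).eval A x) = - E.fib i A (s.eval A x) :=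
  (fib_eval_smul (-1) s hx).trans (by rw [neg_smul, one_smul])

instance : AddCommGroup E.Section where
  add_assoc r s t := ext_fib fun A i x hx => by simp only [fib_eval_add _ _ hx, add_assoc]
  zero_add s := ext_fib fun _ i x hx => by rw [fib_eval_add _ _ hx, fib_eval_zero hx, zero_add]
  add_zero s := ext_fib fun A i x hx => by rw [fib_eval_add _ _ hx, fib_eval_zero hx, add_zero]
  add_comm s t := ext_fib fun A i x hx => by simp only [fib_eval_add _ _ hx, add_comm]
  neg_add_cancel s := ext_fib fun A i x hx => by
    rw [fib_eval_add _ _ hx, fib_eval_neg _ hx, fib_eval_zero hx, neg_add_cancel]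
  nsmul := nsmulRec
  zsmul := zsmulRec

instance : Module ℝ E.Section where
  one_smul s := ext_fib fun A i x hx => by rw [fib_eval_smul _ _ hx, one_smul]
  mul_smul a b s := ext_fib fun A i x hx => by simp only [fib_eval_smul _ _ hx, mul_smul]
  smul_zero a := ext_fib fun A i x hx => by
    rw [fib_eval_smul _ _ hx, fib_eval_zero hx, smul_zero]
  zero_smul s := ext_fib fun A i x hx => by
    rw [fib_eval_smul _ _ hx, fib_eval_zero hx, zero_smul]
  smul_add a s t := ext_fib fun A i x hx => by
    simp only [fib_eval_smul _ _ hx, fib_eval_add _ _ hx, smul_add]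
  add_smul a b s := ext_fib fun A i x hx => by
    simp only [fib_eval_smul _ _ hx, fib_eval_add _ _ hx, add_smul]

lemma fib_eval_sum {ι : Type*} (S : Finset ι) (s : ι → E.Section) {i : E.ι} {x : M.pts.obj A}
    (hx : x ∈ E.base i A) :
    E.fib i A ((∑ n ∈ S, s n).eval A x) = ∑ n ∈ S, E.fib i A ((s n).eval A x) := by
  classical
  induction S using Finset.induction_on with
  | empty => simpa using fib_eval_zero hx
  | insert n S hn ih => rw [Finset.sum_insert hn, Finset.sum_insert hn, fib_eval_add _ _ hx, ih]

end Section

lemma isPointwiseSpace : E.IsPointwiseSpace := fun _ _ _ _ _ => ⟨rfl, rfl⟩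

/-! ### The module of families of sections -/

section Family

variable {E} {K L : Gr}

/-- The coefficient `p(a)` is a polynomial in the images of the odd generators, which are the
coordinates of the superpoint. It is pulled back along the projection to the superpoint. -/
lemma smoothOn_family_eval (M : SuperManifold.{u}) (i : ZMod 2) (a : K.part i) :
    ((superpoint K).prod M).SmoothOn (A := A)
      (fun x => GTensor.tmul i (Gr.Hom.res (A := K) x.1 i a) (1 : ℝ)) Set.univ :=
  (isSuperSmooth_fst (X := superpoint K) (Y := M)).smoothOn (smoothOn_superpoint_eval K i a)

/-- The element `a` acts as the even function `(p, m) ↦ p(a)`, natural because the map on points of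
the superpoint is composition. -/
instance familySMul : SMul K.Even (E.family K).Section where
  smul a σ := σ.mulFun (fun _ x => Gr.Hom.res (A := K) x.1 0 ⟨a, a.2⟩) (fun _ _ => rfl)
    (fun _ => smoothOn_family_eval M 0 _)

lemma val_family_smul (a : K.Even) (σ : (E.family K).Section) (p : K ⟶ A) (m : M.pts.obj A) :
    val (a • σ) A p m = E.smul A (Gr.Hom.resEven p a) (val σ A p m) := rfl

lemma val_family_add (σ τ : (E.family K).Section) (p : K ⟶ A) (m : M.pts.obj A) :
    val (σ + τ) A p m = E.add A (val σ A p m) (val τ A p m)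
      ((proj_val _ _ _ _).trans (proj_val _ _ _ _).symm) := rfl

lemma family_ext_fib {σ τ : (E.family K).Section} (h : ∀ A i (p : K ⟶ A) m, m ∈ E.base i A →
    E.fib i A (val σ A p m) = E.fib i A (val τ A p m)) : σ = τ :=
  Section.ext_fib fun A i x hx => h A i x.1 x.2 hx

lemma proj_val_mem (σ : (E.family K).Section) (p : K ⟶ A) {m : M.pts.obj A} {i : E.ι}
    (hm : m ∈ E.base i A) : E.proj.app A (val σ A p m) ∈ E.base i A := by rwa [proj_val]

lemma fib_val_smul (a : K.Even) (σ : (E.family K).Section) (p : K ⟶ A) {m : M.pts.obj A} {i : E.ι}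
    (hm : m ∈ E.base i A) :
    E.fib i A (val (a • σ) A p m) = Gr.Hom.resEven p a • E.fib i A (val σ A p m) := by
  rw [val_family_smul, E.fib_smul _ _ _ _ (proj_val_mem σ p hm)]

lemma fib_val_add (σ τ : (E.family K).Section) (p : K ⟶ A) {m : M.pts.obj A} {i : E.ι}
    (hm : m ∈ E.base i A) :
    E.fib i A (val (σ + τ) A p m) = E.fib i A (val σ A p m) + E.fib i A (val τ A p m) := by
  rw [val_family_add, E.fib_add _ _ _ _ _ (proj_val_mem σ p hm)]

lemma fib_val_zero (p : K ⟶ A) {m : M.pts.obj A} {i : E.ι} (hm : m ∈ E.base i A) :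
    E.fib i A (val (0 : (E.family K).Section) A p m) = 0 :=
  Section.fib_eval_zero (E := E.family K) (x := (p, m)) hm

lemma resEven_one (p : K ⟶ A) : Gr.Hom.resEven p 1 = 1 := Subtype.ext (map_one (Gr.Hom.alg p))

lemma resEven_zero (p : K ⟶ A) : Gr.Hom.resEven p 0 = 0 := Subtype.ext (map_zero (Gr.Hom.alg p))

lemma resEven_mul (p : K ⟶ A) (a b : K.Even) :
    Gr.Hom.resEven p (a * b) = Gr.Hom.resEven p a * Gr.Hom.resEven p b :=
  Subtype.ext (map_mul (Gr.Hom.alg p) _ _)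

lemma resEven_add (p : K ⟶ A) (a b : K.Even) :
    Gr.Hom.resEven p (a + b) = Gr.Hom.resEven p a + Gr.Hom.resEven p b :=
  Subtype.ext (map_add (Gr.Hom.alg p) _ _)

instance familyModule : Module K.Even (E.family K).Section where
  one_smul s := family_ext_fib fun A i p m hm => by
    rw [fib_val_smul _ _ _ hm, resEven_one, one_smul]
  mul_smul a b s := family_ext_fib fun A i p m hm => by
    simp only [fib_val_smul _ _ _ hm, resEven_mul, mul_smul]
  smul_zero a := family_ext_fib fun A i p m hm => by
    rw [fib_val_smul _ _ _ hm, fib_val_zero _ hm, smul_zero]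
  zero_smul s := family_ext_fib fun A i p m hm => by
    rw [fib_val_smul _ _ _ hm, fib_val_zero _ hm, resEven_zero, zero_smul]
  smul_add a s t := family_ext_fib fun A i p m hm => by
    simp only [fib_val_smul _ _ _ hm, fib_val_add _ _ _ hm, smul_add]
  add_smul a b s := family_ext_fib fun A i p m hm => by
    simp only [fib_val_smul _ _ _ hm, fib_val_add _ _ _ hm, resEven_add, add_smul]

variable (E) in
lemma sectionMap_add (φ : K ⟶ L) (σ τ : (E.family K).Section) :
    E.sectionMap φ (σ + τ) = E.sectionMap φ σ + E.sectionMap φ τ :=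
  section_ext fun _ _ _ => rfl

variable (E) in
lemma sectionMap_smul (φ : K ⟶ L) (a : K.Even) (σ : (E.family K).Section) :
    E.sectionMap φ (a • σ) = Gr.Hom.resEven φ a • E.sectionMap φ σ :=
  section_ext fun _ _ _ => rfl

variable (E) in
/-- The pointwise module structure on the functor of sections. -/
def gammaHatModule : RbarModule E.gammaHat where
  addCommGroup K := inferInstanceAs (AddCommGroup (E.family K).Section)
  module K := familyModule (E := E) (K := K)
  map_add φ σ τ := E.sectionMap_add φ σ τ
  map_smul φ a σ := E.sectionMap_smul φ a σ

lemma isPointwise_gammaHatModule : E.IsPointwise E.gammaHatModule :=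
  fun _ _ _ _ _ _ _ => ⟨rfl, rfl⟩

end Family

end SuperVectorBundle

/-! ### The Grassmann algebra with one generator -/

namespace Gr

/-- The Grassmann algebra with one generator. -/
def line : Gr := ⟨1⟩

/-- The index of the generator. -/
def lineIdx : Fin line.rank := (0 : Fin 1)

lemma eq_lineIdx (i : Fin line.rank) : i = lineIdx := Subsingleton.elim (α := Fin 1) _ _

/-- The generator of the Grassmann algebra with one generator. -/
def eta : line.part 1 := line.gen lineIdx

/-- The functional on the odd part of `Λ_1` that takes the value `1` at the generator. -/
def etaDual : line.part 1 →ₗ[ℝ] ℝ :=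
  ((LinearMap.proj (0 : Fin 1)).comp (ExteriorAlgebra.ιInv (R := ℝ) (M := Fin 1 → ℝ))).comp
    (line.part 1).subtype

lemma etaDual_eta : etaDual eta = 1 := by
  change (ExteriorAlgebra.ιInv (R := ℝ) (M := Fin 1 → ℝ))
    (ExteriorAlgebra.ι ℝ (Pi.single (0 : Fin 1) 1)) 0 = 1
  rw [ExteriorAlgebra.ι_leftInverse (R := ℝ) (M := Fin 1 → ℝ), Pi.single_eq_same]

lemma line_ι (v : Fin line.rank → ℝ) :
    (ExteriorAlgebra.ι ℝ v : line.Alg) = v lineIdx • (eta : line.Alg) := by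
  have h : v = v lineIdx • (Pi.single lineIdx 1 : Fin line.rank → ℝ) := by
    ext i
    rw [eq_lineIdx i]
    simp
  conv_lhs => rw [h, map_smul]
  rfl

lemma line_ι_mul_ι (v w : Fin line.rank → ℝ) :
    (ExteriorAlgebra.ι ℝ v * ExteriorAlgebra.ι ℝ w : line.Alg) = 0 := by
  rw [line_ι v, line_ι w, smul_mul_assoc, mul_smul_comm, odd_mul_self _ eta.2, smul_zero, smul_zero]

/-- With a single generator any product of two vectors vanishes, so only the scalars remain in the
even part. -/
lemma exists_smul_one (k : line.part 0) :
    ∃ r : ℝ, k = r • (⟨1, SetLike.GradedOne.one_mem (A := line.part)⟩ : line.part 0) := by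
  obtain ⟨x, hx⟩ := k
  induction x, hx using CliffordAlgebra.even_induction with
  | algebraMap r => exact ⟨r, Subtype.ext (Algebra.algebraMap_eq_smul_one r)⟩
  | add x y _ _ hx hy =>
    obtain ⟨r, hr⟩ := hx
    obtain ⟨s, hs⟩ := hy
    exact ⟨r + s, (congrArg₂ (· + ·) hr hs).trans (add_smul _ _ _).symm⟩
  | ι_mul_ι_mul v w z _ _ =>
    refine ⟨0, Subtype.ext ?_⟩
    have h : CliffordAlgebra.ι (0 : QuadraticForm ℝ (Fin line.rank → ℝ)) v *
        CliffordAlgebra.ι _ w = 0 := line_ι_mul_ι v w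
    change CliffordAlgebra.ι _ v * CliffordAlgebra.ι _ w * z = (0 : ℝ) • (1 : line.Alg)
    rw [h, zero_mul, zero_smul]

/-- For the same reason nothing of higher degree survives in the odd part, and only multiples of the
generator remain. -/
lemma exists_smul_eta (k : line.part 1) : ∃ r : ℝ, k = r • eta := by
  obtain ⟨x, hx⟩ := k
  induction x, hx using CliffordAlgebra.odd_induction with
  | ι v => exact ⟨v lineIdx, Subtype.ext (line_ι v)⟩
  | add x y _ _ hx hy =>
    obtain ⟨r, hr⟩ := hx
    obtain ⟨s, hs⟩ := hy
    exact ⟨r + s, (congrArg₂ (· + ·) hr hs).trans (add_smul _ _ _).symm⟩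
  | ι_mul_ι_mul v w z _ _ =>
    refine ⟨0, Subtype.ext ?_⟩
    have h : CliffordAlgebra.ι (0 : QuadraticForm ℝ (Fin line.rank → ℝ)) v *
        CliffordAlgebra.ι _ w = 0 := line_ι_mul_ι v w
    change CliffordAlgebra.ι _ v * CliffordAlgebra.ι _ w * z = (0 : ℝ) • (eta : line.Alg)
    rw [h, zero_mul, zero_smul]

variable {A B : Gr}

/-- The morphism `Λ_1 → Λ` with given value at the generator. -/
def ofOdd (c : A.part 1) : line ⟶ A := homOfGen fun _ => c

lemma ofOdd_eta (c : A.part 1) : Hom.res (ofOdd c) 1 eta = c := homOfGen_gen _ _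

lemma line_hom_ext {f g : line ⟶ A} (h : Hom.res f 1 eta = Hom.res g 1 eta) : f = g :=
  hom_ext fun i => by
    rw [eq_lineIdx i]
    exact h

lemma ofOdd_comp (c : A.part 1) (φ : A ⟶ B) : ofOdd c ≫ φ = ofOdd (Hom.res φ 1 c) :=
  line_hom_ext (by rw [ofOdd_eta, Hom.res_comp, LinearMap.comp_apply, ofOdd_eta])

/-- The morphism `Λ_1 ⊗ Λ → Λ` that is the identity on `Λ` and has a given value at the
generator. -/
def evalLine (c : A.part 1) : line.tens A ⟶ A := desc (ofOdd c) (𝟙 A)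

lemma inr_evalLine (c : A.part 1) : inr line A ≫ evalLine c = 𝟙 A := inr_desc _ _

/-- Substitution of a value for the generator is natural. For `c = 0` this shows that the condition
defining `FlipPt` is preserved by morphisms of Grassmann algebras. -/
lemma whisker_evalLine (φ : A ⟶ B) (c : A.part 1) :
    whisker line φ ≫ evalLine (Hom.res φ 1 c) = evalLine c ≫ φ := by
  rw [evalLine, evalLine, whisker_desc, desc_comp, ofOdd_comp, Category.id_comp, Category.comp_id]

end Gr

namespace Bar

variable {A : Gr} {V₀ V₁ : Type u} [AddCommGroup V₀] [Module ℝ V₀] [AddCommGroup V₁] [Module ℝ V₁]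

/-- Substituting `c` for `η` in `η w` gives `c w`. In this way the multiplication by `c` from `ΠE`
to `E` is expressed by the functor `E` alone. -/
lemma map_evalLine (c : A.part 1) (w : Bar A V₁ V₀) :
    map (Gr.evalLine c) (tensOddMul Gr.eta w : Bar (Gr.line.tens A) V₀ V₁) = oddMul c w := by
  rw [Gr.evalLine, map_desc_tensOddMul, Gr.ofOdd_eta, map_id]

lemma tensEvenMul_one (K : Gr) (w : Bar A V₀ V₁) :
    tensEvenMul (⟨1, SetLike.GradedOne.one_mem (A := K.part)⟩ : K.part 0) w = map (K.inr A) w := by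
  rw [tensEvenMul, LinearMap.comp_apply, evenMul_eq_smul]
  have h : Gr.toEven (Gr.Hom.res (K.inl A) 0 ⟨1, SetLike.GradedOne.one_mem (A := K.part)⟩) = 1 :=
    Subtype.ext (map_one (Gr.Hom.alg (K.inl A)))
  rw [h, one_smul]

lemma tensEvenMul_smul_left {K : Gr} (r : ℝ) (k : K.part 0) (w : Bar A V₀ V₁) :
    tensEvenMul (r • k) w = r • tensEvenMul k w := by
  rw [tensEvenMul, LinearMap.comp_apply, map_smul, evenMul_smul_left]
  rfl

lemma tensOddMul_smul_left {K : Gr} (r : ℝ) (k : K.part 1) (w : Bar A V₁ V₀) :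
    tensOddMul (r • k) w = r • tensOddMul k w := by
  rw [tensOddMul, LinearMap.comp_apply, map_smul, oddMul_smul_left]
  rfl

/-- A point over `Λ_1 ⊗ Λ` that vanishes for the value `0` of the generator is a multiple of the
generator. -/
lemma eq_tensOddMul_eta (x : Bar (Gr.line.tens A) V₀ V₁) (hx : map (Gr.evalLine 0) x = 0) :
    x = tensOddMul Gr.eta (contractOdd Gr.etaDual x) := by
  obtain ⟨w, w', rfl⟩ : ∃ (w : Bar A V₀ V₁) (w' : Bar A V₁ V₀),
      x = map (Gr.line.inr A) w + tensOddMul Gr.eta w' := by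
    let b₀ := Module.finBasis ℝ (Gr.line.part 0)
    let b₁ := Module.finBasis ℝ (Gr.line.part 1)
    -- The bases are arbitrary, so every basis vector is rewritten as a multiple of `1` or of `η`,
    -- and the expansion collapses to two terms.
    choose r hr using fun n => Gr.exists_smul_one (b₀ n)
    choose s hs using fun n => Gr.exists_smul_eta (b₁ n)
    refine ⟨∑ n, r n • contractEven (b₀.coord n) x, ∑ n, s n • contractOdd (b₁.coord n) x, ?_⟩
    conv_lhs => rw [← sum_tensMul_contract b₀ b₁ x]
    rw [map_sum, map_sum]
    congr 1
    · refine Finset.sum_congr rfl fun n _ => ?_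
      rw [hr n, tensEvenMul_smul_left, tensEvenMul_one, map_smul]
    · refine Finset.sum_congr rfl fun n _ => ?_
      rw [hs n, tensOddMul_smul_left, map_smul]
  -- Setting `η = 0` kills `η w'` and returns `w`, so `w = 0`. Contraction with the dual of `η` then
  -- recovers `w'`.
  rw [map_add, map_evalLine, oddMul_zero_left, add_zero, ← map_comp, Gr.inr_evalLine, map_id] at hx
  rw [hx, map_zero, zero_add, contractOdd_tensOddMul, Gr.etaDual_eta, one_smul]

lemma tensOddMul_even_smul {K : Gr} (k : K.part 1) (a : A.Even) (w : Bar A V₁ V₀) :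
    tensOddMul k (a • w) = Gr.Hom.resEven (K.inr A) a • tensOddMul k w := by
  rw [tensOddMul, LinearMap.comp_apply, map_smul_even, oddMul_even_smul]
  rfl

end Bar

/-! ### The bundle with reversed parity -/

namespace SuperVectorBundle

open SuperManifold

variable {M : SuperManifold.{u}} {V : SBanach.{u}} (E : SuperVectorBundle M V) {A B : Gr}

lemma map_zero (φ : A ⟶ B) (x : M.pts.obj A) :
    E.tot.map φ (E.zero A x) = E.zero B (M.pts.map φ x) :=
  ((0 : E.Section).eval_map φ x).symm

lemma tot_map_comp {C : Gr} (φ : A ⟶ B) (ψ : B ⟶ C) (a : E.tot.obj A) :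
    E.tot.map (φ ≫ ψ) a = E.tot.map ψ (E.tot.map φ a) := by
  rw [E.tot.map_comp]; rfl

lemma tot_map_id (a : E.tot.obj A) : E.tot.map (𝟙 A) a = a := by
  rw [E.tot.map_id]; rfl

lemma pts_map_comp {C : Gr} (φ : A ⟶ B) (ψ : B ⟶ C) (x : M.pts.obj A) :
    M.pts.map (φ ≫ ψ) x = M.pts.map ψ (M.pts.map φ x) := by
  rw [M.pts.map_comp]; rfl

lemma pts_map_id (x : M.pts.obj A) : M.pts.map (𝟙 A) x = x := by
  rw [M.pts.map_id]; rfl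

/-- The points of the bundle with reversed parity over `m`: the points of the bundle over `Λ_1 ⊗ Λ`
and over `m` that vanish if the generator of `Λ_1` is given the value `0`. -/
def FlipPt (A : Gr) : Type u :=
  {p : M.pts.obj A × E.tot.obj (Gr.line.tens A) //
    E.proj.app _ p.2 = M.pts.map (Gr.inr Gr.line A) p.1 ∧
      E.tot.map (Gr.evalLine 0) p.2 = E.zero A p.1}

variable {E}

/-! ### Points with reversed parity: coordinates, operations and odd multiplication. -/

namespace FlipPt

/-- The base point. -/
def pt (b : E.FlipPt A) : M.pts.obj A := b.1.1

/-- The underlying point of the bundle. -/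
def lift (b : E.FlipPt A) : E.tot.obj (Gr.line.tens A) := b.1.2

lemma proj_lift (b : E.FlipPt A) : E.proj.app _ b.lift = M.pts.map (Gr.inr Gr.line A) b.pt := b.2.1

lemma proj_lift_mem (b : E.FlipPt A) {i : E.ι} (hi : b.pt ∈ E.base i A) :
    E.proj.app _ b.lift ∈ E.base i (Gr.line.tens A) := by
  rw [proj_lift]; exact E.base_map i _ _ hi

/-- The fibre coordinate. -/
def coord (b : E.FlipPt A) (i : E.ι) : Pt A V.flip :=
  Bar.contractOdd Gr.etaDual (E.fib i _ b.lift)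

/-- The point vanishes for `η = 0`, hence so does its fibre coordinate, which must then be a
multiple of `η`. The map that divides by `η` is the contraction defining `coord`. -/
lemma fib_lift (b : E.FlipPt A) {i : E.ι} (hi : b.pt ∈ E.base i A) :
    E.fib i _ b.lift = Bar.tensOddMul Gr.eta (b.coord i) :=
  Bar.eq_tensOddMul_eta _ (by
    rw [← E.fib_map _ _ _ (b.proj_lift_mem hi), lift, b.2.2]
    exact E.fib_zero hi)

lemma ext_lift {b b' : E.FlipPt A} (h : b.pt = b'.pt) (h' : b.lift = b'.lift) : b = b' :=
  Subtype.ext (Prod.ext h h')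

lemma ext_coord {b b' : E.FlipPt A} (i : E.ι) (h : b.pt = b'.pt) (hi : b.pt ∈ E.base i A)
    (hc : b.coord i = b'.coord i) : b = b' :=
  ext_lift h (eq_of_fib i (by rw [proj_lift, proj_lift, h]) (b.proj_lift_mem hi)
    (by rw [b.fib_lift hi, b'.fib_lift (h ▸ hi), hc]))

lemma exists_coord (i : E.ι) {x : M.pts.obj A} (hx : x ∈ E.base i A) (w : Pt A V.flip) :
    ∃ b : E.FlipPt A, b.pt = x ∧ b.coord i = w := by
  -- The point with coordinate `w` is the one whose lift has coordinate `η w`, which indeed vanishes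
  -- for `η = 0`.
  obtain ⟨a, ha, hw⟩ := E.exists_fib i (E.base_map i (Gr.inr Gr.line A) x hx)
    (Bar.tensOddMul Gr.eta w)
  have hp : E.proj.app A (E.tot.map (Gr.evalLine 0) a) = x := by
    rw [E.proj_map, ha, ← pts_map_comp, Gr.inr_evalLine, pts_map_id]
  refine ⟨⟨(x, a), ha, eq_of_fib i (by rw [hp, E.proj_zero]) (by rwa [hp]) ?_⟩, rfl, ?_⟩
  · rw [E.fib_zero hx, E.fib_map _ _ _ (by rw [ha]; exact E.base_map i _ x hx), hw,
      Bar.map_evalLine, Bar.oddMul_zero_left]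
  · change Bar.contractOdd Gr.etaDual (E.fib i _ a) = w
    rw [hw, Bar.contractOdd_tensOddMul, Gr.etaDual_eta, one_smul]

/-- The image of a point under a morphism of Grassmann algebras. -/
def map (φ : A ⟶ B) (b : E.FlipPt A) : E.FlipPt B :=
  ⟨(M.pts.map φ b.pt, E.tot.map (Gr.whisker Gr.line φ) b.lift), by
    rw [E.proj_map, proj_lift, ← pts_map_comp, ← pts_map_comp, Gr.inr_whisker], by
    rw [← E.map_zero]
    have h := b.2.2
    change E.tot.map (Gr.evalLine 0) b.lift = E.zero A b.pt at h
    -- A morphism sends the odd element `0` to `0`, so setting `η = 0` commutes with `φ`.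
    have e := Gr.whisker_evalLine φ 0
    rw [_root_.map_zero] at e
    rw [← h, ← tot_map_comp, ← tot_map_comp, e]⟩

lemma coord_map (φ : A ⟶ B) (b : E.FlipPt A) {i : E.ι} (hi : b.pt ∈ E.base i A) :
    (b.map φ).coord i = Bar.map φ (b.coord i) :=
  (congrArg (Bar.contractOdd Gr.etaDual) (E.fib_map i _ _ (b.proj_lift_mem hi))).trans
    (Bar.contractOdd_map _ _ _)

/-- The sum of two points of the same fibre. -/
def add (b b' : E.FlipPt A) (h : b.pt = b'.pt) : E.FlipPt A :=
  ⟨(b.pt, E.add _ b.lift b'.lift (by rw [proj_lift, proj_lift, h])), by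
    exact (E.proj_add _ _ _ _).trans b.proj_lift, by
    obtain ⟨i, hi⟩ := E.cover A b.pt
    have hp : E.proj.app A (E.tot.map (Gr.evalLine 0) (E.add _ b.lift b'.lift
        (by rw [proj_lift, proj_lift, h]))) = b.pt := by
      rw [E.proj_map, E.proj_add, proj_lift, ← pts_map_comp, Gr.inr_evalLine, pts_map_id]
    refine eq_of_fib i (by rw [hp, E.proj_zero]) (by rwa [hp]) ?_
    -- The fibre coordinate of the sum of the lifts is `η w + η w' = η (w + w')`, which is `0` for
    -- `η = 0`.
    rw [E.fib_zero hi, E.fib_map _ _ _ (by rw [E.proj_add]; exact b.proj_lift_mem hi),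
      E.fib_add _ _ _ _ _ (b.proj_lift_mem hi), b.fib_lift hi, b'.fib_lift (h ▸ hi), ← map_add,
      Bar.map_evalLine, Bar.oddMul_zero_left]⟩

lemma coord_add (b b' : E.FlipPt A) (h : b.pt = b'.pt) {i : E.ι} (hi : b.pt ∈ E.base i A) :
    (b.add b' h).coord i = b.coord i + b'.coord i := by
  change Bar.contractOdd _ (E.fib i _ (E.add _ _ _ _)) = _
  rw [E.fib_add _ _ _ _ _ (b.proj_lift_mem hi), map_add]
  rfl

/-- The product of a point with an even element. -/
def smul (c : A.Even) (b : E.FlipPt A) : E.FlipPt A :=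
  ⟨(b.pt, E.smul _ (Gr.Hom.resEven (Gr.inr Gr.line A) c) b.lift), by
    rw [E.proj_smul, proj_lift], by
    obtain ⟨i, hi⟩ := E.cover A b.pt
    have hp : E.proj.app A (E.tot.map (Gr.evalLine 0)
        (E.smul _ (Gr.Hom.resEven (Gr.inr Gr.line A) c) b.lift)) = b.pt := by
      rw [E.proj_map, E.proj_smul, proj_lift, ← pts_map_comp, Gr.inr_evalLine, pts_map_id]
    refine eq_of_fib i (by rw [hp, E.proj_zero]) (by rwa [hp]) ?_
    rw [E.fib_zero hi, E.fib_map _ _ _ (by rw [E.proj_smul]; exact b.proj_lift_mem hi),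
      E.fib_smul _ _ _ _ (b.proj_lift_mem hi), b.fib_lift hi, ← Bar.tensOddMul_even_smul,
      Bar.map_evalLine, Bar.oddMul_zero_left]⟩

lemma coord_smul (c : A.Even) (b : E.FlipPt A) {i : E.ι} (hi : b.pt ∈ E.base i A) :
    (b.smul c).coord i = c • b.coord i := by
  change Bar.contractOdd _ (E.fib i _ (E.smul _ _ _)) = _
  rw [E.fib_smul _ _ _ _ (b.proj_lift_mem hi), Bar.contractOdd_smul]
  rfl

/-- The product of a point of the bundle with reversed parity with an odd element. -/
def oddSmul (c : A.part 1) (b : E.FlipPt A) : E.tot.obj A := E.tot.map (Gr.evalLine c) b.lift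

lemma proj_oddSmul (c : A.part 1) (b : E.FlipPt A) : E.proj.app A (b.oddSmul c) = b.pt := by
  rw [oddSmul, E.proj_map, proj_lift, ← pts_map_comp, Gr.inr_evalLine, pts_map_id]

/-- The lift has coordinate `η w`, and `oddSmul` substitutes `c` for `η`. Thus multiplication by `c`
takes the same form in every trivialization. -/
lemma fib_oddSmul (c : A.part 1) (b : E.FlipPt A) {i : E.ι} (hi : b.pt ∈ E.base i A) :
    E.fib i A (b.oddSmul c) = Bar.oddMul c (b.coord i) := by
  rw [oddSmul, E.fib_map _ _ _ (b.proj_lift_mem hi), b.fib_lift hi, Bar.map_evalLine]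

end FlipPt

variable (E)

/-- The bundle with reversed parity. -/
def parityFlip : SuperVectorBundle M V.flip where
  tot :=
    { obj := fun A => E.FlipPt A
      map := fun φ => ↾fun b => b.map φ
      map_id := fun A => by
        ext b
        refine FlipPt.ext_lift (pts_map_id _) ?_
        change E.tot.map (Gr.whisker Gr.line (𝟙 A)) b.lift = b.lift
        rw [Gr.whisker_id, tot_map_id]
      map_comp := fun φ ψ => by
        ext b
        refine FlipPt.ext_lift (pts_map_comp _ _ _) ?_
        change E.tot.map (Gr.whisker Gr.line (φ ≫ ψ)) b.lift =
          E.tot.map (Gr.whisker Gr.line ψ) (E.tot.map (Gr.whisker Gr.line φ) b.lift)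
        rw [Gr.whisker_comp, tot_map_comp] }
  proj := { app := fun A => ↾fun b => b.pt }
  add A b b' h := b.add b' h
  smul A c b := b.smul c
  proj_add A b b' h := rfl
  proj_smul A c b := rfl
  ι := E.ι
  base := E.base
  fib i A b := b.coord i
  base_map := E.base_map
  base_open := E.base_open
  cover := E.cover
  fib_map i A B φ b hb := b.coord_map φ hb
  fib_bij i A x hx := by
    refine ⟨fun _ _ => trivial, ?_, ?_⟩
    · intro b hb b' hb' h
      have e : b.pt = b'.pt := Eq.trans hb (Eq.symm hb')
      refine FlipPt.ext_coord i e ?_ h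
      have hb : b.pt = x := hb
      rwa [hb]
    · intro w _
      exact FlipPt.exists_coord i hx w
  fib_add i A b b' h hb := b.coord_add b' h hb
  fib_smul i A c b hb := b.coord_smul c hb
  transition i j A α := by
    -- The transition of `ΠE` over `A` is `w ↦ η w`, followed by the transition `g` of `E` over `Λ_1
    -- ⊗ A` and the division by `η`. The outer maps are continuous and semilinear along `inr`, so
    -- `SuperSmoothOn.baseChange` applies.
    obtain ⟨g, hg, hga⟩ := E.transition i j (Gr.line.tens A) α
    let P₁ : Pt A (M.model α) →L[ℝ] Pt (Gr.line.tens A) (M.model α) :=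
      ⟨Bar.map (Gr.inr Gr.line A), Bar.continuous_map _⟩
    let P₂ : Pt A V.flip →L[ℝ] Pt (Gr.line.tens A) V :=
      ⟨Bar.tensOddMul Gr.eta, (Bar.continuous_oddMul _).comp (Bar.continuous_map _)⟩
    let L : Pt (Gr.line.tens A) V →L[ℝ] Pt A V.flip :=
      ⟨Bar.contractOdd Gr.etaDual, Bar.continuous_contractOdd _⟩
    have hD := (((E.base_open i (Gr.line.tens A)).inter (E.base_open j (Gr.line.tens A))) α).prod
      (isOpen_univ (X := Pt (Gr.line.tens A) V))
    refine ⟨_, (SuperSmoothOn.baseChange (Gr.inr Gr.line A) (P₁.prodMap P₂) (fun a v =>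
      Prod.ext (Bar.map_smul_even _ a v.1) (Bar.tensOddMul_even_smul _ a v.2)) L
      (Bar.contractOdd_smul _) hD hg).mono ?_, ?_⟩
    · rintro ⟨_, w⟩ ⟨⟨m, hm, rfl⟩, -⟩
      exact ⟨⟨M.pts.map (Gr.inr Gr.line A) m, ⟨M.source_map α _ m hm.1,
        E.base_map i _ m hm.2.1, E.base_map j _ m hm.2.2⟩, M.coord_map α _ m hm.1⟩, trivial⟩
    · intro b hb
      have hb : b.pt ∈ M.source α A ∩ (E.base i A ∩ E.base j A) := hb
      change Bar.contractOdd _ (g (Bar.map (Gr.inr Gr.line A) (M.coord α A b.pt),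
        Bar.tensOddMul Gr.eta (b.coord i))) = Bar.contractOdd _ (E.fib j _ b.lift)
      rw [← b.fib_lift hb.2.1, ← M.coord_map α _ _ hb.1, ← b.proj_lift, hga]
      rw [b.proj_lift]
      exact ⟨M.source_map α _ _ hb.1, E.base_map i _ _ hb.2.1, E.base_map j _ _ hb.2.2⟩

lemma isParityReversal_parityFlip : E.IsParityReversal E.parityFlip := by
  refine ⟨Equiv.refl _, fun _ _ => rfl, fun i j A a b c hab hm h => ?_⟩
  have hab : E.proj.app A a = FlipPt.pt b := hab
  rw [hab] at hm
  -- The relation in the trivialization `i` identifies `a` with `c` times `b`, which no longer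
  -- refers to a trivialization. It can then be read off in `j`.
  have e : a = FlipPt.oddSmul c b := by
    refine eq_of_fib i (hab.trans (FlipPt.proj_oddSmul c b).symm) (by rw [hab]; exact hm.1) ?_
    rw [FlipPt.fib_oddSmul c b hm.1]
    exact h
  rw [e, FlipPt.fib_oddSmul c b hm.2]
  rfl

end SuperVectorBundle

/-! ### Tensor products over the first factor -/

namespace GTensor

variable {A : Gr} {i : ZMod 2} {V : Type u} [AddCommGroup V] [Module ℝ V]

/-- The linear map on `Λ_i ⊗ V` given by a bilinear map. -/
def lift {W : Type v} [AddCommGroup W] [Module ℝ W] (f : A.part i →ₗ[ℝ] V →ₗ[ℝ] W) :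
    GTensor A i V →ₗ[ℝ] W := TensorProduct.lift f

lemma lift_tmul {W : Type v} [AddCommGroup W] [Module ℝ W] (f : A.part i →ₗ[ℝ] V →ₗ[ℝ] W)
    (p : A.part i) (x : V) : lift f (tmul i p x) = f p x := TensorProduct.lift.tmul _ _

/-- Only existence of the coefficients is needed, for any finite basis of `Λ_i` and any vector space
`V`, such as a space of sections. Injectivity of `ofBar` is obtained from contractions instead of
uniqueness here. -/
lemma exists_eq_sum_tmul {ι : Type*} [Fintype ι] (b : Module.Basis ι ℝ (A.part i))
    (x : GTensor A i V) : ∃ y : ι → V, x = ∑ n, tmul i (b n) (y n) := by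
  induction x using GTensor.induction with
  | h0 => exact ⟨0, by simp⟩
  | ht p v =>
    refine ⟨fun n => b.repr p n • v, ?_⟩
    simp only [map_smul]
    conv_lhs => rw [← b.sum_repr p]
    exact (TensorProduct.sum_tmul _ _ _).trans
      (Finset.sum_congr rfl fun n _ => (TensorProduct.smul_tmul' _ _ _).symm)
  | ha x y hx hy =>
    obtain ⟨f, rfl⟩ := hx
    obtain ⟨g, rfl⟩ := hy
    exact ⟨f + g, by simp [Finset.sum_add_distrib]⟩

end GTensor

namespace Bar

variable {K A : Gr} {V₀ V₁ : Type u} [AddCommGroup V₀] [Module ℝ V₀] [AddCommGroup V₁] [Module ℝ V₁]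
  {g : Bar (K.tens A) V₀ V₁ →ₗ[ℝ] Bar (K.tens A) V₀ V₁} {g₀ : Bar A V₀ V₁ →ₗ[ℝ] Bar A V₀ V₁}
  {g₁ : Bar A V₁ V₀ →ₗ[ℝ] Bar A V₁ V₀}

/-- After expanding `x` into products `k w`, the hypotheses say that `g` acts on the factors `w`
alone, and the orthogonality relations finish the computation. -/
lemma contractEven_comm (h₀ : ∀ k w, g (tensEvenMul k w) = tensEvenMul k (g₀ w))
    (h₁ : ∀ k w, g (tensOddMul k w) = tensOddMul k (g₁ w)) (f : K.part 0 →ₗ[ℝ] ℝ)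
    (x : Bar (K.tens A) V₀ V₁) : contractEven f (g x) = g₀ (contractEven f x) := by
  conv_lhs => rw [← sum_tensMul_contract (Module.finBasis ℝ _) (Module.finBasis ℝ _) x]
  conv_rhs => rw [← sum_tensMul_contract (Module.finBasis ℝ _) (Module.finBasis ℝ _) x]
  simp only [map_add, map_sum, h₀, h₁, contractEven_tensEvenMul, contractEven_tensOddMul, map_smul,
    map_zero]

lemma contractOdd_comm (h₀ : ∀ k w, g (tensEvenMul k w) = tensEvenMul k (g₀ w))
    (h₁ : ∀ k w, g (tensOddMul k w) = tensOddMul k (g₁ w)) (f : K.part 1 →ₗ[ℝ] ℝ)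
    (x : Bar (K.tens A) V₀ V₁) : contractOdd f (g x) = g₁ (contractOdd f x) := by
  conv_lhs => rw [← sum_tensMul_contract (Module.finBasis ℝ _) (Module.finBasis ℝ _) x]
  conv_rhs => rw [← sum_tensMul_contract (Module.finBasis ℝ _) (Module.finBasis ℝ _) x]
  simp only [map_add, map_sum, h₀, h₁, contractOdd_tensEvenMul, contractOdd_tensOddMul, map_smul,
    map_zero]

end Bar

namespace SuperVectorBundle

open SuperManifold

variable {M : SuperManifold.{u}} {V : SBanach.{u}} (E : SuperVectorBundle M V) {A B K L : Gr}

/-! ### Contraction of the changes of trivializations -/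

/-- The change of trivializations over a point is linear. -/
lemma exists_linear_transition {i j : E.ι} {x : M.pts.obj A} (hi : x ∈ E.base i A)
    (hj : x ∈ E.base j A) : ∃ g : Pt A V →ₗ[ℝ] Pt A V,
      ∀ a, E.proj.app A a = x → E.fib j A a = g (E.fib i A a) := by
  -- `s` inverts the trivialization `i` on the fibre over `x`. The change of trivializations is `s`
  -- followed by the coordinate `j`.
  choose s hs hf using fun v => E.exists_fib i hi v
  have key : ∀ a, E.proj.app A a = x → E.fib j A a = E.fib j A (s (E.fib i A a)) := fun a ha =>
    congrArg _ (eq_of_fib i (ha.trans (hs _).symm) (ha ▸ hi) (hf _).symm)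
  have hsi : ∀ v, E.proj.app A (s v) ∈ E.base i A := fun v => by rwa [hs]
  have hsj : ∀ v, E.proj.app A (s v) ∈ E.base j A := fun v => by rwa [hs]
  refine ⟨{ toFun := fun v => E.fib j A (s v), map_add' := fun v w => ?_,
            map_smul' := fun r v => ?_ }, key⟩
  · have h := key (E.add A (s v) (s w) ((hs v).trans (hs w).symm)) (by rw [E.proj_add, hs])
    rw [E.fib_add _ _ _ _ _ (hsi v), E.fib_add _ _ _ _ _ (hsj v), hf, hf] at h
    exact h.symm
  · have h := key (E.smul A (algebraMap ℝ A.Even r) (s v)) (by rw [E.proj_smul, hs])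
    rw [E.fib_smul _ _ _ _ (hsi v), E.fib_smul _ _ _ _ (hsj v), hf, Bar.algebraMap_smul,
      Bar.algebraMap_smul] at h
    exact h.symm

/-- Contractions commute with the changes of trivializations of a bundle and of the bundle with
reversed parity. -/
lemma exists_transition_comm {i j : E.ι} {x : M.pts.obj A} (hi : x ∈ E.base i A)
    (hj : x ∈ E.base j A) : ∃ (g₀ : Pt A V →ₗ[ℝ] Pt A V) (g₁ : Pt A V.flip →ₗ[ℝ] Pt A V.flip),
      (∀ a, E.proj.app A a = x → E.fib j A a = g₀ (E.fib i A a)) ∧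
      (∀ b : E.FlipPt A, b.pt = x → b.coord j = g₁ (b.coord i)) ∧
      ∀ u : E.tot.obj (K.tens A), E.proj.app _ u = M.pts.map (K.inr A) x →
        (∀ f, Bar.contractEven f (E.fib j _ u) = g₀ (Bar.contractEven f (E.fib i _ u))) ∧
        ∀ f, Bar.contractOdd f (E.fib j _ u) = g₁ (Bar.contractOdd f (E.fib i _ u)) := by
  obtain ⟨g₀, hg₀⟩ := E.exists_linear_transition hi hj
  -- The companion `g₁` is the change of trivializations of the bundle with reversed parity.
  obtain ⟨g₁, hg₁⟩ := E.parityFlip.exists_linear_transition (i := i) (j := j) hi hj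
  have hi' := E.base_map i (K.inr A) x hi
  have hj' := E.base_map j (K.inr A) x hj
  obtain ⟨g, hg⟩ := E.exists_linear_transition hi' hj'
  have hg₁' : ∀ b : E.FlipPt A, b.pt = x → b.coord j = g₁ (b.coord i) := fun b hb => hg₁ b hb
  refine ⟨g₀, g₁, hg₀, hg₁', fun u hu => ?_⟩
  -- The vector `k w` is the coordinate of a point of `E` over `K ⊗ A`, namely `inl k` times the
  -- image of a point over `A`. Reading this point in both trivializations gives the formula.
  have h₀ : ∀ (k : K.part 0) (w : Pt A V), g (Bar.tensEvenMul k w) = Bar.tensEvenMul k (g₀ w) := by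
    intro k w
    obtain ⟨a, rfl, rfl⟩ := E.exists_fib i hi w
    have hp := E.proj_map (K.inr A) a
    have h := hg (E.smul _ (Gr.toEven (Gr.Hom.res (K.inl A) 0 k)) (E.tot.map (K.inr A) a))
      (by rw [E.proj_smul, hp])
    rw [E.fib_smul _ _ _ _ (hp ▸ hj'), E.fib_smul _ _ _ _ (hp ▸ hi'), E.fib_map _ _ _ hj,
      E.fib_map _ _ _ hi, hg₀ a rfl, ← Bar.evenMul_eq_smul, ← Bar.evenMul_eq_smul] at h
    exact h.symm
  -- For odd `k` the same argument takes a point of the reversed bundle over `A`, maps it to `K ⊗ A`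
  -- and multiplies it by the odd element `inl k`.
  have h₁ : ∀ (k : K.part 1) (w : Pt A V.flip),
      g (Bar.tensOddMul k w) = Bar.tensOddMul k (g₁ w) := by
    intro k w
    obtain ⟨b, rfl, rfl⟩ := FlipPt.exists_coord i hi w
    have h := hg ((b.map (K.inr A)).oddSmul (Gr.Hom.res (K.inl A) 1 k)) (FlipPt.proj_oddSmul _ _)
    rw [FlipPt.fib_oddSmul _ (b.map (K.inr A)) hi', FlipPt.fib_oddSmul _ (b.map (K.inr A)) hj',
      b.coord_map _ hi, b.coord_map _ hj, hg₁' b rfl] at h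
    exact h.symm
  rw [hg u hu]
  exact ⟨fun f => Bar.contractEven_comm h₀ h₁ f _, fun f => Bar.contractOdd_comm h₀ h₁ f _⟩

/-! ### Coefficients of families of sections -/

variable {E}

lemma val_map (σ : (E.family K).Section) (ψ : A ⟶ B) (p : K ⟶ A) (m : M.pts.obj A) :
    val σ B (p ≫ ψ) (M.pts.map ψ m) = E.tot.map ψ (val σ A p m) :=
  congrArg (fun y => y.1.2) (σ.1.naturality ψ (p, m))

/-- The restriction of a family of sections to a point of the superpoint is supersmooth. -/
lemma smoothOn_fib_val (σ : (E.family K).Section) (p : K ⟶ A) (i : E.ι) :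
    M.SmoothOn (fun m => E.fib i A (val σ A p m)) (E.base i A) := by
  classical
  -- The constant map to `p` has to be given over all Grassmann algebras. Its values away from `A`
  -- are irrelevant, since supersmoothness is a condition over each algebra separately and does not
  -- include naturality.
  let q : ∀ B, K ⟶ B := fun B => if h : A = B then h ▸ p else Gr.homOfGen 0
  have hq : q A = p := dif_pos rfl
  have hc : IsSuperSmooth (X := M) (Y := superpoint K) fun B _ => q B := fun B _ => smoothOn_const _
  have h := (hc.prodMk (isSuperSmooth_id M)).smoothOn (σ.smoothOn_fib_eval i A)
  have hsm : M.SmoothOn (fun m => E.fib i A (val σ A (q A) m)) (E.base i A) := h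
  rwa [hq] at hsm

/-- The value of a family of sections at the generic point of the superpoint. -/
def generic (σ : (E.family K).Section) (A : Gr) (m : M.pts.obj A) : E.tot.obj (K.tens A) :=
  val σ (K.tens A) (K.inl A) (M.pts.map (K.inr A) m)

lemma proj_generic (σ : (E.family K).Section) (m : M.pts.obj A) :
    E.proj.app _ (generic σ A m) = M.pts.map (K.inr A) m := proj_val _ _ _ _

/-- The morphism `id ⊗ φ` fixes the generic point `inl` and carries `inr m` to `inr (φ m)`. -/
lemma generic_map (σ : (E.family K).Section) (φ : A ⟶ B) (m : M.pts.obj A) :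
    generic σ B (M.pts.map φ m) = E.tot.map (Gr.whisker K φ) (generic σ A m) := by
  rw [generic, generic, ← val_map, Gr.inl_whisker, ← pts_map_comp, ← pts_map_comp, Gr.inr_whisker]

/-- The pair `(p, m)` is the image of `(inl, inr m)` under `desc p (𝟙 A)`, so naturality of `σ`
recovers all its values from the generic ones. -/
lemma map_desc_generic (σ : (E.family K).Section) (p : K ⟶ A) (m : M.pts.obj A) :
    E.tot.map (Gr.desc p (𝟙 A)) (generic σ A m) = val σ A p m := by
  rw [generic, ← val_map, Gr.inl_desc, ← pts_map_comp, Gr.inr_desc, pts_map_id]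

lemma proj_generic_mem (σ : (E.family K).Section) {m : M.pts.obj A} {i : E.ι}
    (hm : m ∈ E.base i A) : E.proj.app _ (generic σ A m) ∈ E.base i (K.tens A) := by
  rw [proj_generic]; exact E.base_map i _ m hm

/-- A contraction that commutes with the changes of trivializations, applied to the generic values
of a family of sections, gives a section. -/
lemma exists_coeff (σ : (E.family K).Section) {W : SBanach.{u}} (F : SuperVectorBundle M W)
    (ε : E.ι ≃ F.ι) (hε : ∀ i A, F.base (ε i) A = E.base i A)
    (C : ∀ A, Pt (K.tens A) V →L[ℝ] Pt A W)
    (hC : ∀ A (a : A.Even) x, C A (Gr.Hom.resEven (K.inr A) a • x) = a • C A x)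
    (hn : ∀ {A B : Gr} (φ : A ⟶ B) x, C B (Bar.map (Gr.whisker K φ) x) = Bar.map φ (C A x))
    (ht : ∀ A i j (m : M.pts.obj A) b, m ∈ E.base i A → m ∈ E.base j A → F.proj.app A b = m →
      F.fib (ε i) A b = C A (E.fib i _ (generic σ A m)) →
      F.fib (ε j) A b = C A (E.fib j _ (generic σ A m))) :
    ∃ s : F.Section, ∀ A i (m : M.pts.obj A), m ∈ E.base i A →
      F.fib (ε i) A (s.eval A m) = C A (E.fib i _ (generic σ A m)) := by
  -- The value is prescribed in one trivialization around `m`, and `ht` makes it correct in all the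
  -- others.
  have hex : ∀ A (m : M.pts.obj A), ∃ b, F.proj.app A b = m ∧ ∀ i, m ∈ E.base i A →
      F.fib (ε i) A b = C A (E.fib i _ (generic σ A m)) := by
    intro A m
    obtain ⟨i, hi⟩ := E.cover A m
    obtain ⟨b, hb, hv⟩ := F.exists_fib (ε i) (by rwa [hε]) (C A (E.fib i _ (generic σ A m)))
    exact ⟨b, hb, fun j hj => ht A i j m b hi hj hb hv⟩
  choose f hf hfib using hex
  refine ⟨Section.mk f hf (fun {A B} φ i' m hm => ?_) (fun i' A => ?_), fun A i m => hfib A m i⟩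
  · obtain ⟨i, rfl⟩ := ε.surjective i'
    rw [hε] at hm
    rw [hfib _ _ _ hm, hfib _ _ _ (E.base_map i φ m hm), generic_map,
      E.fib_map _ _ _ (proj_generic_mem σ hm), hn]
  · obtain ⟨i, rfl⟩ := ε.surjective i'
    rw [hε]
    -- Over `K ⊗ A` the point `inl` of the superpoint is fixed, so `σ` restricts to a supersmooth
    -- function on the points of `M` over `K ⊗ A`. Base change along `inr` brings its contraction
    -- back to `A`.
    have h := SmoothOn.baseChange (K.inr A) (C A) (hC A) (smoothOn_fib_val σ (K.inl A) i)
    exact Section.smoothOn_congr (h.mono (E.base_open i A) fun m hm => E.base_map i _ m hm)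
      fun m hm => (hfib A m i hm).symm

/-- Even contractions of the generic value follow the change `g₀` of `E` itself, by
`exists_transition_comm`, hence they define a section of `E`. -/
lemma exists_coeffEven (σ : (E.family K).Section) (f : K.part 0 →ₗ[ℝ] ℝ) :
    ∃ s : E.Section, ∀ A i (m : M.pts.obj A), m ∈ E.base i A →
      E.fib i A (s.eval A m) = Bar.contractEven f (E.fib i _ (generic σ A m)) :=
  exists_coeff σ E (Equiv.refl _) (fun _ _ => rfl)
    (fun _ => ⟨Bar.contractEven f, Bar.continuous_contractEven f⟩)
    (fun _ => Bar.contractEven_smul f) (fun φ => Bar.contractEven_map f φ)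
    (fun A i j m b hi hj hb h => by
      obtain ⟨g₀, g₁, hg₀, -, hg⟩ := E.exists_transition_comm (K := K) hi hj
      exact ((hg₀ b hb).trans (congrArg g₀ h)).trans
        ((hg _ (proj_generic σ m)).1 f).symm)

/-- Odd contractions exchange the parities of `V` and follow the change `g₁` of the reversed bundle,
hence they define a section of that bundle. -/
lemma exists_coeffOdd (σ : (E.family K).Section) (f : K.part 1 →ₗ[ℝ] ℝ) :
    ∃ s : E.parityFlip.Section, ∀ A i (m : M.pts.obj A), m ∈ E.base i A →
      E.parityFlip.fib i A (s.eval A m) = Bar.contractOdd f (E.fib i _ (generic σ A m)) :=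
  exists_coeff σ E.parityFlip (Equiv.refl _) (fun _ _ => rfl)
    (fun _ => ⟨Bar.contractOdd f, Bar.continuous_contractOdd f⟩)
    (fun _ => Bar.contractOdd_smul f) (fun φ => Bar.contractOdd_map f φ)
    (fun A i j m b hi hj hb h => by
      obtain ⟨g₀, g₁, -, hg₁, hg⟩ := E.exists_transition_comm (K := K) hi hj
      exact ((hg₁ b hb).trans (congrArg g₁ h)).trans
        ((hg _ (proj_generic σ m)).2 f).symm)

/-! ### Families of sections with given coefficients -/

/-- A family of sections is given by its values, if their fibre coordinates are natural and
supersmooth. -/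
def familyMk (f : ∀ A, (K ⟶ A) → M.pts.obj A → E.tot.obj A)
    (hp : ∀ A p m, E.proj.app A (f A p m) = m)
    (hn : ∀ {A B : Gr} (φ : A ⟶ B) (i : E.ι) (p : K ⟶ A) (m : M.pts.obj A), m ∈ E.base i A →
      E.fib i B (f B (p ≫ φ) (M.pts.map φ m)) = Bar.map φ (E.fib i A (f A p m)))
    (hs : ∀ i A, ((superpoint K).prod M).SmoothOn (A := A)
      (fun x => E.fib i A (f A x.1 x.2)) {x | x.2 ∈ E.base i A}) : (E.family K).Section :=
  Section.mk (E := E.family K) (fun A x => ⟨(x, f A x.1 x.2), (hp A x.1 x.2).symm⟩)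
    (fun _ _ => rfl) (fun φ i x hx => hn φ i x.1 x.2 hx) hs

lemma smoothOn_snd_fib {W : SBanach.{u}} {F : SuperVectorBundle M W} (s : F.Section) (i : F.ι) :
    ((superpoint K).prod M).SmoothOn (A := A)
      (fun x => F.fib i A (s.eval A x.2)) {x | x.2 ∈ F.base i A} :=
  (isSuperSmooth_snd (X := superpoint K) (Y := M)).smoothOn (s.smoothOn_fib_eval i A)

/-- The family of sections `(p, m) ↦ p(k) s(m)`, for an even element `k`. -/
def evenFamily (k : K.part 0) (s : E.Section) : (E.family K).Section :=
  familyMk (fun A p m => E.smul A (Gr.toEven (Gr.Hom.res p 0 k)) (s.eval A m))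
    (fun A p m => by rw [E.proj_smul, Section.proj_eval])
    (fun φ i p m hm => by
      rw [E.fib_smul _ _ _ _ (s.proj_eval_mem hm),
        E.fib_smul _ _ _ _ (s.proj_eval_mem (E.base_map i φ m hm)), s.fib_eval_map φ hm,
        Bar.map_smul_even]
      rfl)
    (fun i A => Section.smoothOn_congr
      (((smoothOn_family_eval M 0 k).mono (smoothOn_snd_fib s i).1 (Set.subset_univ _)).evenMul
        (smoothOn_snd_fib s i)) fun x hx => by
          rw [E.fib_smul _ _ _ _ (s.proj_eval_mem hx), Bar.evenMul_eq_smul])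

lemma fib_evenFamily (k : K.part 0) (s : E.Section) (p : K ⟶ A) {m : M.pts.obj A} {i : E.ι}
    (hm : m ∈ E.base i A) : E.fib i A (val (evenFamily k s) A p m) =
      Bar.evenMul (Gr.Hom.res p 0 k) (E.fib i A (s.eval A m)) :=
  (E.fib_smul _ _ _ _ (s.proj_eval_mem hm)).trans (Bar.evenMul_eq_smul _ _).symm

/-- The value of a section of the bundle with reversed parity. -/
def flipEval (t : E.parityFlip.Section) (A : Gr) (m : M.pts.obj A) : E.FlipPt A := t.eval A m

lemma pt_flipEval (t : E.parityFlip.Section) (m : M.pts.obj A) : (flipEval t A m).pt = m :=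
  t.proj_eval m

lemma pt_flipEval_mem (t : E.parityFlip.Section) {m : M.pts.obj A} {i : E.ι}
    (hm : m ∈ E.base i A) : (flipEval t A m).pt ∈ E.base i A := by rwa [pt_flipEval]

/-- The family of sections `(p, m) ↦ p(k) t(m)`, for an odd element `k`. -/
def oddFamily (k : K.part 1) (t : E.parityFlip.Section) : (E.family K).Section :=
  familyMk (fun A p m => (flipEval t A m).oddSmul (Gr.Hom.res p 1 k))
    (fun A p m => (FlipPt.proj_oddSmul _ _).trans (pt_flipEval t m))
    (fun φ i p m hm => by
      rw [FlipPt.fib_oddSmul _ _ (pt_flipEval_mem t hm),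
        FlipPt.fib_oddSmul _ _ (pt_flipEval_mem t (E.base_map i φ m hm)), Bar.map_oddMul]
      exact congrArg (Bar.oddMul _) (t.fib_eval_map φ (i := i) hm))
    (fun i A => Section.smoothOn_congr
      (((smoothOn_family_eval M 1 k).mono (smoothOn_snd_fib t i).1 (Set.subset_univ _)).oddMul
        (smoothOn_snd_fib t i)) fun x hx =>
          (FlipPt.fib_oddSmul _ _ (pt_flipEval_mem t hx)).symm)

lemma fib_oddFamily (k : K.part 1) (t : E.parityFlip.Section) (p : K ⟶ A) {m : M.pts.obj A}
    {i : E.ι} (hm : m ∈ E.base i A) : E.fib i A (val (oddFamily k t) A p m) =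
      Bar.oddMul (Gr.Hom.res p 1 k) (E.parityFlip.fib i A (t.eval A m)) :=
  FlipPt.fib_oddSmul _ _ (pt_flipEval_mem t hm)

lemma fib_val_real_smul (r : ℝ) (σ : (E.family K).Section) (p : K ⟶ A) {m : M.pts.obj A} {i : E.ι}
    (hm : m ∈ E.base i A) : E.fib i A (val (r • σ) A p m) = r • E.fib i A (val σ A p m) :=
  Section.fib_eval_smul (E := E.family K) r σ (x := (p, m)) hm

lemma fib_val_sum {ι : Type*} (S : Finset ι) (σ : ι → (E.family K).Section) (p : K ⟶ A)
    {m : M.pts.obj A} {i : E.ι} (hm : m ∈ E.base i A) :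
    E.fib i A (val (∑ n ∈ S, σ n) A p m) = ∑ n ∈ S, E.fib i A (val (σ n) A p m) :=
  Section.fib_eval_sum (E := E.family K) S σ (x := (p, m)) hm

variable (E K) in
/-- The families `(p, m) ↦ p(k) s(m)`, as a bilinear map. -/
def evenFamilyBilin : K.part 0 →ₗ[ℝ] E.Section →ₗ[ℝ] (E.family K).Section :=
  LinearMap.mk₂ ℝ evenFamily
    (fun k k' s => family_ext_fib fun A i p m hm => by
      rw [fib_val_add _ _ _ hm, fib_evenFamily _ _ _ hm, fib_evenFamily _ _ _ hm,
        fib_evenFamily _ _ _ hm, map_add, Bar.evenMul_add_left])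
    (fun r k s => family_ext_fib fun A i p m hm => by
      rw [fib_val_real_smul _ _ _ hm, fib_evenFamily _ _ _ hm, fib_evenFamily _ _ _ hm, map_smul,
        Bar.evenMul_smul_left])
    (fun k s s' => family_ext_fib fun A i p m hm => by
      rw [fib_val_add _ _ _ hm, fib_evenFamily _ _ _ hm, fib_evenFamily _ _ _ hm,
        fib_evenFamily _ _ _ hm, Section.fib_eval_add _ _ hm, map_add])
    (fun r k s => family_ext_fib fun A i p m hm => by
      rw [fib_val_real_smul _ _ _ hm, fib_evenFamily _ _ _ hm, fib_evenFamily _ _ _ hm,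
        Section.fib_eval_smul _ _ hm, map_smul])

variable (E K) in
/-- The families `(p, m) ↦ p(k) t(m)`, for odd `k`, as a bilinear map. -/
def oddFamilyBilin : K.part 1 →ₗ[ℝ] E.parityFlip.Section →ₗ[ℝ] (E.family K).Section :=
  LinearMap.mk₂ ℝ oddFamily
    (fun k k' s => family_ext_fib fun A i p m hm => by
      rw [fib_val_add _ _ _ hm, fib_oddFamily _ _ _ hm, fib_oddFamily _ _ _ hm,
        fib_oddFamily _ _ _ hm, map_add, Bar.oddMul_add_left])
    (fun r k s => family_ext_fib fun A i p m hm => by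
      rw [fib_val_real_smul _ _ _ hm, fib_oddFamily _ _ _ hm, fib_oddFamily _ _ _ hm, map_smul,
        Bar.oddMul_smul_left])
    (fun k s s' => family_ext_fib fun A i p m hm => by
      rw [fib_val_add _ _ _ hm, fib_oddFamily _ _ _ hm, fib_oddFamily _ _ _ hm,
        fib_oddFamily _ _ _ hm, Section.fib_eval_add (E := E.parityFlip) _ _ (i := i) hm]
      exact map_add (Bar.oddMul (Gr.Hom.res p 1 k)) _ _)
    (fun r k s => family_ext_fib fun A i p m hm => by
      rw [fib_val_real_smul _ _ _ hm, fib_oddFamily _ _ _ hm, fib_oddFamily _ _ _ hm,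
        Section.fib_eval_smul (E := E.parityFlip) _ _ (i := i) hm]
      exact map_smul (Bar.oddMul (Gr.Hom.res p 1 k)) _ _)

variable (E K) in
/-- The map from `(Λ ⊗ E)_0` to the families of sections, where `E` is the super vector space of
sections. -/
def ofBar : Bar K E.Section E.parityFlip.Section →ₗ[ℝ] (E.family K).Section :=
  (GTensor.lift (E.evenFamilyBilin K)).coprod (GTensor.lift (E.oddFamilyBilin K))

lemma ofBar_apply (x : Bar K E.Section E.parityFlip.Section) : E.ofBar K x =
    GTensor.lift (E.evenFamilyBilin K) x.1 + GTensor.lift (E.oddFamilyBilin K) x.2 := rfl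

/-- On pure tensors this is `p(a k) = p(a) p(k)`. -/
lemma ofBar_smul (a : K.Even) (x : Bar K E.Section E.parityFlip.Section) :
    E.ofBar K (a • x) = a • E.ofBar K x := by
  rw [ofBar_apply, ofBar_apply, smul_add]
  congr 1
  · change GTensor.lift _ (a • x.1) = _
    induction x.1 using GTensor.induction with
    | h0 => rw [smul_zero, _root_.map_zero, smul_zero]
    | ha y z hy hz => rw [smul_add, map_add, map_add, smul_add, hy, hz]
    | ht k s =>
      rw [GTensor.smul_tmul, GTensor.lift_tmul, GTensor.lift_tmul]
      refine family_ext_fib fun A i p m hm => ?_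
      refine (fib_evenFamily _ _ _ hm).trans (Eq.trans ?_ (fib_val_smul _ _ _ hm).symm)
      refine Eq.trans ?_ (congrArg _ (fib_evenFamily k s p hm).symm)
      rw [Bar.evenMul_eq_smul, Bar.evenMul_eq_smul, smul_smul]
      congr 1
      exact Subtype.ext (map_mul (Gr.Hom.alg p) _ _)
  · change GTensor.lift _ (a • x.2) = _
    induction x.2 using GTensor.induction with
    | h0 => rw [smul_zero, _root_.map_zero, smul_zero]
    | ha y z hy hz => rw [smul_add, map_add, map_add, smul_add, hy, hz]
    | ht k s =>
      rw [GTensor.smul_tmul, GTensor.lift_tmul, GTensor.lift_tmul]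
      refine family_ext_fib fun A i p m hm => ?_
      refine (fib_oddFamily _ _ _ hm).trans (Eq.trans ?_ (fib_val_smul _ _ _ hm).symm)
      refine Eq.trans ?_ (congrArg _ (fib_oddFamily k s p hm).symm)
      rw [← Bar.oddMul_even_smul_left]
      congr 2
      exact Subtype.ext (map_mul (Gr.Hom.alg p) _ _)

/-- On pure tensors both sides are, by definition, the family `(p, m) ↦ (φ ≫ p)(k) s(m)`, and
additivity does the rest. -/
lemma ofBar_map (φ : K ⟶ L) (x : Bar K E.Section E.parityFlip.Section) :
    E.ofBar L (Bar.map φ x) = E.sectionMap φ (E.ofBar K x) := by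
  have h0 : E.sectionMap φ (0 : (E.family K).Section) = 0 := family_ext_fib fun A i p m hm =>
    (fib_val_zero (φ ≫ p) hm).trans (fib_val_zero p hm).symm
  rw [ofBar_apply, ofBar_apply, sectionMap_add]
  congr 1
  · change GTensor.lift _ (GTensor.map 0 φ x.1) = _
    induction x.1 using GTensor.induction with
    | h0 => rw [_root_.map_zero, _root_.map_zero, _root_.map_zero, h0]
    | ha y z hy hz => rw [map_add, map_add, map_add, sectionMap_add, hy, hz]
    | ht k s => exact section_ext fun _ _ _ => rfl
  · change GTensor.lift _ (GTensor.map 1 φ x.2) = _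
    induction x.2 using GTensor.induction with
    | h0 => rw [_root_.map_zero, _root_.map_zero, _root_.map_zero, h0]
    | ha y z hy hz => rw [map_add, map_add, map_add, sectionMap_add, hy, hz]
    | ht k s => exact section_ext fun _ _ _ => rfl

/-! ### Bijectivity by expansion in bases of the Grassmann algebra. -/

section Basis

variable {ι₀ ι₁ : Type*} [Fintype ι₀] [Fintype ι₁] (b₀ : Module.Basis ι₀ ℝ (K.part 0))
  (b₁ : Module.Basis ι₁ ℝ (K.part 1)) (s : ι₀ → E.Section) (t : ι₁ → E.parityFlip.Section)

/-- The value at `p` is written as a substitution into an expression over `K ⊗ A` that does not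
involve `p`. This puts it in the form of `map_desc_generic`. -/
lemma fib_ofBar_sum (p : K ⟶ A) {m : M.pts.obj A} {i : E.ι} (hm : m ∈ E.base i A) :
    E.fib i A (val (E.ofBar K (∑ n, GTensor.tmul 0 (b₀ n) (s n), ∑ n, GTensor.tmul 1 (b₁ n) (t n)))
      A p m) = Bar.map (Gr.desc p (𝟙 A)) (∑ n, Bar.tensEvenMul (b₀ n) (E.fib i A ((s n).eval A m)) +
        ∑ n, Bar.tensOddMul (b₁ n) (E.parityFlip.fib i A ((t n).eval A m))) := by
  rw [ofBar_apply, fib_val_add _ _ _ hm, map_sum, map_sum, fib_val_sum _ _ _ hm,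
    fib_val_sum _ _ _ hm, map_add, map_sum, map_sum]
  congr 1
  · refine Finset.sum_congr rfl fun n _ => ?_
    rw [GTensor.lift_tmul, Bar.map_desc_tensEvenMul, Bar.map_id]
    exact fib_evenFamily _ _ _ hm
  · refine Finset.sum_congr rfl fun n _ => ?_
    rw [GTensor.lift_tmul, Bar.map_desc_tensOddMul, Bar.map_id]
    exact fib_oddFamily _ _ _ hm

/-- At the generic point `p = inl` the products `p(k) s(inr m)` are the products of the two factors
of the coproduct. The coefficients thus appear unchanged and can be contracted out. -/
lemma fib_ofBar_sum_generic {m : M.pts.obj A} {i : E.ι} (hm : m ∈ E.base i A) :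
    E.fib i _ (generic (E.ofBar K (∑ n, GTensor.tmul 0 (b₀ n) (s n),
      ∑ n, GTensor.tmul 1 (b₁ n) (t n))) A m) =
      ∑ n, Bar.tensEvenMul (b₀ n) (E.fib i A ((s n).eval A m)) +
        ∑ n, Bar.tensOddMul (b₁ n) (E.parityFlip.fib i A ((t n).eval A m)) := by
  have hm' := E.base_map i (K.inr A) m hm
  rw [generic, fib_ofBar_sum b₀ b₁ s t _ hm', map_add, map_sum, map_sum]
  congr 1
  · refine Finset.sum_congr rfl fun n _ => ?_
    rw [Bar.map_desc_tensEvenMul, Bar.map_id, (s n).fib_eval_map _ hm]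
    rfl
  · refine Finset.sum_congr rfl fun n _ => ?_
    rw [Bar.map_desc_tensOddMul, Bar.map_id]
    exact congrArg (Bar.oddMul _) ((t n).fib_eval_map (K.inr A) (i := i) hm)

end Basis

lemma ofBar_injective : Function.Injective (E.ofBar K) := by
  classical
  rw [injective_iff_map_eq_zero]
  rintro ⟨x, y⟩ h
  let b₀ := Module.finBasis ℝ (K.part 0)
  let b₁ := Module.finBasis ℝ (K.part 1)
  obtain ⟨s, rfl⟩ := GTensor.exists_eq_sum_tmul b₀ x
  obtain ⟨t, rfl⟩ := GTensor.exists_eq_sum_tmul b₁ y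
  have key : ∀ A i (m : M.pts.obj A), m ∈ E.base i A →
      ∑ n, Bar.tensEvenMul (b₀ n) (E.fib i A ((s n).eval A m)) +
        ∑ n, Bar.tensOddMul (b₁ n) (E.parityFlip.fib i A ((t n).eval A m)) = 0 := by
    intro A i m hm
    rw [← fib_ofBar_sum_generic b₀ b₁ s t hm, h]
    exact fib_val_zero _ (E.base_map i _ m hm)
  -- Contraction with the dual basis vector `l` isolates the coordinate of the section `s l`.
  have hs : s = 0 := funext fun l => Section.ext_fib fun A i m hm => by
    have h := congrArg (Bar.contractEven (b₀.coord l)) (key A i m hm)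
    simp only [map_add, map_sum, Bar.contractEven_tensEvenMul, Bar.contractEven_tensOddMul,
      Finset.sum_const_zero, add_zero, _root_.map_zero, Module.Basis.coord_apply,
      Module.Basis.repr_self, Finsupp.single_apply, ite_smul, one_smul, zero_smul,
      Finset.sum_ite_eq', Finset.mem_univ, if_true] at h
    exact h.trans (Section.fib_eval_zero hm).symm
  have ht : t = 0 := funext fun l => Section.ext_fib fun A i m hm => by
    have h := congrArg (Bar.contractOdd (b₁.coord l)) (key A i m hm)
    simp only [map_add, map_sum, Bar.contractOdd_tensEvenMul, Bar.contractOdd_tensOddMul,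
      Finset.sum_const_zero, zero_add, _root_.map_zero, Module.Basis.coord_apply,
      Module.Basis.repr_self, Finsupp.single_apply, ite_smul, one_smul, zero_smul,
      Finset.sum_ite_eq', Finset.mem_univ, if_true] at h
    exact h.trans (Section.fib_eval_zero (E := E.parityFlip) hm).symm
  subst hs ht
  simp

lemma ofBar_surjective : Function.Surjective (E.ofBar K) := by
  intro σ
  let b₀ := Module.finBasis ℝ (K.part 0)
  let b₁ := Module.finBasis ℝ (K.part 1)
  -- The candidate coefficients are the contractions with the dual bases. The expansion over `K ⊗ A`
  -- reassembles the generic value of `σ`, and substituting `p` gives its value at `p`.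
  choose s hs using fun n => exists_coeffEven σ (b₀.coord n)
  choose t ht using fun n => exists_coeffOdd σ (b₁.coord n)
  refine ⟨(∑ n, GTensor.tmul 0 (b₀ n) (s n), ∑ n, GTensor.tmul 1 (b₁ n) (t n)), ?_⟩
  refine family_ext_fib fun A i p m hm => ?_
  rw [fib_ofBar_sum b₀ b₁ s t p hm, ← map_desc_generic σ p m,
    E.fib_map _ _ _ (proj_generic_mem σ hm)]
  congr 1
  refine Eq.trans ?_ (Bar.sum_tensMul_contract b₀ b₁ _)
  congr 1
  · exact Finset.sum_congr rfl fun n _ => congrArg _ (hs n A i m hm)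
  · exact Finset.sum_congr rfl fun n _ => congrArg (Bar.tensOddMul (b₁ n)) (ht n A i m hm)

variable (E) in
/-- The functor of sections is represented by the super vector space of sections of the bundle and
of the bundle with reversed parity. -/
lemma gammaHatModule_isIso :
    E.gammaHatModule.IsIso (barModule E.Section E.parityFlip.Section) := by
  -- The required isomorphism goes in the direction opposite to `ofBar`, so each compatibility is
  -- checked after applying `ofBar`.
  let e : ∀ K, Bar K E.Section E.parityFlip.Section ≃ (E.family K).Section := fun K =>
    Equiv.ofBijective (E.ofBar K) ⟨ofBar_injective, ofBar_surjective⟩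
  have hadd : ∀ K (σ τ : (E.family K).Section),
      (e K).symm (σ + τ) = (e K).symm σ + (e K).symm τ := fun K σ τ => by
    rw [Equiv.symm_apply_eq]
    refine Eq.trans ?_ (map_add (E.ofBar K) _ _).symm
    exact congrArg₂ (· + ·) ((e K).apply_symm_apply σ).symm ((e K).apply_symm_apply τ).symm
  have hsmul : ∀ K (a : K.Even) (σ : (E.family K).Section),
      (e K).symm (a • σ) = a • (e K).symm σ := fun K a σ => by
    rw [Equiv.symm_apply_eq]
    refine Eq.trans ?_ (ofBar_smul a _).symm
    exact congrArg (a • ·) ((e K).apply_symm_apply σ).symm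
  have hmap : ∀ K L (φ : K ⟶ L) (σ : (E.family K).Section),
      (e L).symm (E.sectionMap φ σ) = Bar.map φ ((e K).symm σ) := fun K L φ σ => by
    rw [Equiv.symm_apply_eq]
    refine Eq.trans ?_ (ofBar_map φ _).symm
    exact congrArg (E.sectionMap φ) ((e K).apply_symm_apply σ).symm
  exact ⟨fun K => (e K).symm, hadd, hsmul, hmap⟩

end SuperVectorBundle

end

end SuperGeom

/-! ### Superrepresentability of the functor of sections. -/

theorem mainTheorem1 (M : SuperGeom.SuperManifold.{u}) (V : SuperGeom.SBanach.{u})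
    (E : SuperGeom.SuperVectorBundle M V) :
    ∃ S : SuperGeom.RbarModule E.gammaHat, E.IsPointwise S ∧ S.IsSuperrepresentable ∧
      ∃ E' : SuperGeom.SuperVectorBundle M V.flip, E.IsParityReversal E' ∧
        ∃ (_ : AddCommGroup E.Section) (_ : Module ℝ E.Section)
          (_ : AddCommGroup E'.Section) (_ : Module ℝ E'.Section),
          E.IsPointwiseSpace ∧ E'.IsPointwiseSpace ∧
            S.IsIso (SuperGeom.barModule E.Section E'.Section) :=
  ⟨E.gammaHatModule, SuperGeom.SuperVectorBundle.isPointwise_gammaHatModule,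
    ⟨E.Section, E.parityFlip.Section, inferInstance, inferInstance, inferInstance, inferInstance,
      E.gammaHatModule_isIso⟩,
    E.parityFlip, E.isParityReversal_parityFlip, inferInstance, inferInstance, inferInstance,
    inferInstance, E.isPointwiseSpace, E.parityFlip.isPointwiseSpace, E.gammaHatModule_isIso⟩
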